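/- **Definitions.** All vector spaces are over $\mathbb C$. For a graded space $M=\coprod_i M_i$ let $M'=\coprod_i M_i^*$ be its graded dual. A *meromorphic open-string vertex algebra* (MOSVA) is a space $V=\coprod_{n\in\mathbb Z}V_{(n)}$ with $V_{(n)}=0$ for $n\ll 0$, a bilinear map $Y_V:V\otimes V\to V[[x,x^{-1}]]$ and $\mathbf 1\in V$ such that, with $\mathbf d_V v=nv$ on $V_{(n)}$ and $D_Vv=\lim_{x\to0}\frac{d}{dx}Y_V(v,x)\mathbf 1$: $[\mathbf d_V,Y_V(v,x)]=x\frac{d}{dx}Y_V(v,x)+Y_V(\mathbf d_Vv,x)$; $Y_V(\mathbf 1,x)=1_V$; $Y_V(u,x)\mathbf 1\in V[[x]]$ with constant term $u$; $\frac{d}{dx}Y_V(v,x)=Y_V(D_Vv,x)=[D_V,Y_V(v,x)]$; and, for $W=V$, $Y_W=Y_V$, all $u_i\in V$, $w\in W$, $w'\in W'$: - (rationality) for all $n$, $\langle w',Y_W(u_1,z_1)\cdots Y_W(u_n,z_n)w\rangle$ converges absolutely for $|z_1|>\cdots>|z_n|>0$ to a rational function whose only possible poles are at $z_i=0$ and $z_i=z_j$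 ($i\ne j$), and $\langle w',Y_W(Y_V(u_1,z_1-z_2)u_2,z_2)w\rangle$ converges absolutely for $|z_2|>|z_1-z_2|>0$ to a rational function whose only possible poles are at $z_1=0$, $z_2=0$, $z_1=z_2$; - (associativity) $\langle w',Y_W(u_1,z_1)Y_W(u_2,z_2)w\rangle=\langle w',Y_W(Y_V(u_1,z_1-z_2)u_2,z_2)w\rangle$ for $|z_1|>|z_2|>|z_1-z_2|>0$. A *left $V$-module* is a space $W=\coprod_{m\in\mathbb C}W_{[m]}$ with $W_{[m]}=0$ for $\operatorname{Re}m\ll0$, a bilinear map $Y_W:V\otimes W\to W[[x,x^{-1}]]$, the operator $\mathbf d_W$ acting as $m$ on $W_{[m]}$ and an operator $D_W$ of weight $1$, such that $[\mathbf d_W,Y_W(u,x)]=Y_W(\mathbf d_Vu,x)+x\frac{d}{dx}Y_W(u,x)$, $Y_W(\mathbf 1,x)=1_W$, $\frac{d}{dx}Y_W(u,x)=Y_W(D_Vu,x)=[D_W,Y_W(u,x)]$, and rationality and associativity hold. The definitions of left module and of Möbius left module below also make sense over data $(V,Y,\mathbf 1,\rho)$ of the same kind with another vertex operator map $Y$ in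 place of $Y_V$. Let $\mathfrak{sl}(2)$ have basis $L_{-1},L_0,L_1$ with $[L_0,L_{-1}]=L_{-1}$, $[L_0,L_1]=-L_1$, $[L_{-1},L_1]=-2L_0$. A *Möbius MOSVA* is a MOSVA with a representation $\rho_V$ of $\mathfrak{sl}(2)$ on $V$, $L_V(j)=\rho_V(L_j)$, such that $L_V(0)=\mathbf d_V$, $L_V(-1)=D_V$ and $$[L_V(1),Y_V(u,x)]=Y_V(L_V(1)u,x)+2xY_V(L_V(0)u,x)+x^2Y_V(L_V(-1)u,x).$$ A *Möbius left $V$-module* is a left $V$-module with a representation $\rho_W$ of $\mathfrak{sl}(2)$, $L_W(j)=\rho_W(L_j)$, such that (i) $L_W(-1)=D_W$, $[L_W(0),Y_W(u,x)]=Y_W(L_V(0)u,x)+xY_W(L_V(-1)u,x)$ and $[L_W(1),Y_W(u,x)]=Y_W(L_V(1)u,x)+2xY_W(L_V(0)u,x)+x^2Y_W(L_V(-1)u,x)$; (ii) for all $n\in\mathbb C$ and $w\in W_{[n]}$ there is $m\in\mathbb N$ with $(L_W(0)-n)^mw=0$. $V^{op}$ denotes $V$ with the vertex operator $Y_V^s(u,x)v=e^{xD_V}Y_V(v,-x)u$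 and the same $\mathbf 1$, grading and $\rho_V$. **Theorem.** Let $(V,Y_V,\mathbf 1,\rho_V)$ be a Möbius MOSVA and $(W,Y_W,\rho_W)$ a Möbius left $V$-module, not necessarily with finite-dimensional weight spaces. Suppose there is a real number $C$ such that for all homogeneous $u_1,u_2\in V$, $w\in W$, $w'\in W'$, the order of the pole $z_1=0$ of the rational function given by $\langle w',Y_W(u_1,z_1)Y_W(u_2,z_2)w\rangle$ is at most $\operatorname{wt}u_1+\operatorname{Re}(\operatorname{wt}w)+C$. Then the formulas $$\langle Y_W'(u,x)w',w\rangle=\langle w',Y_W(e^{xL_V(1)}(-x^{-2})^{L_V(0)}u,x^{-1})w\rangle,\qquad \langle\rho_W'(L_j)w',w\rangle=\langle w',L_W(-j)w\rangle\quad(j=0,\pm1)$$ define a map $Y_W':V\otimes W'\to W'[[x,x^{-1}]]$ and a representation $\rho_W'$ of $\mathfrak{sl}(2)$ on $W'$ (graded by $W'_{[n]}=W_{[n]}^*$), and $(W',Y_W',\rho_W')$ is a left $V^{op}$-module satisfying condition (i) of a Möbius left $V^{op}$-module. It also satisfies (ii), that is, $(W',Y_W',\rho_W')$ is a Möbius left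 $V^{op}$-module, if and only if for every $n\in\mathbb C$ there is $m\in\mathbb N$ with $(L_W(0)-n)^mW_{[n]}=0$ (which is automatic when the weight spaces are finite-dimensional or $L_W(0)$ is semisimple). -/

import Mathlib

/-! ## Graded vector spaces and graded duals -/

/-- For `M = ⨁ i, G i`, the operator acting on `G i` as the scalar `c i`
(and the zero map if `M` is not the internal direct sum of the `G i`). -/
noncomputable def gradedScalar {ι M : Type*} [DecidableEq ι] [AddCommGroup M] [Module ℂ M]
    (G : ι → Submodule ℂ M) (c : ι → ℂ) : M →ₗ[ℂ] M :=
  open Classical in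
  if h : DirectSum.IsInternal G then
    (DirectSum.toModule ℂ ι M fun i => c i • (G i).subtype) ∘ₗ
      (LinearEquiv.ofBijective (DirectSum.coeLinearMap G) h).symm.toLinearMap
  else 0

theorem gradedScalar_apply {ι M : Type*} [DecidableEq ι] [AddCommGroup M] [Module ℂ M]
    {G : ι → Submodule ℂ M} (h : DirectSum.IsInternal G) (c : ι → ℂ) {i : ι} {x : M}
    (hx : x ∈ G i) : gradedScalar G c x = c i • x := by
  have e : (LinearEquiv.ofBijective (DirectSum.coeLinearMap G) h).symm x
      = DirectSum.lof ℂ ι (fun i => G i) i ⟨x, hx⟩ := by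
    rw [LinearEquiv.symm_apply_eq]
    exact (DirectSum.coeLinearMap_lof G i ⟨x, hx⟩).symm
  rw [gradedScalar, dif_pos h]
  simp only [LinearMap.comp_apply, LinearEquiv.coe_coe, e, DirectSum.toModule_lof]
  rfl

/-- The projection of `M = ⨁ i, G i` onto the component `G i`. -/
noncomputable def gradedProj {ι M : Type*} [DecidableEq ι] [AddCommGroup M] [Module ℂ M]
    (G : ι → Submodule ℂ M) (i : ι) : M →ₗ[ℂ] M :=
  gradedScalar G (Pi.single i 1)

/-- The copy of `(G i)^*` inside the full dual: functionals vanishing on all `G j`, `j ≠ i`. -/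
def dualPiece {ι M : Type*} [AddCommGroup M] [Module ℂ M]
    (G : ι → Submodule ℂ M) (i : ι) : Submodule ℂ (Module.Dual ℂ M) where
  carrier := {f | ∀ j, j ≠ i → ∀ x ∈ G j, f x = 0}
  add_mem' {f g} hf hg j hj x hx := by simp [hf j hj x hx, hg j hj x hx]
  zero_mem' := by simp
  smul_mem' a f hf j hj x hx := by simp [hf j hj x hx]

/-- The graded dual `M' = ∐ i, (G i)^*`, realised inside the full dual of `M`. -/
def gradedDual {ι M : Type*} [AddCommGroup M] [Module ℂ M]
    (G : ι → Submodule ℂ M) : Submodule ℂ (Module.Dual ℂ M) :=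
  ⨆ i, dualPiece G i

/-- The grading of the graded dual: the component of weight `i` is `(G i)^*`. -/
def dualGrading {ι M : Type*} [AddCommGroup M] [Module ℂ M]
    (G : ι → Submodule ℂ M) (i : ι) : Submodule ℂ (gradedDual G) :=
  (dualPiece G i).comap (gradedDual G).subtype

/-! ## Vertex operators, rationality and associativity

A vertex operator map `V ⊗ W → W[[x, x⁻¹]]` is a function `Y : V → W → ℤ → W`, where `Y u w k` is
the coefficient of `x ^ k` in `Y(u, x)w`; bilinearity is required in the definitions below. -/

/-- `Y : V → W → W[[x, x⁻¹]]` is bilinear. -/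
structure IsVertexBilinear {V W : Type*} [AddCommGroup V] [Module ℂ V] [AddCommGroup W]
    [Module ℂ W] (Y : V → W → ℤ → W) : Prop where
  left : ∀ w, IsLinearMap ℂ fun u => Y u w
  right : ∀ u, IsLinearMap ℂ fun w => Y u w

/-- The coefficient of `x₁ ^ k₁ ⋯ xₙ ^ kₙ` in `Y(u₁, x₁) ⋯ Y(uₙ, xₙ)w`. -/
def prodCoeff {V W : Type*} (Y : V → W → ℤ → W) :
    (n : ℕ) → (Fin n → V) → W → (Fin n → ℤ) → W
  | 0, _, w, _ => w
  | n + 1, u, w, k => Y (u 0) (prodCoeff Y n (Fin.tail u) w (Fin.tail k)) (k 0)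

/-- The terms of the series `⟨w', Y(u₁, z₁) ⋯ Y(uₙ, zₙ)w⟩`. -/
noncomputable def prodTerm {V W : Type*} [AddCommGroup W] [Module ℂ W] (Y : V → W → ℤ → W)
    {n : ℕ} (w' : Module.Dual ℂ W) (u : Fin n → V) (w : W) (z : Fin n → ℂ) (k : Fin n → ℤ) : ℂ :=
  w' (prodCoeff Y n u w k) * ∏ i, z i ^ k i

/-- The terms of the series `⟨w', Y_W(Y_V(u₁, z₁ - z₂)u₂, z₂)w⟩`. -/
noncomputable def iterTerm {V W : Type*} [AddCommGroup W] [Module ℂ W]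
    (YV : V → V → ℤ → V) (YW : V → W → ℤ → W) (w' : Module.Dual ℂ W) (u₁ u₂ : V) (w : W)
    (z₁ z₂ : ℂ) (k : ℤ × ℤ) : ℂ :=
  w' (YW (YV u₁ u₂ k.1) w k.2) * ((z₁ - z₂) ^ k.1 * z₂ ^ k.2)

/-- Rationality of products of any number of vertex operators. (In `ℂ`, `HasSum` over a multi-index
is absolute convergence.) -/
def ProductRationality {ι V W : Type*} [AddCommGroup W] [Module ℂ W]
    (G : ι → Submodule ℂ W) (Y : V → W → ℤ → W) : Prop :=
  ∀ (n : ℕ) (u : Fin n → V) (w : W), ∀ w' ∈ gradedDual G,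
    ∃ (f : MvPolynomial (Fin n) ℂ) (p : Fin n → ℕ) (q : Fin n → Fin n → ℕ),
      ∀ z : Fin n → ℂ, (∀ i, z i ≠ 0) → (∀ i j, i < j → ‖z j‖ < ‖z i‖) →
        HasSum (prodTerm Y w' u w z)
          (MvPolynomial.eval z f /
            ((∏ i, z i ^ p i) * ∏ i, ∏ j ∈ Finset.Ioi i, (z i - z j) ^ q i j))

/-- Rationality of iterates of two vertex operators. -/
def IterateRationality {ι V W : Type*} [AddCommGroup W] [Module ℂ W]
    (G : ι → Submodule ℂ W) (YV : V → V → ℤ → V) (YW : V → W → ℤ → W) : Prop :=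
  ∀ (u₁ u₂ : V) (w : W), ∀ w' ∈ gradedDual G,
    ∃ (f : MvPolynomial (Fin 2) ℂ) (p₁ p₂ p₁₂ : ℕ),
      ∀ z₁ z₂ : ℂ, ‖z₁ - z₂‖ < ‖z₂‖ → 0 < ‖z₁ - z₂‖ →
        HasSum (iterTerm YV YW w' u₁ u₂ w z₁ z₂)
          (MvPolynomial.eval ![z₁, z₂] f / (z₁ ^ p₁ * z₂ ^ p₂ * (z₁ - z₂) ^ p₁₂))

/-- Associativity: for `|z₁| > |z₂| > |z₁ - z₂| > 0` the product and the iterate of two vertex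
operators converge absolutely to the same sum. -/
def VertexAssociativity {ι V W : Type*} [AddCommGroup W] [Module ℂ W]
    (G : ι → Submodule ℂ W) (YV : V → V → ℤ → V) (YW : V → W → ℤ → W) : Prop :=
  ∀ (u₁ u₂ : V) (w : W), ∀ w' ∈ gradedDual G, ∀ z₁ z₂ : ℂ,
    ‖z₂‖ < ‖z₁‖ → ‖z₁ - z₂‖ < ‖z₂‖ → 0 < ‖z₁ - z₂‖ →
      ∃ s : ℂ, HasSum (prodTerm YW w' ![u₁, u₂] w ![z₁, z₂]) s ∧
        HasSum (iterTerm YV YW w' u₁ u₂ w z₁ z₂) s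

/-! ## Meromorphic open-string vertex algebras and left modules -/

/-- `D_V v = lim_{x → 0} d/dx Y_V(v, x)𝟏`. -/
def vertexD {V : Type*} (Y : V → V → ℤ → V) (vac : V) (v : V) : V := Y v vac 1

/-- `d_V`, acting on `V_(n)` as `n`. -/
noncomputable def vertexd {V : Type*} [AddCommGroup V] [Module ℂ V]
    (G : ℤ → Submodule ℂ V) : V →ₗ[ℂ] V :=
  gradedScalar G fun n => (n : ℂ)

/-- `(V, Y, vac)`, graded by `G`, is a meromorphic open-string vertex algebra. -/
structure IsMOSVA {V : Type*} [AddCommGroup V] [Module ℂ V]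
    (G : ℤ → Submodule ℂ V) (Y : V → V → ℤ → V) (vac : V) : Prop where
  internal : DirectSum.IsInternal G
  bilinear : IsVertexBilinear Y
  lower_bound : ∃ N : ℤ, ∀ n < N, G n = ⊥
  d_commutator : ∀ u v k,
    vertexd G (Y u v k) - Y u (vertexd G v) k = (k : ℂ) • Y u v k + Y (vertexd G u) v k
  identity : ∀ v k, Y vac v k = if k = 0 then v else 0
  creation_regular : ∀ u k, k < 0 → Y u vac k = 0
  creation : ∀ u, Y u vac 0 = u
  D_derivative : ∀ u v k, ((k + 1 : ℤ) : ℂ) • Y u v (k + 1) = Y (vertexD Y vac u) v k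
  D_commutator : ∀ u v k, ((k + 1 : ℤ) : ℂ) • Y u v (k + 1) =
    vertexD Y vac (Y u v k) - Y u (vertexD Y vac v) k
  product_rationality : ProductRationality G Y
  iterate_rationality : IterateRationality G Y Y
  associativity : VertexAssociativity G Y Y

/-- `(W, YW, dW, DW)`, graded by `GW`, is a left module for `(V, YV, vac)`, graded by `GV`. -/
structure IsLeftModule {V W : Type*} [AddCommGroup V] [Module ℂ V] [AddCommGroup W] [Module ℂ W]
    (GV : ℤ → Submodule ℂ V) (YV : V → V → ℤ → V) (vac : V)
    (GW : ℂ → Submodule ℂ W) (YW : V → W → ℤ → W) (dW DW : W →ₗ[ℂ] W) : Prop where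
  internal : DirectSum.IsInternal GW
  bilinear : IsVertexBilinear YW
  D_weight : ∀ m, ∀ w ∈ GW m, DW w ∈ GW (m + 1)
  lower_bound : ∃ N : ℝ, ∀ m : ℂ, m.re < N → GW m = ⊥
  d_grading : ∀ m, ∀ w ∈ GW m, dW w = m • w
  d_commutator : ∀ u w k,
    dW (YW u w k) - YW u (dW w) k = YW (vertexd GV u) w k + (k : ℂ) • YW u w k
  identity : ∀ w k, YW vac w k = if k = 0 then w else 0
  D_derivative : ∀ u w k, ((k + 1 : ℤ) : ℂ) • YW u w (k + 1) = YW (vertexD YV vac u) w k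
  D_commutator : ∀ u w k, ((k + 1 : ℤ) : ℂ) • YW u w (k + 1) = DW (YW u w k) - YW u (DW w) k
  product_rationality : ProductRationality GW YW
  iterate_rationality : IterateRationality GW YV YW
  associativity : VertexAssociativity GW YV YW

/-! ## Möbius structures -/

/-- A representation on `M` of the Lie algebra `sl(2)` with basis `L₋₁, L₀, L₁` and brackets
`[L₀, L₋₁] = L₋₁`, `[L₀, L₁] = -L₁`, `[L₋₁, L₁] = -2 L₀`, given by the images of the basis. -/
structure Sl2Rep (M : Type*) [AddCommGroup M] [Module ℂ M] where
  Lneg : Module.End ℂ M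
  Lzero : Module.End ℂ M
  Lpos : Module.End ℂ M
  bracket_zero_neg : ⁅Lzero, Lneg⁆ = Lneg
  bracket_zero_pos : ⁅Lzero, Lpos⁆ = -Lpos
  bracket_neg_pos : ⁅Lneg, Lpos⁆ = -((2 : ℂ) • Lzero)

/-- `(V, Y, vac, ρ)` is a Möbius MOSVA. -/
structure IsMobiusMOSVA {V : Type*} [AddCommGroup V] [Module ℂ V]
    (G : ℤ → Submodule ℂ V) (Y : V → V → ℤ → V) (vac : V) (ρ : Sl2Rep V) : Prop
    extends IsMOSVA G Y vac where
  Lzero_eq : ρ.Lzero = vertexd G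
  Lneg_eq : ∀ v, ρ.Lneg v = vertexD Y vac v
  Lpos_commutator : ∀ u v k, ρ.Lpos (Y u v k) - Y u (ρ.Lpos v) k =
    Y (ρ.Lpos u) v k + (2 : ℂ) • Y (ρ.Lzero u) v (k - 1) + Y (ρ.Lneg u) v (k - 2)

/-- A left module with an `sl(2)`-representation satisfying the conditions of a Möbius left module
other than local nilpotency of `L_W(0) - n` on `W_[n]`. The operator `d_W` is the one determined by
the grading, and `D_W = L_W(-1)`. -/
structure IsSl2LeftModule {V W : Type*} [AddCommGroup V] [Module ℂ V]
    [AddCommGroup W] [Module ℂ W]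
    (GV : ℤ → Submodule ℂ V) (YV : V → V → ℤ → V) (vac : V) (ρV : Sl2Rep V)
    (GW : ℂ → Submodule ℂ W) (YW : V → W → ℤ → W) (ρW : Sl2Rep W) : Prop
    extends IsLeftModule GV YV vac GW YW (gradedScalar GW fun m => m) ρW.Lneg where
  Lzero_commutator : ∀ u w k, ρW.Lzero (YW u w k) - YW u (ρW.Lzero w) k =
    YW (ρV.Lzero u) w k + YW (ρV.Lneg u) w (k - 1)
  Lpos_commutator : ∀ u w k, ρW.Lpos (YW u w k) - YW u (ρW.Lpos w) k =
    YW (ρV.Lpos u) w k + (2 : ℂ) • YW (ρV.Lzero u) w (k - 1) + YW (ρV.Lneg u) w (k - 2)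

/-- `(W, YW, ρW)` is a Möbius left module for `(V, YV, vac, ρV)`. -/
structure IsMobiusLeftModule {V W : Type*} [AddCommGroup V] [Module ℂ V]
    [AddCommGroup W] [Module ℂ W]
    (GV : ℤ → Submodule ℂ V) (YV : V → V → ℤ → V) (vac : V) (ρV : Sl2Rep V)
    (GW : ℂ → Submodule ℂ W) (YW : V → W → ℤ → W) (ρW : Sl2Rep W) : Prop
    extends IsSl2LeftModule GV YV vac ρV GW YW ρW where
  locally_nilpotent : ∀ n, ∀ w ∈ GW n, ∃ m : ℕ, ((ρW.Lzero - n • 1) ^ m) w = 0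

/-! ## Opposite vertex operators and the strong pole-order condition -/

/-- The skew-symmetry opposite vertex operator `Y^s(u, x)v = e^{x D_V} Y(v, -x)u` of `V^op`. -/
noncomputable def skewOpposite {V : Type*} [AddCommGroup V] [Module ℂ V]
    (Y : V → V → ℤ → V) (vac : V) (u v : V) (k : ℤ) : V :=
  ∑ᶠ j : ℕ, (((-1 : ℂ) ^ (k - (j : ℤ))) * ((j.factorial : ℂ)⁻¹)) •
    (vertexD Y vac)^[j] (Y v u (k - (j : ℤ)))

/-- The opposite vertex operator `Y_W^o(u, x)w = Y_W(e^{x L(1)} (-x⁻²)^{L(0)} u, x⁻¹)w`: on the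
component of `u` of weight `h` it is `∑ m, (-1)^h / m! x^{m - 2h} Y_W(L(1)^m u, x⁻¹)w`. -/
noncomputable def oppositeVertexOp {V W : Type*} [AddCommGroup V] [Module ℂ V]
    [AddCommGroup W] [Module ℂ W] (GV : ℤ → Submodule ℂ V) (ρV : Sl2Rep V)
    (YW : V → W → ℤ → W) (u : V) (w : W) (k : ℤ) : W :=
  ∑ᶠ h : ℤ, ∑ᶠ m : ℕ, (((-1 : ℂ) ^ h) * ((m.factorial : ℂ)⁻¹)) •
    YW ((ρV.Lpos ^ m) (gradedProj GV h u)) w ((m : ℤ) - 2 * h - k)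

/-- The strong pole-order condition: for homogeneous `u₁, u₂, w, w'`, the order of the pole `z₁ = 0`
of the rational function given by `⟨w', Y(u₁, z₁)Y(u₂, z₂)w⟩` is at most `wt u₁ + Re (wt w) + C`. -/
def StrongPoleOrder {V W : Type*} [AddCommGroup V] [Module ℂ V] [AddCommGroup W] [Module ℂ W]
    (GV : ℤ → Submodule ℂ V) (GW : ℂ → Submodule ℂ W) (YW : V → W → ℤ → W) : Prop :=
  ∃ C : ℝ, ∀ (n₁ n₂ : ℤ) (m m' : ℂ), ∀ u₁ ∈ GV n₁, ∀ u₂ ∈ GV n₂, ∀ w ∈ GW m,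
    ∀ w' ∈ dualPiece GW m',
      ∃ (f : MvPolynomial (Fin 2) ℂ) (p₁ : ℤ) (p₂ p₁₂ : ℕ), (p₁ : ℝ) ≤ n₁ + m.re + C ∧
        ∀ z₁ z₂ : ℂ, ‖z₂‖ < ‖z₁‖ → 0 < ‖z₂‖ →
          HasSum (prodTerm YW w' ![u₁, u₂] w ![z₁, z₂])
            (MvPolynomial.eval ![z₁, z₂] f / (z₁ ^ p₁ * z₂ ^ p₂ * (z₁ - z₂) ^ p₁₂))

/-! ## Graded spaces and graded duals -/

section Graded

variable {ι M : Type*} [AddCommGroup M] [Module ℂ M] {G : ι → Submodule ℂ M}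

/-! The grading, vacuum, derivative and sl(2) axioms for W' are transposes of termwise identities
for the opposite operator Y^o. The substance is convergence, rationality and associativity, which
must be tested against functionals φ in W''. When weight spaces are infinite-dimensional, W'' is
larger than W and φ need not be evaluation at a vector.

The way round is finite detection. Fix w' and homogeneous u₁, …, uₙ. On each W_[m], finitely many
functionals already detect whether all coefficients of ⟨w', Y(u₁,x₁)⋯Y(uₙ,xₙ)w⟩ vanish
(`exists_functionals_prodCoeff`). These coefficients, as functionals of w, therefore span a
finite-dimensional space, on which φ agrees with evaluation at an actual vector of W
(`exists_eval_eq_of_dualPiece`). After that replacement every claim about W' becomes a claim about W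
at the inverted points 1/z.

Finite detection is where the pole-order condition enters. It makes the exponent p in the weak
associativity (x+y)^p Y(u₁,x+y)Y(u₂,x)w = (x+y)^p Y(Y(u₁,y)u₂,x)w depend only on the weights of u₁
and w, not on u₂ or w' (`weakAssociativity`). The operators can then be absorbed one after another,
starting next to the innermost one, into a single Y(ξ(x),x)w with ξ a polynomial of controlled
degree. Since the weights of V are bounded below, ⟨w', Y(ξ(x),x)w⟩ has no high powers of x. Only low
powers have to be killed, and the passage back to the product is triangular
(`prodCoeff_eq_zero_of_le`).

For associativity, Y^o applied to Y^s(u₁,z₁-z₂)u₂ is rewritten through iterates of L(1)^a u₂ with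
L(1)^b u₁, in reversed order (`oppositeVertexOp_skewOpposite`). These are iterates on W at (1/z₂,
1/z₁), and inversion carries the associativity region into itself with the two variables exchanged.

The criterion for (ii) is linear algebra: an endomorphism with locally nilpotent transpose is
nilpotent (`exists_pow_eq_zero_of_dual`). -/

theorem dualPiece_le_gradedDual (i : ι) : dualPiece G i ≤ gradedDual G := le_iSup (dualPiece G) i

@[elab_as_elim]
theorem gradedDualInduction {P : Module.Dual ℂ M → Prop} {f : Module.Dual ℂ M}
    (hf : f ∈ gradedDual G) (homog : ∀ i, ∀ f ∈ dualPiece G i, P f) (zero : P 0)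
    (add : ∀ f g, P f → P g → P (f + g)) : P f :=
  Submodule.iSup_induction (dualPiece G) (motive := P) hf homog zero add

variable [DecidableEq ι]

theorem gradedInduction (h : DirectSum.IsInternal G) {P : M → Prop} (x : M)
    (homog : ∀ i, ∀ x ∈ G i, P x) (zero : P 0) (add : ∀ x y, P x → P y → P (x + y)) : P x := by
  have hx : x ∈ iSup G := by rw [h.submodule_iSup_eq_top]; trivial
  exact Submodule.iSup_induction G (motive := P) hx homog zero add

theorem gradedProj_of_mem (h : DirectSum.IsInternal G) {i : ι} {x : M} (hx : x ∈ G i) :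
    gradedProj G i x = x := by
  rw [gradedProj, gradedScalar_apply h _ hx]; simp

theorem gradedProj_of_mem_ne (h : DirectSum.IsInternal G) {i j : ι} (hij : j ≠ i) {x : M}
    (hx : x ∈ G j) : gradedProj G i x = 0 := by
  rw [gradedProj, gradedScalar_apply h _ hx, Pi.single_eq_of_ne hij, zero_smul]

theorem gradedProj_mem (h : DirectSum.IsInternal G) (i : ι) (x : M) : gradedProj G i x ∈ G i := by
  induction x using gradedInduction h with
  | homog j x hx =>
    by_cases hij : j = i
    · subst hij; rwa [gradedProj_of_mem h hx]
    · rw [gradedProj_of_mem_ne h hij hx]; exact zero_mem _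
  | zero => simp
  | add x y hx hy => rw [map_add]; exact add_mem hx hy

theorem gradedProj_support_finite (h : DirectSum.IsInternal G) (x : M) :
    {i | gradedProj G i x ≠ 0}.Finite := by
  induction x using gradedInduction h with
  | homog j x hx =>
    refine (Set.finite_singleton j).subset fun i hi => ?_
    by_contra hij
    exact hi (gradedProj_of_mem_ne h (fun e => hij e.symm) hx)
  | zero => simp
  | add x y hx hy =>
    refine (hx.union hy).subset fun i hi => ?_
    by_contra hc
    simp only [Set.mem_union, Set.mem_ofPred_eq, not_or, not_not] at hc
    exact hi (by rw [map_add, hc.1, hc.2, add_zero])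

theorem eq_zero_of_gradedProj (h : DirectSum.IsInternal G) {x : M}
    (hx : ∀ i, gradedProj G i x = 0) : x = 0 := by
  have key : x = ∑ᶠ i, gradedProj G i x := by
    clear hx
    induction x using gradedInduction h with
    | homog j x hx =>
      rw [finsum_eq_single _ j fun i hi => gradedProj_of_mem_ne h (Ne.symm hi) hx,
        gradedProj_of_mem h hx]
    | zero => simp
    | add x y hx hy =>
      simp only [map_add]
      rw [finsum_add_distrib (gradedProj_support_finite h x) (gradedProj_support_finite h y),
        ← hx, ← hy]
  rw [key]; simp [hx]

theorem gradedProj_gradedScalar (h : DirectSum.IsInternal G) (c : ι → ℂ) (i : ι) (x : M) :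
    gradedProj G i (gradedScalar G c x) = c i • gradedProj G i x := by
  induction x using gradedInduction h with
  | homog j x hx =>
    rw [gradedScalar_apply h c hx, map_smul]
    by_cases hij : j = i
    · rw [hij]
    · rw [gradedProj_of_mem_ne h hij hx]; simp
  | zero => simp
  | add x y hx hy => simp only [map_add, hx, hy, smul_add]

theorem mem_of_gradedProj_eq_zero (h : DirectSum.IsInternal G) {i : ι} {x : M}
    (hx : ∀ j, j ≠ i → gradedProj G j x = 0) : x ∈ G i := by
  have : x - gradedProj G i x = 0 := by
    refine eq_zero_of_gradedProj h fun j => ?_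
    rw [map_sub]
    by_cases hj : j = i
    · subst hj
      rw [gradedProj_of_mem h (gradedProj_mem h j x), sub_self]
    · rw [hx j hj, gradedProj_of_mem_ne h (Ne.symm hj) (gradedProj_mem h i x), sub_self]
  rw [sub_eq_zero.1 this]
  exact gradedProj_mem h i x

/-- Distinct scalars separate the components, so an eigenvector equation determines the weight.
Commutators with `d` thereby yield the weights of modes. -/
theorem mem_of_gradedScalar (h : DirectSum.IsInternal G) {c : ι → ℂ} (hc : Function.Injective c)
    {i : ι} {x : M} (hx : gradedScalar G c x = c i • x) : x ∈ G i := by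
  refine mem_of_gradedProj_eq_zero h fun j hj => ?_
  have h1 := gradedProj_gradedScalar h c j x
  rw [hx, map_smul, ← sub_eq_zero, ← sub_smul] at h1
  rcases smul_eq_zero.1 h1 with h2 | h2
  · exact absurd (hc (sub_eq_zero.1 h2)).symm hj
  · exact h2

theorem comp_gradedProj_mem_dualPiece (h : DirectSum.IsInternal G) (f : Module.Dual ℂ M) (i : ι) :
    f ∘ₗ gradedProj G i ∈ dualPiece G i := fun j hj x hx => by
  rw [LinearMap.comp_apply, gradedProj_of_mem_ne h hj hx, map_zero]

/-- Any functional on M becomes homogeneous after projecting to one component, so homogeneous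
functionals separate the points of that component. -/
theorem eq_zero_of_dualPiece (h : DirectSum.IsInternal G) {i : ι} {x : M} (hx : x ∈ G i)
    (h0 : ∀ f ∈ dualPiece G i, f x = 0) : x = 0 := by
  rw [← Module.forall_dual_apply_eq_zero_iff ℂ]
  intro f
  have := h0 _ (comp_gradedProj_mem_dualPiece h f i)
  rwa [LinearMap.comp_apply, gradedProj_of_mem h hx] at this

theorem dualPiece_apply_eq (h : DirectSum.IsInternal G) {i : ι} {f : Module.Dual ℂ M}
    (hf : f ∈ dualPiece G i) (x : M) : f x = f (gradedProj G i x) := by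
  induction x using gradedInduction h with
  | homog j x hx =>
    by_cases hij : j = i
    · subst hij; rw [gradedProj_of_mem h hx]
    · rw [gradedProj_of_mem_ne h hij hx, hf j hij x hx, map_zero]
  | zero => simp
  | add x y hx hy => rw [map_add, map_add, map_add, hx, hy]

/-- An element of the i-th piece is determined by its values on `G i`, where all other pieces
vanish; this gives independence. -/
theorem dualGrading_internal (h : DirectSum.IsInternal G) :
    DirectSum.IsInternal (dualGrading G) := by
  refine DirectSum.isInternal_submodule_of_iSupIndep_of_iSup_eq_top ?_ ?_
  · intro i
    rw [Submodule.disjoint_def]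
    intro f hf hf'
    have hv : ∀ x ∈ G i, (f : Module.Dual ℂ M) x = 0 := by
      intro x hx
      clear hf
      simp only [iSup_subtype'] at hf'
      induction hf' using Submodule.iSup_induction' with
      | mem j g hg => exact hg i j.2.symm x hx
      | zero => rfl
      | add g g' _ _ h1 h2 =>
        change (g : Module.Dual ℂ M) x + (g' : Module.Dual ℂ M) x = 0
        rw [h1, h2, add_zero]
    ext x
    exact (dualPiece_apply_eq h hf x).trans (hv _ (gradedProj_mem h i x))
  · rw [eq_top_iff]
    rintro ⟨f, hf⟩ -
    unfold gradedDual at hf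
    induction hf using Submodule.iSup_induction' with
    | mem i f hf => exact Submodule.mem_iSup_of_mem i hf
    | zero => exact zero_mem _
    | add f g hf hg h1 h2 => exact add_mem h1 h2

end Graded

/-! ## Laurent series in one variable -/

section Laurent

theorem HasSum.of_eq {ι E : Type*} [AddCommMonoid E] [TopologicalSpace E] {f g : ι → E} {s t : E}
    (h : HasSum f s) (hf : ∀ k, g k = f k) (hs : t = s) : HasSum g t := by
  rwa [hs, funext hf]

theorem hasSum_int_iff_nat {E : Type*} [AddCommMonoid E] [TopologicalSpace E] {f : ℤ → E} {N : ℤ}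
    (hf : ∀ k < N, f k = 0) {s : E} : HasSum f s ↔ HasSum (fun j : ℕ => f (N + j)) s := by
  have hinj : Function.Injective fun j : ℕ => N + (j : ℤ) := fun a b h => by simpa using h
  refine (hinj.hasSum_iff fun k hk => hf k ?_).symm
  by_contra hc
  exact hk ⟨(k - N).toNat, by simp only; omega⟩

/-- Divided by its leading power, the series tends to its lowest coefficient as t → 0, so that
coefficient is zero. Induction moves the lower bound up. -/
theorem laurent_eq_zero {c : ℤ → ℂ} {N : ℤ} (hN : ∀ k < N, c k = 0)
    (h : ∀ t : ℝ, 0 < t → t < 1 → HasSum (fun k : ℤ => c k * (t : ℂ) ^ k) 0) : c = 0 := by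
  have key : ∀ n : ℕ, ∀ k < N + n, c k = 0 := by
    intro n
    induction n with
    | zero => simpa using hN
    | succ n ih =>
      intro k hk
      by_cases hkn : k < N + n
      · exact ih k hkn
      have hk' : k = N + n := by push_cast at hk; omega
      rw [← hk'] at ih
      have hs : ∀ t : ℝ, 0 < t → t < 1 → HasSum (fun j : ℕ => c (k + j) * (t : ℂ) ^ j) 0 := by
        intro t h0 h1
        have ht : (t : ℂ) ≠ 0 := by exact_mod_cast h0.ne'
        have := ((hasSum_int_iff_nat (N := k) fun l hl => by rw [ih l hl, zero_mul]).1
          (h t h0 h1)).mul_right ((t : ℂ) ^ (-k))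
        rw [zero_mul] at this
        refine this.of_eq (fun j => ?_) rfl
        rw [mul_assoc, ← zpow_add₀ ht, show k + (j : ℤ) + -k = j by ring, zpow_natCast]
      have hsum : Summable fun j : ℕ => ‖c (k + (j + 1 : ℕ))‖ * (1 / 2 : ℝ) ^ (j + 1) := by
        have := ((summable_nat_add_iff 1).2 (hs (1 / 2) (by norm_num) (by norm_num)).summable).norm
        refine this.congr fun j => ?_
        rw [norm_mul, norm_pow, Complex.norm_real]
        norm_num
      -- The tail is O(t): for t < 1/2 it is dominated by 2t times the absolutely convergent tail at
      -- 1/2.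
      have hb : ∀ t : ℝ, 0 < t → t < 1 / 2 →
          ‖c k‖ ≤ 2 * t * ∑' j : ℕ, ‖c (k + (j + 1 : ℕ))‖ * (1 / 2 : ℝ) ^ (j + 1) := by
        intro t h0 h1
        have h2 := hs t h0 (by linarith)
        have h3 : c k = -∑' j : ℕ, c (k + (j + 1 : ℕ)) * (t : ℂ) ^ (j + 1) := by
          have := h2.summable.tsum_eq_zero_add
          rw [h2.tsum_eq] at this
          simp only [Nat.cast_zero, add_zero, pow_zero, mul_one] at this
          linear_combination -this
        rw [h3, norm_neg, ← tsum_mul_left]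
        refine tsum_of_norm_bounded (hsum.mul_left (2 * t)).hasSum fun j => ?_
        rw [norm_mul, norm_pow, Complex.norm_real, Real.norm_of_nonneg h0.le]
        have h4 : t ^ (j + 1) ≤ 2 * t * (1 / 2) ^ (j + 1) := by
          have h5 : (2 * t) ^ (j + 1) ≤ 2 * t := by
            calc (2 * t) ^ (j + 1) ≤ (2 * t) ^ 1 :=
                  pow_le_pow_of_le_one (by linarith) (by linarith) (by omega)
              _ = 2 * t := pow_one _
          calc t ^ (j + 1) = (2 * t) ^ (j + 1) * (1 / 2) ^ (j + 1) := by
                rw [← mul_pow]; congr 1; ring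
            _ ≤ _ := by gcongr
        calc _ ≤ ‖c (k + (j + 1 : ℕ))‖ * (2 * t * (1 / 2) ^ (j + 1)) := by gcongr
          _ = _ := by ring
      set B := ∑' j : ℕ, ‖c (k + (j + 1 : ℕ))‖ * (1 / 2 : ℝ) ^ (j + 1) with hB
      have hB0 : 0 ≤ B := tsum_nonneg fun j => by positivity
      by_contra hc
      have hpos : 0 < ‖c k‖ := norm_pos_iff.2 hc
      -- This t makes the bound at most half of ‖c k‖, a contradiction; B + 1 guards against B = 0.
      have h6 := hb (min (1 / 4) (‖c k‖ / (4 * (B + 1)))) (by positivity)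
        (lt_of_le_of_lt (min_le_left _ _) (by norm_num))
      have h7 : 2 * min (1 / 4) (‖c k‖ / (4 * (B + 1))) * B
          ≤ 2 * (‖c k‖ / (4 * (B + 1))) * (B + 1) := by
        gcongr
        · exact min_le_right _ _
        · linarith
      have h8 : 2 * (‖c k‖ / (4 * (B + 1))) * (B + 1) = ‖c k‖ / 2 := by field_simp; norm_num
      linarith
  funext k
  exact key (k - N + 1).toNat k (by omega)

theorem hasSum_int_choose {A : ℤ} {τ : ℂ} (hτ : ‖τ‖ < 1) :
    HasSum (fun j : ℕ => ((Ring.choose A j : ℤ) : ℂ) * τ ^ j) ((1 + τ) ^ A) := by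
  have h := (Complex.one_add_cpow_hasFPowerSeriesOnBall_zero (a := A)).hasSum
    (y := τ) (by simpa [Metric.mem_eball, enorm_eq_nnnorm, ← NNReal.coe_lt_one] using hτ)
  simp only [zero_add, Complex.cpow_intCast] at h
  refine h.of_eq (fun j => ?_) rfl
  rw [binomialSeries_apply, smul_eq_mul, List.ofFn_const, List.prod_replicate]
  congr 1
  exact Ring.map_choose (Int.castRingHom ℂ) A j

/-- Upper negation makes the upper entry of the second binomial independent of j, and Vandermonde's
identity applies. It later merges the binomials coming from L(-1) and from L(1). -/
theorem sum_neg_one_pow_choose (A B : ℤ) (n : ℕ) :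
    ∑ j ∈ Finset.range (n + 1), (-1) ^ j * Ring.choose A j * Ring.choose (B - j) (n - j)
      = Ring.choose (B - A) n := by
  have neg : ∀ (r : ℤ) (k : ℕ), Ring.choose r k = (-1) ^ k * Ring.choose (k - r - 1) k := by
    intro r k
    have := Ring.choose_neg (-r) k
    rw [neg_neg] at this
    rw [this, Int.negOnePow_def]
    rw [show -r + (k : ℤ) - 1 = k - r - 1 by ring]
    simp [Units.smul_def]
  rw [neg (B - A) n, show (n : ℤ) - (B - A) - 1 = A + (n - B - 1) by ring,
    Ring.add_choose_eq _ (Commute.all _ _), Finset.Nat.sum_antidiagonal_eq_sum_range_succ_mk,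
    Finset.mul_sum]
  refine Finset.sum_congr rfl fun j hj => ?_
  have hj' : j ≤ n := Nat.lt_succ_iff.1 (Finset.mem_range.1 hj)
  rw [neg (B - j) (n - j)]
  have e1 : ((n - j : ℕ) : ℤ) - (B - j) - 1 = n - B - 1 := by push_cast [hj']; ring
  have e2 : (-1 : ℤ) ^ n = (-1) ^ j * (-1) ^ (n - j) := by rw [← pow_add]; congr 1; omega
  rw [e1, e2]; simp only; ring

/-- Multiplication of a Laurent series by the variable. -/
def laurentShift : (ℤ → ℂ) →ₗ[ℂ] (ℤ → ℂ) where
  toFun a k := a (k - 1)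
  map_add' _ _ := rfl
  map_smul' _ _ := rfl

theorem laurentShift_pow (n : ℕ) (a : ℤ → ℂ) (k : ℤ) : (laurentShift ^ n) a k = a (k - n) := by
  induction n generalizing k with
  | zero => simp
  | succ n ih =>
    rw [pow_succ']
    change (laurentShift ^ n) a (k - 1) = _
    rw [ih]; congr 1; push_cast; ring

open Polynomial in
theorem hasSum_aeval_laurentShift {a : ℤ → ℂ} {z s : ℂ} (hz : z ≠ 0)
    (h : HasSum (fun k : ℤ => a k * z ^ k) s) (P : ℂ[X]) :
    HasSum (fun k : ℤ => aeval laurentShift P a k * z ^ k) (P.eval z * s) := by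
  induction P using Polynomial.induction_on with
  | C c =>
    simpa [Module.algebraMap_end_apply, mul_assoc] using h.mul_left c
  | add P Q hP hQ =>
    simpa [add_mul] using hP.add hQ
  | monomial n c ih =>
    have h1 := (ih.mul_left z)
    rw [← (Equiv.subRight (1 : ℤ)).hasSum_iff] at h1
    refine h1.of_eq (fun k => ?_) (by simp; ring)
    · rw [pow_succ', ← mul_assoc, mul_comm (C c) X, mul_assoc, map_mul, aeval_X]
      change _ = z * ((aeval laurentShift (C c * X ^ n)) a (k - 1) * z ^ (k - 1))
      rw [zpow_sub_one₀ hz]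
      field_simp
      rfl

/-- The substitution `z = 1 + t` in a series in `z` with finitely many positive powers, expanded
in negative powers of `t`. -/
noncomputable def laurentTranslate (a : ℤ → ℂ) (i : ℤ) : ℂ :=
  ∑ᶠ j : ℕ, ((Ring.choose (i + j) j : ℤ) : ℂ) * a (i + j)

theorem laurentTranslate_eq_sum {a : ℤ → ℂ} {K : ℤ} (ha : ∀ k, K < k → a k = 0) (i : ℤ) {n : ℕ}
    (hn : K < i + n) :
    laurentTranslate a i = ∑ j ∈ Finset.range n, ((Ring.choose (i + j) j : ℤ) : ℂ) * a (i + j) := by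
  refine finsum_eq_sum_of_support_subset _ fun j hj => ?_
  rw [Function.mem_support] at hj
  simp only [Finset.coe_range, Set.mem_Iio]
  by_contra hc
  exact hj (by rw [ha _ (by omega), mul_zero])

/-- Pascal's rule: multiplication by z turns into multiplication by 1 + t. -/
theorem laurentTranslate_shift {a : ℤ → ℂ} {K : ℤ} (ha : ∀ k, K < k → a k = 0) :
    laurentTranslate (laurentShift a) = laurentShift (laurentTranslate a) + laurentTranslate a := by
  funext i
  set n := (K - i + 1).toNat
  have hn : K < i + n := by omega
  rw [laurentTranslate_eq_sum (a := laurentShift a) (K := K + 1) (n := n + 1)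
    (fun k hk => ha (k - 1) (by omega)) i (by push_cast; omega)]
  change _ = laurentTranslate a (i - 1) + laurentTranslate a i
  rw [laurentTranslate_eq_sum ha (n := n + 1) (i - 1) (by push_cast; omega),
    laurentTranslate_eq_sum ha i hn, Finset.sum_range_succ', Finset.sum_range_succ']
  have e : ∀ j : ℕ, laurentShift a (i + (j + 1 : ℕ)) = a (i + j) := fun j => by
    change a _ = _; congr 1; push_cast; ring
  have e' : ∀ j : ℕ, i - 1 + ((j + 1 : ℕ) : ℤ) = i + j := fun j => by push_cast; ring
  have e'' : ∀ j : ℕ, Ring.choose (i + ((j + 1 : ℕ) : ℤ)) (j + 1)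
      = Ring.choose (i + j) j + Ring.choose (i + j) (j + 1) := fun j => by
    rw [← Ring.choose_succ_succ]; congr 1; push_cast; ring
  simp only [e, e', e'', Int.cast_add, add_mul, Finset.sum_add_distrib]
  simp only [Nat.cast_zero, add_zero, Ring.choose_zero_right]
  change _ + _ * a (i - 1) = _
  ring

theorem laurentTranslate_add {a b : ℤ → ℂ} {K L : ℤ} (ha : ∀ k, K < k → a k = 0)
    (hb : ∀ k, L < k → b k = 0) :
    laurentTranslate (a + b) = laurentTranslate a + laurentTranslate b := by
  funext i
  set n := (max K L - i + 1).toNat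
  rw [Pi.add_apply, laurentTranslate_eq_sum (K := max K L) (n := n) _ i (by omega),
    laurentTranslate_eq_sum ha (n := n) i (by omega),
    laurentTranslate_eq_sum hb (n := n) i (by omega), ← Finset.sum_add_distrib]
  · exact Finset.sum_congr rfl fun j _ => by rw [Pi.add_apply, mul_add]
  · intro k hk
    rw [Pi.add_apply, ha k (by omega), hb k (by omega), add_zero]

theorem laurentTranslate_smul (c : ℂ) (a : ℤ → ℂ) :
    laurentTranslate (c • a) = c • laurentTranslate a := by
  funext i
  rw [Pi.smul_apply, laurentTranslate, laurentTranslate, smul_finsum]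
  exact finsum_congr fun j => by simp only [Pi.smul_apply, smul_eq_mul]; ring

open Polynomial in
theorem aeval_laurentShift_bounded {a : ℤ → ℂ} {K : ℤ} (ha : ∀ k, K < k → a k = 0) (P : ℂ[X]) :
    ∃ L : ℤ, ∀ k, L < k → aeval laurentShift P a k = 0 := by
  induction P using Polynomial.induction_on' with
  | add P Q hP hQ =>
    obtain ⟨L, hL⟩ := hP
    obtain ⟨L', hL'⟩ := hQ
    refine ⟨max L L', fun k hk => ?_⟩
    rw [map_add, LinearMap.add_apply, Pi.add_apply, hL k (by omega), hL' k (by omega), add_zero]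
  | monomial n c =>
    refine ⟨K + n, fun k hk => ?_⟩
    rw [aeval_monomial]
    change c • (laurentShift ^ n) a k = 0
    rw [laurentShift_pow, ha _ (by omega), smul_zero]

open Polynomial in
-- The substitution intertwines z with 1 + t. Upper boundedness is carried along because the finite
-- sums defining the substitution, and with them additivity, depend on it.
theorem laurentTranslate_aeval {a : ℤ → ℂ} {K : ℤ} (ha : ∀ k, K < k → a k = 0) (P : ℂ[X]) :
    laurentTranslate (aeval laurentShift P a)
      = aeval (laurentShift + 1) P (laurentTranslate a) := by
  induction P using Polynomial.induction_on with
  | C c => simpa [Module.algebraMap_end_apply] using laurentTranslate_smul c a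
  | add P Q hP hQ =>
    obtain ⟨L, hL⟩ := aeval_laurentShift_bounded ha P
    obtain ⟨L', hL'⟩ := aeval_laurentShift_bounded ha Q
    rw [map_add, LinearMap.add_apply, laurentTranslate_add hL hL', hP, hQ, map_add,
      LinearMap.add_apply]
  | monomial n c ih =>
    obtain ⟨L, hL⟩ := aeval_laurentShift_bounded ha (C c * X ^ n)
    have e : C c * X ^ (n + 1) = X * (C c * X ^ n) := by ring
    rw [e, map_mul (aeval laurentShift) X, map_mul (aeval (laurentShift + 1)) X, aeval_X, aeval_X,
      Module.End.mul_apply, Module.End.mul_apply,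
      laurentTranslate_shift hL, ih]
    rfl

end Laurent

/-! ### Comparing two expansions of one rational function -/

section Laurent

theorem hasSum_ite_zero (z : ℂ) :
    HasSum (fun k : ℤ => (Pi.single 0 1 : ℤ → ℂ) k * z ^ k) 1 := by
  refine (hasSum_ite_eq (0 : ℤ) (1 : ℂ)).of_eq (fun k => ?_) rfl
  by_cases hk : k = 0
  · simp [hk]
  · simp [hk]

open Polynomial in
theorem aeval_laurentShift_bounded_below {b : ℤ → ℂ} {N : ℤ} (hb : ∀ k < N, b k = 0) (P : ℂ[X]) :
    ∀ k < N, aeval laurentShift P b k = 0 := by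
  induction P using Polynomial.induction_on' with
  | add P Q hP hQ =>
    intro k hk
    rw [map_add, LinearMap.add_apply, Pi.add_apply, hP k hk, hQ k hk, add_zero]
  | monomial n c =>
    intro k hk
    rw [aeval_monomial]
    change c • (laurentShift ^ n) b k = 0
    rw [laurentShift_pow, hb _ (by omega), smul_zero]

/-- Powers of t can be cancelled even in two-sided series. Powers of 1 + t cannot, since 1 + t kills
∑ (-1)^k t^k; this is why the factor (1 + t)^p stays in the comparison of expansions. -/
theorem laurentShift_pow_injective (n : ℕ) : Function.Injective (laurentShift ^ n) := by
  intro a b h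
  funext k
  have := congrFun h (k + n)
  rwa [laurentShift_pow, laurentShift_pow, add_sub_cancel_right] at this

theorem laurentTranslate_single : laurentTranslate (Pi.single 0 1) = Pi.single 0 1 := by
  funext i
  rw [laurentTranslate_eq_sum (K := 0) (n := (1 - i).toNat)
    (fun k hk => Pi.single_eq_of_ne (by omega) _) i (by omega)]
  by_cases hi : i = 0
  · subst hi; simp
  rw [Pi.single_eq_of_ne hi]
  refine Finset.sum_eq_zero fun j hj => ?_
  by_cases hij : i + j = 0
  · rw [hij]
    obtain ⟨j, rfl⟩ : ∃ l, j = l + 1 := ⟨j - 1, by omega⟩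
    rw [Ring.choose_zero_succ]; simp
  · rw [Pi.single_eq_of_ne hij, mul_zero]

open Polynomial in
/-- If a series in `z` convergent for `z > 1` and a series in `t` convergent for `0 < t < 1` are
expansions of one rational function with `z = 1 + t`, poles at `z = 0` of order at most `p` and at
`z = 1`, then the product of `z ^ p` with either has the same expansion in `t`. -/
theorem sum_choose_mul_eq_laurentTranslate {a b : ℤ → ℂ} {K N : ℤ} (ha : ∀ k, K < k → a k = 0)
    (hb : ∀ k < N, b k = 0) (g : ℂ[X]) (p q : ℕ)
    (hA : ∀ z : ℝ, 1 < z → HasSum (fun k : ℤ => a k * (z : ℂ) ^ k)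
      (g.eval (z : ℂ) / ((z : ℂ) ^ p * ((z : ℂ) - 1) ^ q)))
    (hB : ∀ t : ℝ, 0 < t → t < 1 → HasSum (fun k : ℤ => b k * (t : ℂ) ^ k)
      (g.eval (1 + (t : ℂ)) / ((1 + (t : ℂ)) ^ p * (t : ℂ) ^ q))) (i : ℤ) :
    ∑ s ∈ Finset.range (p + 1), (p.choose s : ℂ) * b (i - p + s)
      = ∑ᶠ j : ℕ, ((Ring.choose (i + j) j : ℤ) : ℂ) * a (i + j - p) := by
  -- Clearing denominators in the expansion at infinity gives a polynomial identity. The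
  -- substitution z = 1/t reduces uniqueness there to series bounded below.
  have h1 : aeval laurentShift ((X - 1 : ℂ[X]) ^ q * X ^ p) a
      = aeval laurentShift g (Pi.single 0 1) := by
    obtain ⟨L, hL⟩ := aeval_laurentShift_bounded ha ((X - 1 : ℂ[X]) ^ q * X ^ p)
    obtain ⟨L', hL'⟩ := aeval_laurentShift_bounded (a := Pi.single 0 1) (K := 0)
      (fun k hk => Pi.single_eq_of_ne (by omega) _) g
    have key : (fun k : ℤ => aeval laurentShift ((X - 1 : ℂ[X]) ^ q * X ^ p) a (-k)
        - aeval laurentShift g (Pi.single 0 1) (-k)) = 0 := by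
      refine laurent_eq_zero (N := -max L L') (fun k hk => ?_) fun t h0 h1 => ?_
      · rw [hL _ (by omega), hL' _ (by omega), sub_zero]
      · have hz : 1 < t⁻¹ := (one_lt_inv₀ h0).2 h1
        have hz0 : ((t⁻¹ : ℝ) : ℂ) ≠ 0 := by
          exact_mod_cast (inv_pos.2 h0).ne'
        have hz1 : ((t⁻¹ : ℝ) : ℂ) - 1 ≠ 0 := by
          rw [sub_ne_zero]; exact_mod_cast hz.ne'
        have e1 := hasSum_aeval_laurentShift hz0 (hA _ hz) ((X - 1 : ℂ[X]) ^ q * X ^ p)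
        have e2 := hasSum_aeval_laurentShift hz0 (hasSum_ite_zero _) g
        have e3 := e1.sub e2
        rw [← (Equiv.neg ℤ).hasSum_iff] at e3
        refine e3.of_eq (fun k => ?_) ?_
        · simp only [Function.comp_apply, Equiv.neg_apply, Complex.ofReal_inv, inv_zpow', neg_neg,
            sub_mul]
        · simp only [eval_mul, eval_pow, eval_sub, eval_X, eval_one]
          generalize ((t⁻¹ : ℝ) : ℂ) = z at hz0 hz1
          field_simp
          simp
    funext k
    have := congrFun key (-k)
    simp only [neg_neg, Pi.zero_apply] at this
    exact sub_eq_zero.1 this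
  -- The same in the expansion at t = 0, for the polynomial g(1 + t).
  have h2 : aeval laurentShift ((X : ℂ[X]) ^ q * (X + 1) ^ p) b
      = aeval laurentShift (g.comp (X + 1)) (Pi.single 0 1) := by
    rw [← sub_eq_zero]
    refine laurent_eq_zero (N := min N 0) (fun k hk => ?_) fun t h0 h1 => ?_
    · rw [Pi.sub_apply, aeval_laurentShift_bounded_below hb _ _ (by omega),
        aeval_laurentShift_bounded_below (N := 0)
          (fun k hk => Pi.single_eq_of_ne (by omega) _) _ _ (by omega), sub_zero]
    · have ht : (t : ℂ) ≠ 0 := by exact_mod_cast h0.ne'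
      have ht1 : 1 + (t : ℂ) ≠ 0 := by
        have : (1 + t : ℝ) ≠ 0 := by positivity
        exact_mod_cast this
      have e1 := hasSum_aeval_laurentShift ht (hB t h0 h1) ((X : ℂ[X]) ^ q * (X + 1) ^ p)
      have e2 := hasSum_aeval_laurentShift ht (hasSum_ite_zero _) (g.comp (X + 1))
      refine (e1.sub e2).of_eq (fun k => by rw [Pi.sub_apply, sub_mul]) ?_
      simp only [eval_mul, eval_pow, eval_add, eval_X, eval_one, eval_comp]
      rw [add_comm (t : ℂ) 1]
      field_simp
      simp
  -- Translating the first identity by z = 1 + t gives the same right-hand side as the second; only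
  -- the factor t^q remains to be cancelled.
  have h3 : (laurentShift ^ q) (aeval (laurentShift + 1) (X ^ p : ℂ[X]) (laurentTranslate a))
      = (laurentShift ^ q) (((laurentShift + 1) ^ p) b) := by
    have e1 := laurentTranslate_aeval ha ((X - 1 : ℂ[X]) ^ q * X ^ p)
    rw [h1, laurentTranslate_aeval (K := 0) (fun k hk => Pi.single_eq_of_ne (by omega) _),
      laurentTranslate_single] at e1
    have e2 : aeval laurentShift (g.comp (X + 1)) = aeval (laurentShift + 1) g := by
      rw [aeval_comp]; simp
    rw [e2, e1] at h2
    simpa using h2.symm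
  have h4 := laurentShift_pow_injective q h3
  rw [← laurentTranslate_aeval ha] at h4
  have h5 := congrFun h4 i
  have e5 : ((laurentShift + 1) ^ p) b i
      = ∑ m ∈ Finset.range (p + 1), (p.choose m : ℂ) * b (i - m) := by
    rw [(Commute.one_right laurentShift).add_pow]
    simp only [one_pow, mul_one, LinearMap.sum_apply, Finset.sum_apply]
    refine Finset.sum_congr rfl fun m _ => ?_
    rw [← nsmul_eq_mul', LinearMap.smul_apply, Pi.smul_apply, laurentShift_pow, nsmul_eq_mul]
  rw [e5] at h5
  have e6 : laurentTranslate (aeval laurentShift (X ^ p : ℂ[X]) a) i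
      = ∑ᶠ j : ℕ, ((Ring.choose (i + j) j : ℤ) : ℂ) * a (i + j - p) := by
    simp only [map_pow, aeval_X]
    exact finsum_congr fun j => by rw [laurentShift_pow]
  rw [← e6, h5, ← Finset.sum_range_reflect]
  refine Finset.sum_congr rfl fun s hs => ?_
  have hs' : s ≤ p := Nat.lt_succ_iff.1 (Finset.mem_range.1 hs)
  rw [show p + 1 - 1 - s = p - s by omega, Nat.choose_symm hs', Nat.cast_sub hs']
  congr 2; ring

theorem hasSum_mul_complex {ι κ : Type*} {f : ι → ℂ} {g : κ → ℂ} {s t : ℂ} (hf : HasSum f s)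
    (hg : HasSum g t) : HasSum (fun x : ι × κ => f x.1 * g x.2) (s * t) :=
  hf.mul hg (summable_mul_of_summable_norm hf.summable.norm hg.summable.norm)

/-- The Cauchy product with the binomial series, grouped by the total power of τ. Truncation of β
makes every group finite, so the `finsum` is the true sum. -/
theorem hasSum_choose_mul {β : ℤ → ℂ} {A N : ℤ} {τ S : ℂ} (hτ0 : τ ≠ 0) (hτ : ‖τ‖ < 1)
    (hβ : ∀ k < N, β k = 0) (h : HasSum (fun k : ℤ => β k * τ ^ k) S) :
    HasSum (fun K : ℤ => (∑ᶠ j : ℕ, ((Ring.choose A j : ℤ) : ℂ) * β (K - j)) * τ ^ K)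
      ((1 + τ) ^ A * S) := by
  have h1 := hasSum_int_choose (A := A) hτ
  generalize hC : (fun j : ℕ => ((Ring.choose A j : ℤ) : ℂ)) = C at *
  have hC' : ∀ j : ℕ, ((Ring.choose A j : ℤ) : ℂ) = C j := fun j => congrFun hC j
  simp only [hC'] at h1 ⊢
  have h2 := hasSum_mul_complex h1 h
  let e : ℤ × ℕ ≃ ℕ × ℤ :=
    { toFun := fun x => (x.2, x.1 - x.2)
      invFun := fun x => (x.2 + x.1, x.1)
      left_inv := fun x => by simp
      right_inv := fun x => by simp }
  rw [← e.hasSum_iff] at h2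
  refine (h2.prod_fiberwise fun K => ?_)
  have hfin : (Function.support fun j : ℕ => C j * β (K - j)).Finite := by
    refine (Finset.range (K - N + 1).toNat).finite_toSet.subset fun j hj => ?_
    rw [Function.mem_support] at hj
    simp only [Finset.coe_range, Set.mem_Iio]
    by_contra hc
    exact hj (by rw [hβ _ (by omega), mul_zero])
  rw [finsum_eq_sum _ hfin]
  have h3 : HasSum (fun j : ℕ => C j * β (K - j))
      (∑ j ∈ hfin.toFinset, C j * β (K - j)) :=
    hasSum_sum_of_ne_finset_zero fun j hj => by
      by_contra hc
      exact hj (hfin.mem_toFinset.2 hc)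
  refine (h3.mul_right (τ ^ K)).of_eq (fun j => ?_) rfl
  simp only [Function.comp_apply, e, Equiv.coe_fn_mk]
  rw [zpow_sub₀ hτ0, zpow_natCast]
  field_simp

end Laurent

/-! ## Modes of vertex operators -/

/-- The definition peels off the outermost operator; inductions that absorb operators into the
vector, and transposition, need the innermost one. -/
theorem prodCoeff_last {V W : Type*} (Y : V → W → ℤ → W) (n : ℕ) (u : Fin (n + 1) → V) (w : W)
    (k : Fin (n + 1) → ℤ) : prodCoeff Y (n + 1) u w k
      = prodCoeff Y n (Fin.init u) (Y (u (Fin.last n)) w (k (Fin.last n))) (Fin.init k) := by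
  induction n with
  | zero => rfl
  | succ n ih =>
    rw [prodCoeff, ih]
    rfl

theorem prodCoeff_two {V W : Type*} (Y : V → W → ℤ → W) (u : Fin 2 → V) (w : W) (k : Fin 2 → ℤ) :
    prodCoeff Y 2 u w k = Y (u 0) (Y (u 1) w (k 1)) (k 0) := rfl

/-- A family supported in a box may be summed by total degree. The largest degree occurring is A + B
- 2, hence the bound on M. -/
theorem sum_antidiagonal_box {E : Type*} [AddCommMonoid E] {f : ℕ → ℕ → E} {A B M : ℕ}
    (hA : ∀ a b, A ≤ a → f a b = 0) (hB : ∀ a b, B ≤ b → f a b = 0) (hM : A + B ≤ M + 1) :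
    ∑ s ∈ Finset.range M, ∑ x ∈ Finset.HasAntidiagonal.antidiagonal s, f x.1 x.2
      = ∑ a ∈ Finset.range A, ∑ b ∈ Finset.range B, f a b := by
  rw [← Finset.sum_product', Finset.sum_sigma']
  refine Finset.sum_bij_ne_zero (fun x _ _ => x.2) ?_ ?_ ?_ ?_
  · rintro ⟨s, a, b⟩ _ hne
    simp only [Finset.mem_product, Finset.mem_range]
    constructor
    · by_contra hc; exact hne (hA _ _ (not_lt.1 hc))
    · by_contra hc; exact hne (hB _ _ (not_lt.1 hc))
  · rintro ⟨s, a, b⟩ h1 _ ⟨s', a', b'⟩ h2 _ h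
    simp only [Finset.mem_sigma, Finset.HasAntidiagonal.mem_antidiagonal] at h1 h2
    obtain ⟨rfl, rfl⟩ := Prod.mk.inj h
    obtain rfl : s = s' := by omega
    rfl
  · rintro ⟨a, b⟩ h hne
    simp only [Finset.mem_product, Finset.mem_range] at h
    exact ⟨⟨a + b, a, b⟩, by simp; omega, hne, rfl⟩
  · intros; rfl

section Modes

variable {V W : Type*} [AddCommGroup V] [Module ℂ V] [AddCommGroup W] [Module ℂ W]

namespace IsVertexBilinear

variable {Y : V → W → ℤ → W}

theorem add_left (hY : IsVertexBilinear Y) (u u' : V) (w : W) (k : ℤ) :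
    Y (u + u') w k = Y u w k + Y u' w k :=
  congrFun ((hY.left w).map_add u u') k

theorem smul_left (hY : IsVertexBilinear Y) (c : ℂ) (u : V) (w : W) (k : ℤ) :
    Y (c • u) w k = c • Y u w k :=
  congrFun ((hY.left w).map_smul c u) k

theorem add_right (hY : IsVertexBilinear Y) (u : V) (w w' : W) (k : ℤ) :
    Y u (w + w') k = Y u w k + Y u w' k :=
  congrFun ((hY.right u).map_add w w') k

theorem smul_right (hY : IsVertexBilinear Y) (c : ℂ) (u : V) (w : W) (k : ℤ) :
    Y u (c • w) k = c • Y u w k :=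
  congrFun ((hY.right u).map_smul c w) k

/-- The coefficient of `x ^ k` in `Y(u, x)w`, as a bilinear map. -/
def mode (hY : IsVertexBilinear Y) (k : ℤ) : V →ₗ[ℂ] Module.End ℂ W :=
  LinearMap.mk₂ ℂ (fun u w => Y u w k) (fun u u' w => hY.add_left u u' w k)
    (fun c u w => hY.smul_left c u w k) (fun u w w' => hY.add_right u w w' k)
    (fun c u w => hY.smul_right c u w k)

theorem mode_apply (hY : IsVertexBilinear Y) (k : ℤ) (u : V) (w : W) :
    hY.mode k u w = Y u w k := rfl

theorem zero_left (hY : IsVertexBilinear Y) (w : W) (k : ℤ) : Y 0 w k = 0 := by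
  rw [← hY.mode_apply, map_zero, LinearMap.zero_apply]

theorem zero_right (hY : IsVertexBilinear Y) (u : V) (k : ℤ) : Y u 0 k = 0 := by
  rw [← hY.mode_apply, map_zero]

theorem sum_left (hY : IsVertexBilinear Y) {ι : Type*} (s : Finset ι) (f : ι → V) (w : W) (k : ℤ) :
    Y (∑ i ∈ s, f i) w k = ∑ i ∈ s, Y (f i) w k := by
  rw [← hY.mode_apply, map_sum, LinearMap.sum_apply]; rfl

theorem sum_right (hY : IsVertexBilinear Y) {ι : Type*} (s : Finset ι) (u : V) (f : ι → W) (k : ℤ) :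
    Y u (∑ i ∈ s, f i) k = ∑ i ∈ s, Y u (f i) k := by
  rw [← hY.mode_apply, map_sum]; rfl

/-- The coefficient of a product of vertex operators as an endomorphism. -/
def prodEnd (hY : IsVertexBilinear Y) (n : ℕ) (u : Fin n → V) (k : Fin n → ℤ) : Module.End ℂ W :=
  MultilinearMap.mkPiAlgebraFin ℂ n (Module.End ℂ W) fun i => hY.mode (k i) (u i)

theorem prodEnd_apply (hY : IsVertexBilinear Y) (n : ℕ) (u : Fin n → V) (k : Fin n → ℤ) (w : W) :
    hY.prodEnd n u k w = prodCoeff Y n u w k := by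
  induction n with
  | zero => simp [prodEnd, prodCoeff]
  | succ n ih =>
    have := ih (Fin.tail u) (Fin.tail k)
    simp only [prodEnd, MultilinearMap.mkPiAlgebraFin_apply] at this
    simp only [prodEnd, prodCoeff, MultilinearMap.mkPiAlgebraFin_apply, List.ofFn_succ,
      List.prod_cons, Module.End.mul_apply, mode_apply]
    rw [← this]; rfl

end IsVertexBilinear

end Modes

/-! ### Weights of modes, truncation and weak associativity -/

section Weights

variable {V W : Type*} [AddCommGroup V] [Module ℂ V] [AddCommGroup W] [Module ℂ W]
  {GV : ℤ → Submodule ℂ V} {YV : V → V → ℤ → V} {vac : V} {ρV : Sl2Rep V}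
  {GW : ℂ → Submodule ℂ W} {YW : V → W → ℤ → W} {ρW : Sl2Rep W}

theorem IsMOSVA.mode_mem (hV : IsMOSVA GV YV vac) {a b : ℤ} {u v : V} (hu : u ∈ GV a)
    (hv : v ∈ GV b) (k : ℤ) : YV u v k ∈ GV (a + b + k) := by
  refine mem_of_gradedScalar hV.internal (c := fun n : ℤ => (n : ℂ)) Int.cast_injective ?_
  have h := hV.d_commutator u v k
  simp only [vertexd, gradedScalar_apply hV.internal _ hv, gradedScalar_apply hV.internal _ hu,
    hV.bilinear.smul_left, hV.bilinear.smul_right] at h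
  rw [sub_eq_iff_eq_add] at h
  rw [h]; push_cast; module

theorem IsMOSVA.exists_bound (hV : IsMOSVA GV YV vac) : ∃ N : ℤ, ∀ n < N, ∀ v ∈ GV n, v = 0 := by
  obtain ⟨N, hN⟩ := hV.lower_bound
  exact ⟨N, fun n hn v hv => by rw [hN n hn] at hv; exact hv⟩

theorem IsMOSVA.mode_eq_zero (hV : IsMOSVA GV YV vac) (u v : V) :
    ∃ N : ℤ, ∀ k < N, YV u v k = 0 := by
  obtain ⟨N, hN⟩ := hV.exists_bound
  induction u using gradedInduction hV.internal with
  | homog a u hu =>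
    induction v using gradedInduction hV.internal with
    | homog b v hv => exact ⟨N - a - b, fun k hk => hN _ (by omega) _ (hV.mode_mem hu hv k)⟩
    | zero => exact ⟨0, fun k _ => hV.bilinear.zero_right u k⟩
    | add v v' h h' =>
      obtain ⟨M, hM⟩ := h
      obtain ⟨M', hM'⟩ := h'
      refine ⟨min M M', fun k hk => ?_⟩
      rw [hV.bilinear.add_right, hM k (by omega), hM' k (by omega), add_zero]
  | zero => exact ⟨0, fun k _ => hV.bilinear.zero_left v k⟩
  | add u u' h h' =>
    obtain ⟨M, hM⟩ := h
    obtain ⟨M', hM'⟩ := h'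
    refine ⟨min M M', fun k hk => ?_⟩
    rw [hV.bilinear.add_left, hM k (by omega), hM' k (by omega), add_zero]

theorem IsSl2LeftModule.mode_mem (hV : IsMOSVA GV YV vac)
    (hW : IsSl2LeftModule GV YV vac ρV GW YW ρW) {a : ℤ} {m : ℂ} {u : V} {w : W} (hu : u ∈ GV a)
    (hw : w ∈ GW m) (k : ℤ) : YW u w k ∈ GW (a + m + k) := by
  refine mem_of_gradedScalar hW.internal (c := fun m : ℂ => m) Function.injective_id ?_
  have h := hW.d_commutator u w k
  simp only [vertexd, gradedScalar_apply hV.internal _ hu, gradedScalar_apply hW.internal _ hw,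
    hW.bilinear.smul_left, hW.bilinear.smul_right] at h
  rw [sub_eq_iff_eq_add] at h
  rw [h]; module

theorem IsSl2LeftModule.exists_bound (hW : IsSl2LeftModule GV YV vac ρV GW YW ρW) :
    ∃ N : ℝ, ∀ m : ℂ, m.re < N → ∀ w ∈ GW m, w = 0 := by
  obtain ⟨N, hN⟩ := hW.lower_bound
  exact ⟨N, fun n hn v hv => by rw [hN n hn] at hv; exact hv⟩

/-- Uniform truncation of the modes between fixed weight spaces. -/
theorem IsSl2LeftModule.exists_mode_bound (hV : IsMOSVA GV YV vac)
    (hW : IsSl2LeftModule GV YV vac ρV GW YW ρW) (a : ℤ) (m : ℂ) :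
    ∃ N : ℤ, ∀ u ∈ GV a, ∀ w ∈ GW m, ∀ k < N, YW u w k = 0 := by
  obtain ⟨N, hN⟩ := hW.exists_bound
  refine ⟨⌊N - a - m.re⌋, fun u hu w hw k hk => hN _ ?_ _ (hW.mode_mem hV hu hw k)⟩
  have h1 : (k : ℝ) + 1 ≤ ⌊N - a - m.re⌋ := by exact_mod_cast hk
  have h2 := Int.floor_le (N - a - m.re)
  simp only [Complex.add_re, Complex.intCast_re]
  linarith

/-- For homogeneous data only exponents with sum e can pair nontrivially with φ, so the double
series is in fact a series in one index. -/
theorem hasSum_prodTerm_iff (hV : IsMOSVA GV YV vac)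
    (hW : IsSl2LeftModule GV YV vac ρV GW YW ρW) {h₁ h₂ e : ℤ} {m : ℂ} {u₁ u₂ : V} {w : W}
    (hu₁ : u₁ ∈ GV h₁) (hu₂ : u₂ ∈ GV h₂) (hw : w ∈ GW m) {φ : Module.Dual ℂ W}
    (hφ : φ ∈ dualPiece GW (h₁ + h₂ + m + e)) (z₁ z₂ s : ℂ) :
    HasSum (prodTerm YW φ ![u₁, u₂] w ![z₁, z₂]) s ↔
      HasSum (fun k : ℤ => φ (YW u₁ (YW u₂ w (e - k)) k) * (z₁ ^ k * z₂ ^ (e - k))) s := by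
  have hinj : Function.Injective fun k : ℤ => (![k, e - k] : Fin 2 → ℤ) := fun a b h => by
    simpa using congrFun h 0
  rw [← hinj.hasSum_iff]
  · refine Iff.of_eq (congrArg (fun f => HasSum f s) (funext fun k => ?_))
    simp [prodTerm, prodCoeff_two, Fin.prod_univ_two]
  · intro k hk
    rw [prodTerm, prodCoeff_two]
    have hne : (h₁ : ℂ) + (h₂ + m + k 1) + k 0 ≠ h₁ + h₂ + m + e := by
      intro h
      refine hk ⟨k 0, ?_⟩
      have h' : ((k 0 + k 1 : ℤ) : ℂ) = e := by push_cast; linear_combination h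
      have h'' : k 0 + k 1 = e := by exact_mod_cast h'
      funext i
      fin_cases i
      · rfl
      · simp; omega
    exact mul_eq_zero_of_left (hφ _ hne _ (hW.mode_mem hV hu₁ (hW.mode_mem hV hu₂ hw _) _)) _

theorem hasSum_iterTerm_iff (hV : IsMOSVA GV YV vac)
    (hW : IsSl2LeftModule GV YV vac ρV GW YW ρW) {h₁ h₂ e : ℤ} {m : ℂ} {u₁ u₂ : V} {w : W}
    (hu₁ : u₁ ∈ GV h₁) (hu₂ : u₂ ∈ GV h₂) (hw : w ∈ GW m) {φ : Module.Dual ℂ W}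
    (hφ : φ ∈ dualPiece GW (h₁ + h₂ + m + e)) (z₁ z₂ s : ℂ) :
    HasSum (iterTerm YV YW φ u₁ u₂ w z₁ z₂) s ↔
      HasSum (fun k : ℤ => φ (YW (YV u₁ u₂ k) w (e - k)) * ((z₁ - z₂) ^ k * z₂ ^ (e - k))) s := by
  have hinj : Function.Injective fun k : ℤ => (k, e - k) := fun a b h => by
    simpa using congrArg Prod.fst h
  rw [← hinj.hasSum_iff]
  · refine Iff.of_eq (congrArg (fun f => HasSum f s) (funext fun k => ?_))
    simp [iterTerm]
  · intro k hk
    rw [iterTerm]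
    have hne : ((h₁ + h₂ + k.1 : ℤ) : ℂ) + m + k.2 ≠ h₁ + h₂ + m + e := by
      intro h
      refine hk ⟨k.1, ?_⟩
      have h' : ((k.1 + k.2 : ℤ) : ℂ) = e := by push_cast at h ⊢; linear_combination h
      have h'' : k.1 + k.2 = e := by exact_mod_cast h'
      ext
      · rfl
      · simp; omega
    rw [hφ _ hne _ (hW.mode_mem hV (hV.mode_mem hu₁ hu₂ _) hw _), zero_mul]

/-- The strong pole-order condition with a given constant. -/
def PoleOrderBound (GV : ℤ → Submodule ℂ V) (GW : ℂ → Submodule ℂ W) (YW : V → W → ℤ → W)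
    (C : ℝ) : Prop :=
  ∀ (n₁ n₂ : ℤ) (m m' : ℂ), ∀ u₁ ∈ GV n₁, ∀ u₂ ∈ GV n₂, ∀ w ∈ GW m, ∀ w' ∈ dualPiece GW m',
    ∃ (f : MvPolynomial (Fin 2) ℂ) (p₁ : ℤ) (p₂ p₁₂ : ℕ), (p₁ : ℝ) ≤ n₁ + m.re + C ∧
      ∀ z₁ z₂ : ℂ, ‖z₂‖ < ‖z₁‖ → 0 < ‖z₂‖ →
        HasSum (prodTerm YW w' ![u₁, u₂] w ![z₁, z₂])
          (MvPolynomial.eval ![z₁, z₂] f / (z₁ ^ p₁ * z₂ ^ p₂ * (z₁ - z₂) ^ p₁₂))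

/-- Weak associativity, with the power of `x₁` depending only on the weights of `u₁` and `w`. -/
theorem weakAssociativity (hV : IsMOSVA GV YV vac) (hW : IsSl2LeftModule GV YV vac ρV GW YW ρW)
    {C : ℝ} (hC : PoleOrderBound GV GW YW C)
    {h₁ h₂ : ℤ} {m : ℂ} {u₁ u₂ : V} {w : W} (hu₁ : u₁ ∈ GV h₁) (hu₂ : u₂ ∈ GV h₂) (hw : w ∈ GW m)
    {p : ℕ} (hp : h₁ + m.re + C ≤ p) (i l : ℤ) {J : ℕ} (hJ : ∀ k ≤ l - J, YW u₂ w k = 0) :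
    ∑ s ∈ Finset.range (p + 1), (p.choose s : ℂ) • YW (YV u₁ u₂ (i - p + s)) w (l - s)
      = ∑ j ∈ Finset.range J,
        ((Ring.choose (i + j) j : ℤ) : ℂ) • YW u₁ (YW u₂ w (l - j)) (i + j - p) := by
  -- Both sides are homogeneous with total exponent e, so a functional of the matching weight
  -- suffices to test the identity.
  set e : ℤ := i + l - p with he
  rw [← sub_eq_zero]
  refine eq_zero_of_dualPiece (G := GW) (i := h₁ + h₂ + m + e) hW.internal ?_ fun φ hφ => ?_
  · refine sub_mem (Submodule.sum_mem _ fun s _ => Submodule.smul_mem _ _ ?_)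
      (Submodule.sum_mem _ fun j _ => Submodule.smul_mem _ _ ?_)
    · convert hW.mode_mem hV (hV.mode_mem hu₁ hu₂ (i - p + s)) hw (l - s) using 2
      rw [he]; push_cast; ring
    · convert hW.mode_mem hV hu₁ (hW.mode_mem hV hu₂ hw (l - j)) (i + j - p) using 2
      rw [he]; push_cast; ring
  rw [map_sub, sub_eq_zero, map_sum, map_sum]
  obtain ⟨f, p₁, p₂, p₁₂, hp₁, hf⟩ := hC h₁ h₂ m _ u₁ hu₁ u₂ hu₂ w hw φ hφ
  obtain ⟨Na, hNa⟩ := hW.exists_mode_bound hV h₂ m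
  obtain ⟨Nb, hNb⟩ := hV.mode_eq_zero u₁ u₂
  have hpp : p₁ ≤ p := by
    have : (p₁ : ℝ) ≤ (p : ℤ) := by push_cast; linarith
    exact_mod_cast this
  -- Homogeneity allows z₂ = 1, which leaves one variable. The extra power of X trades the actual
  -- pole order p₁, which depends on φ and u₂, for the uniform p.
  set g : Polynomial ℂ :=
    MvPolynomial.aeval ![Polynomial.X, 1] f * Polynomial.X ^ (p - p₁).toNat with hg
  have hgz : ∀ z : ℂ, z ≠ 0 → g.eval z / (z ^ p * (z - 1) ^ p₁₂)
      = MvPolynomial.eval ![z, 1] f / (z ^ p₁ * 1 ^ p₂ * (z - 1) ^ p₁₂) := by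
    intro z hz
    have e1 : (MvPolynomial.aeval ![Polynomial.X, 1] f : Polynomial ℂ).eval z
        = MvPolynomial.eval ![z, 1] f := by
      rw [← Polynomial.coe_evalRingHom, ← MvPolynomial.coe_aeval_eq_eval,
        MvPolynomial.aeval_def, MvPolynomial.hom_eval₂, RingHom.coe_coe, MvPolynomial.aeval_def]
      congr 1
      · ext; simp
      · funext i; fin_cases i <;> simp
    rw [hg, Polynomial.eval_mul, Polynomial.eval_pow, Polynomial.eval_X, e1, one_pow, mul_one,
      ← zpow_natCast z (p - p₁).toNat, Int.toNat_of_nonneg (by omega), zpow_sub₀ hz, zpow_natCast]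
    have := zpow_ne_zero p₁ hz
    by_cases h1 : (z - 1) ^ p₁₂ = 0
    · simp [h1]
    · field_simp
  -- Products at (z, 1) give the expansion for z > 1, iterates at (1 + t, 1) the one for 0 < t < 1;
  -- associativity identifies the rational functions.
  have key := sum_choose_mul_eq_laurentTranslate
    (a := fun k => φ (YW u₁ (YW u₂ w (e - k)) k)) (b := fun k => φ (YW (YV u₁ u₂ k) w (e - k)))
    (K := e - Na) (N := Nb)
    (fun k hk => by
      rw [hNa u₂ hu₂ w hw _ (by omega), hW.bilinear.zero_right, map_zero])
    (fun k hk => by rw [hNb k hk, hW.bilinear.zero_left, map_zero]) g p p₁₂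
    (fun z hz => by
      have hz0 : (z : ℂ) ≠ 0 := by
        have : z ≠ 0 := by positivity
        exact_mod_cast this
      have h1 := (hasSum_prodTerm_iff hV hW hu₁ hu₂ hw hφ _ _ _).1 (hf z 1 (by
        rw [Complex.norm_real, norm_one, Real.norm_of_nonneg (by linarith)]; exact hz) (by simp))
      rw [hgz _ hz0]
      exact h1.of_eq (fun k => by rw [one_zpow, mul_one]) rfl)
    (fun t h0 h1 => by
      have hn : ‖(1 : ℂ) + (t : ℂ)‖ = 1 + t := by
        rw [show (1 : ℂ) + (t : ℂ) = ((1 + t : ℝ) : ℂ) by push_cast; rfl, Complex.norm_real,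
          Real.norm_of_nonneg (by linarith)]
      have hz0 : (1 : ℂ) + (t : ℂ) ≠ 0 := by
        rw [← norm_pos_iff, hn]; linarith
      have hsub : (1 : ℂ) + (t : ℂ) - 1 = t := by ring
      have hnt : ‖(t : ℂ)‖ = t := by rw [Complex.norm_real, Real.norm_of_nonneg h0.le]
      obtain ⟨s, hs1, hs2⟩ := hW.associativity u₁ u₂ w φ (dualPiece_le_gradedDual _ hφ)
        (1 + t) 1 (by rw [hn, norm_one]; linarith) (by rw [hsub, hnt, norm_one]; exact h1)
        (by rw [hsub, hnt]; exact h0)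
      have h2 := hf (1 + t) 1 (by rw [hn, norm_one]; linarith) (by simp)
      have h3 := hgz _ hz0
      rw [hsub] at h3
      rw [hsub] at h2
      rw [h3, ← hs1.unique h2]
      refine ((hasSum_iterTerm_iff hV hW hu₁ hu₂ hw hφ _ _ _).1 hs2).of_eq (fun k => ?_) rfl
      rw [one_zpow, mul_one, hsub]) i
  calc _ = _ := Finset.sum_congr rfl fun s _ => by
        rw [map_smul, smul_eq_mul, show l - (s : ℤ) = e - (i - p + s) by omega]
    _ = _ := key
    _ = _ := by
      rw [finsum_eq_sum_of_support_subset (s := Finset.range J)]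
      · refine Finset.sum_congr rfl fun j _ => ?_
        rw [map_smul, smul_eq_mul, show e - (i + j - p) = l - (j : ℤ) by omega]
      · intro j hj
        rw [Function.mem_support] at hj
        simp only [Finset.coe_range, Set.mem_Iio]
        by_contra hc
        exact hj (by rw [hJ _ (by omega), hW.bilinear.zero_right, map_zero, mul_zero])

end Weights

/-! ### Finite detection of products of vertex operators -/

section Finiteness

variable {V W : Type*} [AddCommGroup V] [Module ℂ V] [AddCommGroup W] [Module ℂ W]
  {GV : ℤ → Submodule ℂ V} {YV : V → V → ℤ → V} {vac : V} {ρV : Sl2Rep V}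
  {GW : ℂ → Submodule ℂ W} {YW : V → W → ℤ → W} {ρW : Sl2Rep W}

/-- The coefficient of `x ^ l` in `Y(ξ(x), x)w` for the polynomial `ξ(x) = ∑ s ≤ d, ξ s x ^ s`. -/
def polyMode (Y : V → W → ℤ → W) (d : ℕ) (ξ : ℕ → V) (w : W) (l : ℤ) : W :=
  ∑ s ∈ Finset.range (d + 1), Y (ξ s) w (l - s)

/-- The coefficient of `y ^ i` in `(y + x) ^ p Y(u, y)ξ(x)`. -/
def polyTransform (Y : V → V → ℤ → V) (p : ℕ) (u : V) (i : ℤ) (ξ : ℕ → V) (s : ℕ) : V :=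
  ∑ x ∈ Finset.HasAntidiagonal.antidiagonal s, (p.choose x.1 : ℂ) • Y u (ξ x.2) (i - p + x.1)

/-- Weak associativity for each coefficient of ξ, summed. Since p does not depend on those
coefficients, a neighbouring operator is absorbed into a polynomial vector at the cost of raising
the degree by p. -/
theorem polyMode_polyTransform (hV : IsMOSVA GV YV vac)
    (hW : IsSl2LeftModule GV YV vac ρV GW YW ρW) {C : ℝ} (hC : PoleOrderBound GV GW YW C)
    {h c : ℤ} {m : ℂ} {u : V} {ξ : ℕ → V} {w : W} (hu : u ∈ GV h)
    (hξ : ∀ s : ℕ, ξ s ∈ GV (c + s)) {d : ℕ} (hd : ∀ s, d < s → ξ s = 0) (hw : w ∈ GW m) {p : ℕ}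
    (hp : h + m.re + C ≤ p) (i l : ℤ) {J : ℕ} (hJ : ∀ s, ∀ k ≤ l - J, YW (ξ s) w k = 0) :
    polyMode YW (d + p) (polyTransform YV p u i ξ) w l
      = ∑ j ∈ Finset.range J,
        ((Ring.choose (i + j) j : ℤ) : ℂ) • YW u (polyMode YW d ξ w (l - j)) (i + j - p) := by
  have h1 : polyMode YW (d + p) (polyTransform YV p u i ξ) w l
      = ∑ s ∈ Finset.range (d + p + 1), ∑ x ∈ Finset.HasAntidiagonal.antidiagonal s,
        (p.choose x.1 : ℂ) • YW (YV u (ξ x.2) (i - p + x.1)) w (l - x.2 - x.1) := by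
    refine Finset.sum_congr rfl fun s _ => ?_
    rw [polyTransform, hW.bilinear.sum_left]
    refine Finset.sum_congr rfl fun x hx => ?_
    rw [Finset.HasAntidiagonal.mem_antidiagonal] at hx
    rw [hW.bilinear.smul_left, ← hx]
    congr 2; push_cast; ring
  rw [h1, sum_antidiagonal_box (A := p + 1) (B := d + 1)
    (f := fun a b => (p.choose a : ℂ) • YW (YV u (ξ b) (i - p + a)) w (l - b - a))
    (fun a b hab => by rw [Nat.choose_eq_zero_of_lt (by omega), Nat.cast_zero, zero_smul])
    (fun a b hab => by
      rw [hd b (by omega), hV.bilinear.zero_right, hW.bilinear.zero_left, smul_zero]) (by omega),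
    Finset.sum_comm]
  have h2 : ∀ b ∈ Finset.range (d + 1), ∑ a ∈ Finset.range (p + 1),
      (p.choose a : ℂ) • YW (YV u (ξ b) (i - p + a)) w (l - b - a)
      = ∑ j ∈ Finset.range J,
        ((Ring.choose (i + j) j : ℤ) : ℂ) • YW u (YW (ξ b) w (l - b - j)) (i + j - p) :=
    fun b _ => weakAssociativity hV hW hC hu (hξ b) hw hp i (l - b)
      fun k hk => hJ b k (by omega)
  rw [Finset.sum_congr rfl h2, Finset.sum_comm]
  refine Finset.sum_congr rfl fun j _ => ?_
  rw [polyMode, hW.bilinear.sum_right, Finset.smul_sum]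
  refine Finset.sum_congr rfl fun b _ => ?_
  rw [sub_right_comm]

/-- Absorbing all the `u i` leaves one operator with a polynomial vector of degree at most d + ∑ P
i. Its high powers of x pair to zero with w' because they would need vectors of V of weight below N.
Thus vanishing up to L, a bound independent of ξ and of the vector w beyond its weight, d and the `P
i`, forces vanishing everywhere. -/
theorem prodCoeff_eq_zero_of_le (hV : IsMOSVA GV YV vac)
    (hW : IsSl2LeftModule GV YV vac ρV GW YW ρW) {C : ℝ} (hC : PoleOrderBound GV GW YW C)
    {N : ℤ} (hN : ∀ n < N, ∀ v ∈ GV n, v = 0) {m n' : ℂ} {w : W} (hw : w ∈ GW m)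
    {w' : Module.Dual ℂ W} (hw' : w' ∈ dualPiece GW n') (n : ℕ) :
    ∀ (u : Fin n → V) (h : Fin n → ℤ) (_ : ∀ i, u i ∈ GV (h i)) (P : Fin n → ℕ)
      (_ : ∀ i, h i + m.re + C ≤ P i) (d : ℕ) (c : ℤ) (ξ : ℕ → V) (_ : ∀ s : ℕ, ξ s ∈ GV (c + s))
      (_ : ∀ s, d < s → ξ s = 0) (L : ℤ) (_ : n'.re - m.re - N + d + ∑ i, (P i : ℝ) ≤ L)
      (_ : ∀ l ≤ L, ∀ k, w' (prodCoeff YW n u (polyMode YW d ξ w l) k) = 0),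
      ∀ l k, w' (prodCoeff YW n u (polyMode YW d ξ w l) k) = 0 := by
  induction n with
  | zero =>
    intro u h _ P _ d c ξ hξ hd L hL hO l k
    by_cases hl : l ≤ L
    · exact hO l hl k
    change w' (polyMode YW d ξ w l) = 0
    rw [polyMode, map_sum]
    refine Finset.sum_eq_zero fun s hs => ?_
    -- If the weights match, then c + s = Re n' - Re m - l + s < N because l > L and s ≤ d, so ξ s
    -- vanishes.
    by_cases he : ((c + s : ℤ) : ℂ) + m + ((l - s : ℤ) : ℂ) = n'
    · rw [hN (c + s) _ _ (hξ s), hW.bilinear.zero_left, map_zero]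
      have h1 := congrArg Complex.re he
      simp only [Complex.add_re, Complex.intCast_re] at h1
      simp only [Finset.univ_eq_empty, Finset.sum_empty, add_zero] at hL
      have hs' : (s : ℝ) ≤ d := by
        exact_mod_cast Nat.lt_succ_iff.1 (Finset.mem_range.1 hs)
      have hl' : (L : ℝ) + 1 ≤ l := by exact_mod_cast (not_le.1 hl)
      have h3 : (((c + s : ℤ) : ℝ)) < N := by push_cast at h1 ⊢; linarith
      exact_mod_cast h3
    · exact hw' _ he _ (hW.mode_mem hV (hξ s) hw _)
  | succ n ih =>
    intro u h hu P hP d c ξ hξ hd L hL hO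
    set p := P (Fin.last n) with hp
    set v := u (Fin.last n) with hv
    obtain ⟨N', hN'⟩ := hW.exists_bound
    have hB : ∃ B : ℤ, ∀ s, ∀ k < B, YW (ξ s) w k = 0 := by
      refine ⟨⌊N' - (c + d) - m.re⌋, fun s k hk => ?_⟩
      by_cases hs : d < s
      · rw [hd s hs, hW.bilinear.zero_left]
      refine hN' _ ?_ _ (hW.mode_mem hV (hξ s) hw k)
      have h1 : (k : ℝ) + 1 ≤ ⌊N' - (c + d) - m.re⌋ := by exact_mod_cast hk
      have h2 := Int.floor_le (N' - (c + d) - m.re)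
      have h3 : (s : ℝ) ≤ d := by exact_mod_cast not_lt.1 hs
      simp only [Complex.add_re, Complex.intCast_re, Int.cast_add, Int.cast_natCast,
        Complex.natCast_re]
      linarith
    obtain ⟨B, hB⟩ := hB
    have hJ : ∀ l : ℤ, ∀ s, ∀ k ≤ l - (l - B + 1).toNat, YW (ξ s) w k = 0 :=
      fun l s k hk => hB s k (by omega)
    have key := fun i l => polyMode_polyTransform hV hW hC (hu (Fin.last n)) hξ hd hw
      (hP (Fin.last n)) i l (hJ l)
    have expand : ∀ (i l : ℤ) (k : Fin n → ℤ),
        w' (prodCoeff YW n (Fin.init u) (polyMode YW (d + p) (polyTransform YV p v i ξ) w l) k)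
        = ∑ j ∈ Finset.range (l - B + 1).toNat, ((Ring.choose (i + j) j : ℤ) : ℂ) *
          w' (prodCoeff YW (n + 1) u (polyMode YW d ξ w (l - j))
            (Fin.snoc (α := fun _ => ℤ) k (i + j - p))) := by
      intro i l k
      rw [key, ← hW.bilinear.prodEnd_apply, map_sum, map_sum]
      refine Finset.sum_congr rfl fun j _ => ?_
      rw [map_smul, map_smul, smul_eq_mul, hW.bilinear.prodEnd_apply, prodCoeff_last,
        Fin.snoc_last, Fin.init_snoc]
    -- The absorbed expression has one operator fewer and degree d + p. The summand P of the
    -- absorbed operator moves into the degree, so the same L serves.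
    have hT : ∀ i l k,
        w' (prodCoeff YW n (Fin.init u) (polyMode YW (d + p) (polyTransform YV p v i ξ) w l) k)
          = 0 := by
      intro i
      refine ih (Fin.init u) (Fin.init h) (fun i => hu i.castSucc) (Fin.init P)
        (fun i => hP i.castSucc) (d + p) (c + h (Fin.last n) + i - p) _ (fun s => ?_)
        (fun s hs => ?_) L ?_ fun l hl k => ?_
      · refine Submodule.sum_mem _ fun x hx => Submodule.smul_mem _ _ ?_
        rw [Finset.HasAntidiagonal.mem_antidiagonal] at hx
        convert hV.mode_mem (hu (Fin.last n)) (hξ x.2) (i - p + x.1) using 2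
        rw [← hx]; push_cast; ring
      · refine Finset.sum_eq_zero fun x hx => ?_
        rw [Finset.HasAntidiagonal.mem_antidiagonal] at hx
        by_cases h1 : p < x.1
        · rw [Nat.choose_eq_zero_of_lt h1, Nat.cast_zero, zero_smul]
        · rw [hd x.2 (by omega), hV.bilinear.zero_right, smul_zero]
      · rw [Fin.sum_univ_castSucc] at hL
        refine le_trans (le_of_eq ?_) hL
        simp only [Fin.init, Nat.cast_add, hp]
        ring
      · rw [expand]
        exact Finset.sum_eq_zero fun j _ => by rw [hO _ (by omega), mul_zero]
    -- The expansion is triangular in l: its j = 0 term has coefficient 1 and the others involve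
    -- lower powers, so vanishing propagates upward from the truncation bound B.
    have low : ∀ j : ℕ, ∀ l < B + j, ∀ k,
        w' (prodCoeff YW (n + 1) u (polyMode YW d ξ w l) k) = 0 := by
      intro j
      induction j with
      | zero =>
        intro l hl k
        have : polyMode YW d ξ w l = 0 :=
          Finset.sum_eq_zero fun s _ => hB s _ (by push_cast at hl; omega)
        rw [this, ← hW.bilinear.prodEnd_apply, map_zero, map_zero]
      | succ j ihj =>
        intro l hl k
        by_cases hlj : l < B + j
        · exact ihj l hlj k
        -- Adding p gives the j = 0 term exactly the exponent `k (Fin.last n)`.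
        have h1 := hT (k (Fin.last n) + p) l (Fin.init k)
        have h2 : (l - B + 1).toNat = (l - B).toNat + 1 := by omega
        rw [expand, h2, Finset.sum_range_succ', Finset.sum_eq_zero, zero_add] at h1
        · simpa using h1
        · intro j' _
          rw [ihj _ (by push_cast at hl ⊢; omega), mul_zero]
    intro l k
    exact low (l - B + 1).toNat l (by omega) k

/-- The matrix coefficients of a product of vertex operators span a finite-dimensional space of
functionals on each weight space: finitely many functionals detect their common zeros. -/
theorem exists_functionals_prodCoeff (hV : IsMOSVA GV YV vac)
    (hW : IsSl2LeftModule GV YV vac ρV GW YW ρW) {C : ℝ} (hC : PoleOrderBound GV GW YW C)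
    {w' : Module.Dual ℂ W} (hw' : w' ∈ gradedDual GW) {n : ℕ} (u : Fin n → V) (h : Fin n → ℤ)
    (hu : ∀ i, u i ∈ GV (h i)) (m : ℂ) :
    ∃ s : Finset (Module.Dual ℂ W), ∀ w ∈ GW m, (∀ f ∈ s, f w = 0) →
      ∀ k, w' (prodCoeff YW n u w k) = 0 := by
  classical
  refine gradedDualInduction hw' (fun n' w' hw' => ?_) ?_ fun f g hf hg => ?_
  · obtain ⟨N, hN⟩ := hV.exists_bound
    induction n generalizing m with
    | zero => exact ⟨{w'}, fun w _ h k => h w' (Finset.mem_singleton_self w')⟩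
    | succ n ih =>
      obtain ⟨B, hB⟩ := hW.exists_mode_bound hV (h (Fin.last n)) m
      let P : Fin n → ℕ := fun i => ⌈h i.castSucc + m.re + C⌉₊
      -- Only modes of the innermost operator between B and L need testing; each lands in one weight
      -- space, where the induction hypothesis gives finitely many functionals. The innermost vector
      -- is a constant polynomial, of degree 0.
      let L : ℤ := ⌈n'.re - m.re - N + (0 : ℕ) + ∑ i, (P i : ℝ)⌉
      choose s hs using fun κ : ℤ => ih (Fin.init u) (Fin.init h) (fun i => hu i.castSucc)
        (h (Fin.last n) + m + κ)
      refine ⟨(Finset.Icc B L).biUnion fun κ => (s κ).image fun f =>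
        f ∘ₗ hW.bilinear.mode κ (u (Fin.last n)), fun w hw hf k => ?_⟩
      have hmode : ∀ l, polyMode YW 0 (Pi.single 0 (u (Fin.last n))) w l
          = YW (u (Fin.last n)) w l := fun l => by simp [polyMode]
      rw [prodCoeff_last, ← hmode]
      refine prodCoeff_eq_zero_of_le hV hW hC hN hw hw' n (Fin.init u) (Fin.init h)
        (fun i => hu i.castSucc) P (fun i => Nat.le_ceil _) 0 (h (Fin.last n))
        (Pi.single 0 (u (Fin.last n))) (fun s => ?_)
        (fun s hs => Pi.single_eq_of_ne (by omega) _) L (Int.le_ceil _) (fun l hl k => ?_) _ _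
      · by_cases hs : s = 0
        · subst hs; simpa using hu (Fin.last n)
        · rw [Pi.single_eq_of_ne hs]; exact zero_mem _
      · rw [hmode]
        by_cases hl' : l < B
        · rw [hB _ (hu (Fin.last n)) _ hw _ hl', ← hW.bilinear.prodEnd_apply, map_zero, map_zero]
        · refine hs l _ (hW.mode_mem hV (hu (Fin.last n)) hw l) (fun f hfs => ?_) k
          exact hf _ (Finset.mem_biUnion.2 ⟨l, Finset.mem_Icc.2 ⟨not_lt.1 hl', hl⟩,
            Finset.mem_image_of_mem _ hfs⟩)
  · exact ⟨∅, fun _ _ _ _ => rfl⟩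
  · obtain ⟨s, hs⟩ := hf
    obtain ⟨t, ht⟩ := hg
    refine ⟨s ∪ t, fun w hw h k => ?_⟩
    rw [LinearMap.add_apply, hs w hw (fun f hf => h f (Finset.mem_union_left _ hf)),
      ht w hw (fun f hf => h f (Finset.mem_union_right _ hf)), add_zero]

end Finiteness

/-! ### Functionals on the graded dual as evaluations -/

section DoubleDual

variable {ι M : Type*} [DecidableEq ι] [AddCommGroup M] [Module ℂ M] {G : ι → Submodule ℂ M}

/-- Evaluations at vectors exhaust the dual of a finite-dimensional space of functionals. The
hypothesis on s places A, restricted to `G i`, inside such a space. -/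
theorem exists_eval_eq_of_dualPiece (hG : DirectSum.IsInternal G) {i : ι}
    {φ : Module.Dual ℂ (gradedDual G)} (hφ : φ ∈ dualPiece (dualGrading G) i)
    (A : Set (gradedDual G)) {s : Finset (Module.Dual ℂ M)}
    (hs : ∀ x ∈ G i, (∀ f ∈ s, f x = 0) → ∀ a ∈ A, (a : Module.Dual ℂ M) x = 0) :
    ∃ x ∈ G i, ∀ a ∈ A, φ a = (a : Module.Dual ℂ M) x := by
  -- A homogeneous φ sees only the component of weight i, so it factors through restriction of
  -- functionals to `G i`.
  let incl : Module.Dual ℂ M →ₗ[ℂ] gradedDual G :=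
    { toFun := fun f => ⟨f ∘ₗ gradedProj G i,
        dualPiece_le_gradedDual i (comp_gradedProj_mem_dualPiece hG f i)⟩
      map_add' := fun _ _ => rfl
      map_smul' := fun _ _ => rfl }
  have hincl : ∀ a : gradedDual G, φ a = φ (incl a) := by
    intro a
    induction a using gradedInduction (dualGrading_internal hG) with
    | homog j a ha =>
      by_cases hj : j = i
      · subst hj
        congr 1
        ext x
        exact dualPiece_apply_eq hG ha x
      · have h1 : incl a = 0 := by
          ext x
          exact ha i (Ne.symm hj) _ (gradedProj_mem hG i x)
        rw [hφ j hj a ha, h1, map_zero]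
    | zero => rw [map_zero, Submodule.coe_zero, map_zero, map_zero]
    | add a b ha hb => rw [map_add, ha, hb, Submodule.coe_add, map_add, map_add]
  let E : Submodule ℂ (Module.Dual ℂ M) :=
    Submodule.span ℂ ((fun f => f ∘ₗ gradedProj G i) '' (s : Set (Module.Dual ℂ M)))
  have : FiniteDimensional ℂ E := FiniteDimensional.span_of_finite ℂ (s.finite_toSet.image _)
  obtain ⟨x, hx⟩ : ∃ x : M, ∀ f ∈ E, (φ ∘ₗ incl) f = f x := by
    -- No nonzero functional in E vanishes at all vectors, and a subspace of the dual of a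
    -- finite-dimensional E is recovered from its coannihilator.
    have hsurj : Function.Surjective (E.subtype.dualMap ∘ₗ Module.Dual.eval ℂ M) := by
      rw [← LinearMap.range_eq_top]
      set R := LinearMap.range (E.subtype.dualMap ∘ₗ Module.Dual.eval ℂ M)
      have h1 : R.dualCoannihilator = ⊥ := by
        rw [eq_bot_iff]
        intro f hf
        rw [Submodule.mem_dualCoannihilator] at hf
        exact Subtype.ext (LinearMap.ext fun x => hf _ ⟨x, rfl⟩)
      rw [← Subspace.dualCoannihilator_dualAnnihilator_eq (W := R), h1,
        Submodule.dualAnnihilator_bot]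
    obtain ⟨x, hx⟩ := hsurj ((φ ∘ₗ incl) ∘ₗ E.subtype)
    exact ⟨x, fun f hf => (LinearMap.congr_fun hx ⟨f, hf⟩).symm⟩
  refine ⟨gradedProj G i x, gradedProj_mem hG i x, fun a ha => ?_⟩
  have hmem : (a : Module.Dual ℂ M) ∘ₗ gradedProj G i ∈ E := by
    have := mem_span_of_iInf_ker_le_ker (L := fun f : s => (f : Module.Dual ℂ M) ∘ₗ gradedProj G i)
      (K := (a : Module.Dual ℂ M) ∘ₗ gradedProj G i) (fun y hy => by
        simp only [Submodule.mem_iInf, LinearMap.mem_ker, LinearMap.comp_apply] at hy ⊢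
        exact hs _ (gradedProj_mem hG i y) (fun f hf => hy ⟨f, hf⟩) a ha)
    refine Submodule.span_mono ?_ this
    rintro _ ⟨f, rfl⟩
    exact ⟨f, f.2, rfl⟩
  rw [hincl, ← LinearMap.comp_apply a.1 (gradedProj G i), ← hx _ hmem, LinearMap.comp_apply]
  congr 1
  ext y
  change a.1 (gradedProj G i y) = a.1 (gradedProj G i (gradedProj G i y))
  rw [gradedProj_of_mem hG (gradedProj_mem hG i y)]

theorem exists_eval_eq (hG : DirectSum.IsInternal G) {φ : Module.Dual ℂ (gradedDual G)}
    (hφ : φ ∈ gradedDual (dualGrading G)) (A : Set (gradedDual G))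
    (hA : ∀ i, ∃ s : Finset (Module.Dual ℂ M), ∀ x ∈ G i, (∀ f ∈ s, f x = 0) →
      ∀ a ∈ A, (a : Module.Dual ℂ M) x = 0) :
    ∃ x, ∀ a ∈ A, φ a = (a : Module.Dual ℂ M) x := by
  refine gradedDualInduction hφ (fun i φ hφ => ?_) ?_ fun f g hf hg => ?_
  · obtain ⟨s, hs⟩ := hA i
    obtain ⟨x, -, hx⟩ := exists_eval_eq_of_dualPiece hG hφ A hs
    exact ⟨x, hx⟩
  · exact ⟨0, fun a _ => by rw [map_zero]; rfl⟩
  · obtain ⟨x, hx⟩ := hf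
    obtain ⟨y, hy⟩ := hg
    exact ⟨x + y, fun a ha => by rw [LinearMap.add_apply, hx a ha, hy a ha, map_add]⟩

end DoubleDual

/-! ### Commutation with sl(2) -/

section Mobius

variable {V W : Type*} [AddCommGroup V] [Module ℂ V] [AddCommGroup W] [Module ℂ W]
  {GV : ℤ → Submodule ℂ V} {YV : V → V → ℤ → V} {vac : V} {ρV : Sl2Rep V}
  {GW : ℂ → Submodule ℂ W} {YW : V → W → ℤ → W} {ρW : Sl2Rep W}

namespace Sl2Rep

theorem zero_neg (ρ : Sl2Rep V) (v : V) : ρ.Lzero (ρ.Lneg v) = ρ.Lneg (ρ.Lzero v) + ρ.Lneg v := by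
  have := LinearMap.congr_fun ρ.bracket_zero_neg v
  rw [LieRing.of_associative_ring_bracket, LinearMap.sub_apply, Module.End.mul_apply,
    Module.End.mul_apply, sub_eq_iff_eq_add'] at this
  exact this

theorem zero_pos (ρ : Sl2Rep V) (v : V) : ρ.Lzero (ρ.Lpos v) = ρ.Lpos (ρ.Lzero v) - ρ.Lpos v := by
  have := LinearMap.congr_fun ρ.bracket_zero_pos v
  rw [LieRing.of_associative_ring_bracket, LinearMap.sub_apply, Module.End.mul_apply,
    Module.End.mul_apply, sub_eq_iff_eq_add'] at this
  rw [this, LinearMap.neg_apply, sub_eq_add_neg]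

theorem pos_neg (ρ : Sl2Rep V) (v : V) :
    ρ.Lpos (ρ.Lneg v) = ρ.Lneg (ρ.Lpos v) + (2 : ℂ) • ρ.Lzero v := by
  have := LinearMap.congr_fun ρ.bracket_neg_pos v
  rw [LieRing.of_associative_ring_bracket, LinearMap.sub_apply, Module.End.mul_apply,
    Module.End.mul_apply, LinearMap.neg_apply, LinearMap.smul_apply] at this
  rw [eq_add_of_sub_eq this]; abel

end Sl2Rep

namespace IsMobiusMOSVA

theorem Lzero_apply (hV : IsMobiusMOSVA GV YV vac ρV) {n : ℤ} {v : V} (hv : v ∈ GV n) :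
    ρV.Lzero v = (n : ℂ) • v := by
  rw [hV.Lzero_eq, vertexd, gradedScalar_apply hV.internal _ hv]

theorem mem_of_Lzero (hV : IsMobiusMOSVA GV YV vac ρV) {n : ℤ} {v : V}
    (hv : ρV.Lzero v = (n : ℂ) • v) : v ∈ GV n := by
  rw [hV.Lzero_eq, vertexd] at hv
  exact mem_of_gradedScalar hV.internal (c := fun n : ℤ => (n : ℂ)) Int.cast_injective hv

theorem Lpos_mem (hV : IsMobiusMOSVA GV YV vac ρV) {n : ℤ} {v : V} (hv : v ∈ GV n) :
    ρV.Lpos v ∈ GV (n - 1) := by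
  refine hV.mem_of_Lzero ?_
  rw [ρV.zero_pos, hV.Lzero_apply hv, map_smul]; push_cast; module

theorem Lneg_mem (hV : IsMobiusMOSVA GV YV vac ρV) {n : ℤ} {v : V} (hv : v ∈ GV n) :
    ρV.Lneg v ∈ GV (n + 1) := by
  refine hV.mem_of_Lzero ?_
  rw [ρV.zero_neg, hV.Lzero_apply hv, map_smul]; push_cast; module

theorem Lpos_pow_mem (hV : IsMobiusMOSVA GV YV vac ρV) {n : ℤ} {v : V} (hv : v ∈ GV n) (m : ℕ) :
    (ρV.Lpos ^ m) v ∈ GV (n - m) := by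
  induction m with
  | zero => simpa using hv
  | succ m ih =>
    rw [pow_succ', Module.End.mul_apply]
    convert hV.Lpos_mem ih using 2
    push_cast; ring

theorem exists_Lpos_pow_eq_zero (hV : IsMobiusMOSVA GV YV vac ρV) (v : V) :
    ∃ M : ℕ, ∀ m, M ≤ m → (ρV.Lpos ^ m) v = 0 := by
  obtain ⟨N, hN⟩ := hV.exists_bound
  induction v using gradedInduction hV.internal with
  | homog n v hv =>
    exact ⟨(n - N + 1).toNat, fun m hm => hN _ (by omega) _ (hV.Lpos_pow_mem hv m)⟩
  | zero => exact ⟨0, fun m _ => map_zero _⟩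
  | add x y hx hy =>
    obtain ⟨M, hM⟩ := hx
    obtain ⟨M', hM'⟩ := hy
    refine ⟨max M M', fun m hm => ?_⟩
    rw [map_add, hM m (by omega), hM' m (by omega), add_zero]

/-- Moving L(-1) to the left past L(1)^(m+1) produces the terms 2(h - i) for i = 0, …, m, whose sum
is (m + 1)(2h - m). -/
theorem Lpos_pow_Lneg (hV : IsMobiusMOSVA GV YV vac ρV) {h : ℤ} {v : V} (hv : v ∈ GV h) (m : ℕ) :
    (ρV.Lpos ^ (m + 1)) (ρV.Lneg v)
      = ρV.Lneg ((ρV.Lpos ^ (m + 1)) v) + ((m + 1) * (2 * h - m) : ℂ) • (ρV.Lpos ^ m) v := by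
  induction m with
  | zero =>
    simp only [zero_add, pow_one, pow_zero, Module.End.one_apply]
    rw [ρV.pos_neg, hV.Lzero_apply hv]; push_cast; module
  | succ m ih =>
    have e : ∀ x j, (ρV.Lpos ^ (j + 1)) x = ρV.Lpos ((ρV.Lpos ^ j) x) := fun x j => by
      rw [pow_succ', Module.End.mul_apply]
    rw [e _ (m + 1), ih, map_add, map_smul, ρV.pos_neg,
      hV.Lzero_apply (hV.Lpos_pow_mem hv (m + 1)), ← e v m, ← e v (m + 1)]
    push_cast; module

theorem vac_mem (hV : IsMobiusMOSVA GV YV vac ρV) : vac ∈ GV 0 := by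
  have h := hV.d_commutator vac vac 0
  rw [hV.identity, hV.identity, if_pos rfl, if_pos rfl, sub_self, Int.cast_zero, zero_smul,
    zero_add, hV.creation, ← hV.Lzero_eq] at h
  exact hV.mem_of_Lzero (by rw [← h, Int.cast_zero, zero_smul])

theorem Lneg_vac (hV : IsMobiusMOSVA GV YV vac ρV) : ρV.Lneg vac = 0 := by
  rw [hV.Lneg_eq, vertexD, hV.identity, if_neg one_ne_zero]

/-- In the L(1)-commutator for Y(𝟏,x)𝟏 the left side vanishes, and on the right only L(1)𝟏 survives.
-/
theorem Lpos_vac (hV : IsMobiusMOSVA GV YV vac ρV) : ρV.Lpos vac = 0 := by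
  have h := hV.Lpos_commutator vac vac 0
  rw [hV.identity, hV.identity, if_pos rfl, if_pos rfl, sub_self, hV.creation, hV.Lneg_vac,
    hV.Lzero_apply hV.vac_mem, Int.cast_zero, zero_smul, hV.bilinear.zero_left,
    hV.bilinear.zero_left, smul_zero, add_zero, add_zero] at h
  exact h.symm

/-- The commutator of `L(1)` with the modes of a homogeneous vector. -/
theorem Lpos_mode (hV : IsMobiusMOSVA GV YV vac ρV) {h : ℤ} {u : V} (hu : u ∈ GV h) (v : V)
    (k : ℤ) : ρV.Lpos (YV u v k)
      = YV u (ρV.Lpos v) k + YV (ρV.Lpos u) v k + (2 * h + k - 1 : ℂ) • YV u v (k - 1) := by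
  have h1 := hV.Lpos_commutator u v k
  have h2 := hV.D_derivative u v (k - 2)
  rw [show k - 2 + 1 = k - 1 by ring, ← hV.Lneg_eq] at h2
  rw [sub_eq_iff_eq_add] at h1
  rw [h1, hV.Lzero_apply hu, hV.bilinear.smul_left, ← h2]
  push_cast; module

end IsMobiusMOSVA

namespace IsSl2LeftModule

theorem Lneg_left (hV : IsMobiusMOSVA GV YV vac ρV) (hW : IsSl2LeftModule GV YV vac ρV GW YW ρW)
    (u : V) (w : W) (k : ℤ) : YW (ρV.Lneg u) w k = ((k + 1 : ℤ) : ℂ) • YW u w (k + 1) := by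
  rw [hV.Lneg_eq, hW.D_derivative]

theorem Lneg_mode (hW : IsSl2LeftModule GV YV vac ρV GW YW ρW) (u : V) (w : W) (k : ℤ) :
    ρW.Lneg (YW u w k) = YW u (ρW.Lneg w) k + ((k + 1 : ℤ) : ℂ) • YW u w (k + 1) := by
  rw [hW.D_commutator]; abel

theorem Lzero_mode (hV : IsMobiusMOSVA GV YV vac ρV) (hW : IsSl2LeftModule GV YV vac ρV GW YW ρW)
    {h : ℤ} {u : V} (hu : u ∈ GV h) (w : W) (k : ℤ) :
    ρW.Lzero (YW u w k) = YW u (ρW.Lzero w) k + (h + k : ℂ) • YW u w k := by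
  have h1 := hW.Lzero_commutator u w k
  rw [sub_eq_iff_eq_add] at h1
  rw [h1, hW.Lneg_left hV, hV.Lzero_apply hu, hW.bilinear.smul_left, sub_add_cancel]
  module

theorem Lpos_mode (hV : IsMobiusMOSVA GV YV vac ρV) (hW : IsSl2LeftModule GV YV vac ρV GW YW ρW)
    {h : ℤ} {u : V} (hu : u ∈ GV h) (w : W) (k : ℤ) : ρW.Lpos (YW u w k)
      = YW u (ρW.Lpos w) k + YW (ρV.Lpos u) w k + (2 * h + k - 1 : ℂ) • YW u w (k - 1) := by
  have h1 := hW.Lpos_commutator u w k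
  rw [sub_eq_iff_eq_add] at h1
  rw [h1, hW.Lneg_left hV, hV.Lzero_apply hu, hW.bilinear.smul_left,
    show k - 2 + 1 = k - 1 by ring]
  push_cast; module

end IsSl2LeftModule

/-! ## The opposite vertex operator -/

section Opposite

local notation "Yo" => oppositeVertexOp GV ρV YW

/-- The ranges S and M may be larger than necessary, so several vectors can be summed over a common
range. -/
theorem oppositeVertexOp_eq_sum (hY : IsVertexBilinear YW) {u : V} {S : Finset ℤ} {M : ℕ}
    (hS : ∀ h ∉ S, gradedProj GV h u = 0)
    (hM : ∀ h m, M ≤ m → (ρV.Lpos ^ m) (gradedProj GV h u) = 0) (w : W) (k : ℤ) :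
    Yo u w k = ∑ h ∈ S, ∑ m ∈ Finset.range M, (((-1 : ℂ) ^ h) * ((m.factorial : ℂ)⁻¹)) •
      YW ((ρV.Lpos ^ m) (gradedProj GV h u)) w ((m : ℤ) - 2 * h - k) := by
  rw [oppositeVertexOp, finsum_eq_sum_of_support_subset (s := S)]
  · refine Finset.sum_congr rfl fun h _ => finsum_eq_sum_of_support_subset _ fun m hm => ?_
    rw [Function.mem_support] at hm
    simp only [Finset.coe_range, Set.mem_Iio]
    by_contra hc
    exact hm (by rw [hM h m (not_lt.1 hc), hY.zero_left, smul_zero])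
  · intro h hh
    rw [Function.mem_support] at hh
    by_contra hc
    exact hh (by simp only [hS h hc, map_zero, hY.zero_left, smul_zero, finsum_zero])

theorem exists_opposite_support (hV : IsMobiusMOSVA GV YV vac ρV) (u : V) :
    ∃ (S : Finset ℤ) (M : ℕ), (∀ h ∉ S, gradedProj GV h u = 0) ∧
      ∀ h m, M ≤ m → (ρV.Lpos ^ m) (gradedProj GV h u) = 0 := by
  choose M hM using fun h : ℤ => hV.exists_Lpos_pow_eq_zero (gradedProj GV h u)
  have hS := gradedProj_support_finite hV.internal u
  refine ⟨hS.toFinset, hS.toFinset.sup M, fun h hh => ?_, fun h m hm => ?_⟩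
  · by_contra hc; exact hh (hS.mem_toFinset.2 hc)
  · by_cases hh : h ∈ hS.toFinset
    · exact hM h m ((Finset.le_sup hh).trans hm)
    · have : gradedProj GV h u = 0 := by
        by_contra hc; exact hh (hS.mem_toFinset.2 hc)
      rw [this, map_zero]

theorem oppositeVertexOp_of_mem (hV : IsMobiusMOSVA GV YV vac ρV) (hY : IsVertexBilinear YW)
    {h : ℤ} {u : V} (hu : u ∈ GV h) {M : ℕ} (hM : ∀ m, M ≤ m → (ρV.Lpos ^ m) u = 0) (w : W)
    (k : ℤ) : Yo u w k = (-1 : ℂ) ^ h • ∑ m ∈ Finset.range M, ((m.factorial : ℂ)⁻¹) •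
      YW ((ρV.Lpos ^ m) u) w ((m : ℤ) - 2 * h - k) := by
  rw [oppositeVertexOp_eq_sum hY (S := {h}) (M := M), Finset.sum_singleton, Finset.smul_sum]
  · simp only [gradedProj_of_mem hV.internal hu, smul_smul]
  · intro h' hh'
    exact gradedProj_of_mem_ne hV.internal (fun e => hh' (by simp [e])) hu
  · intro h' m hm
    by_cases hh : h = h'
    · subst hh; rw [gradedProj_of_mem hV.internal hu, hM m hm]
    · rw [gradedProj_of_mem_ne hV.internal hh hu, map_zero]

theorem oppositeVertexOp_bilinear (hV : IsMobiusMOSVA GV YV vac ρV) (hY : IsVertexBilinear YW) :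
    IsVertexBilinear Yo := by
  refine ⟨fun w => ⟨fun u u' => funext fun k => ?_, fun c u => funext fun k => ?_⟩,
    fun u => ⟨fun w w' => funext fun k => ?_, fun c w => funext fun k => ?_⟩⟩
  · obtain ⟨S, M, h1, h2⟩ := exists_opposite_support hV u
    obtain ⟨S', M', h1', h2'⟩ := exists_opposite_support hV u'
    rw [Pi.add_apply, oppositeVertexOp_eq_sum hY (S := S ∪ S') (M := max M M'),
      oppositeVertexOp_eq_sum hY (S := S ∪ S') (M := max M M') (u := u),
      oppositeVertexOp_eq_sum hY (S := S ∪ S') (M := max M M') (u := u'),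
      ← Finset.sum_add_distrib]
    · refine Finset.sum_congr rfl fun h _ => ?_
      rw [← Finset.sum_add_distrib]
      refine Finset.sum_congr rfl fun m _ => ?_
      rw [map_add, map_add, hY.add_left, smul_add]
    · exact fun h hh => h1' h (fun hc => hh (Finset.mem_union_right _ hc))
    · exact fun h m hm => h2' h m (by omega)
    · exact fun h hh => h1 h (fun hc => hh (Finset.mem_union_left _ hc))
    · exact fun h m hm => h2 h m (by omega)
    · intro h hh
      rw [map_add, h1 h (fun hc => hh (Finset.mem_union_left _ hc)),
        h1' h (fun hc => hh (Finset.mem_union_right _ hc)), add_zero]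
    · intro h m hm
      rw [map_add, map_add, h2 h m (by omega), h2' h m (by omega), add_zero]
  all_goals obtain ⟨S, M, h1, h2⟩ := exists_opposite_support hV u
  · rw [Pi.smul_apply, oppositeVertexOp_eq_sum hY (S := S) (M := M) (u := c • u),
      oppositeVertexOp_eq_sum hY h1 h2, Finset.smul_sum]
    · refine Finset.sum_congr rfl fun h _ => ?_
      rw [Finset.smul_sum]
      refine Finset.sum_congr rfl fun m _ => ?_
      rw [map_smul, map_smul, hY.smul_left, smul_comm]
    · intro h hh; rw [map_smul, h1 h hh, smul_zero]
    · intro h m hm; rw [map_smul, map_smul, h2 h m hm, smul_zero]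
  · simp only [Pi.add_apply, oppositeVertexOp_eq_sum hY h1 h2, hY.add_right, smul_add,
      Finset.sum_add_distrib]
  · simp only [Pi.smul_apply, oppositeVertexOp_eq_sum hY h1 h2, hY.smul_right, Finset.smul_sum]
    exact Finset.sum_congr rfl fun h _ => Finset.sum_congr rfl fun m _ => smul_comm _ _ _

theorem oppositeVertexOp_mem (hV : IsMobiusMOSVA GV YV vac ρV)
    (hW : IsSl2LeftModule GV YV vac ρV GW YW ρW) {h : ℤ} {m : ℂ} {u : V} {w : W} (hu : u ∈ GV h)
    (hw : w ∈ GW m) (k : ℤ) : Yo u w k ∈ GW (m - h - k) := by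
  obtain ⟨M, hM⟩ := hV.exists_Lpos_pow_eq_zero u
  rw [oppositeVertexOp_of_mem hV hW.bilinear hu hM]
  refine Submodule.smul_mem _ _ (Submodule.sum_mem _ fun j _ => Submodule.smul_mem _ _ ?_)
  convert hW.mode_mem hV.toIsMOSVA (hV.Lpos_pow_mem hu j) hw (j - 2 * h - k) using 2
  push_cast; ring

theorem oppositeVertexOp_vac (hV : IsMobiusMOSVA GV YV vac ρV)
    (hW : IsSl2LeftModule GV YV vac ρV GW YW ρW) (w : W) (k : ℤ) :
    Yo vac w k = if k = 0 then w else 0 := by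
  rw [oppositeVertexOp_of_mem hV hW.bilinear hV.vac_mem (M := 1)]
  · simp [hW.identity]
  · intro m hm
    obtain ⟨m, rfl⟩ : ∃ j, m = j + 1 := ⟨m - 1, by omega⟩
    rw [pow_succ, Module.End.mul_apply, hV.Lpos_vac, map_zero]

/-- Since 1/m! = (m + 1)/(m + 1)!, terms with L(1)^(m+1) can be compared with terms with L(1)^m. -/
theorem sum_inv_factorial_succ {E : Type*} [AddCommGroup E] [Module ℂ E] (f : ℕ → E) (M : ℕ) :
    ∑ m ∈ Finset.range M, ((m.factorial : ℂ)⁻¹) • f (m + 1)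
      = ∑ m ∈ Finset.range (M + 1), ((m.factorial : ℂ)⁻¹ * m) • f m := by
  rw [Finset.sum_range_succ', Nat.cast_zero, mul_zero, zero_smul, add_zero]
  refine Finset.sum_congr rfl fun m _ => ?_
  congr 1
  have := Nat.factorial_ne_zero m
  rw [Nat.factorial_succ]; push_cast
  have h2 : (m : ℂ) + 1 ≠ 0 := by exact_mod_cast Nat.succ_ne_zero m
  field_simp

/-- `d/dx Y^o(u, x) = Y^o(L(-1)u, x)`. -/
theorem oppositeVertexOp_derivative (hV : IsMobiusMOSVA GV YV vac ρV)
    (hW : IsSl2LeftModule GV YV vac ρV GW YW ρW) (u : V) (w : W) (k : ℤ) :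
    Yo (ρV.Lneg u) w k = ((k + 1 : ℤ) : ℂ) • Yo u w (k + 1) := by
  have hY := oppositeVertexOp_bilinear (YW := YW) hV hW.bilinear
  induction u using gradedInduction hV.internal with
  | zero => rw [map_zero, hY.zero_left, hY.zero_left, smul_zero]
  | add x y hx hy => rw [map_add, hY.add_left, hY.add_left, hx, hy, smul_add]
  | homog h u hu =>
    obtain ⟨M, hM⟩ := hV.exists_Lpos_pow_eq_zero u
    obtain ⟨M', hM'⟩ := hV.exists_Lpos_pow_eq_zero (ρV.Lneg u)
    set n := max M M'
    set f : ℕ → W := fun m => YW ((ρV.Lpos ^ m) u) w (m - 2 * h - (k + 1)) with hf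
    have hf0 : ∀ m, n ≤ m → f m = 0 := fun m hm => by
      simp only [hf]
      rw [hM m (by omega), hW.bilinear.zero_left]
    rw [oppositeVertexOp_of_mem hV hW.bilinear hu (M := n) (fun m hm => hM m (by omega)),
      oppositeVertexOp_of_mem hV hW.bilinear (hV.Lneg_mem hu) (M := n + 1)
        (fun m hm => hM' m (by omega)), Finset.sum_range_succ']
    -- One term comes from L(-1) standing outermost, which differentiates, the other from its
    -- commutator with L(1)^(m+1). After reindexing, the factors m - 2h - (k + 1) and 2h - m add up
    -- to -(k + 1), independently of m.
    have e1 : ∀ m ∈ Finset.range n, (((m + 1).factorial : ℂ)⁻¹) •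
        YW ((ρV.Lpos ^ (m + 1)) (ρV.Lneg u)) w (((m + 1 : ℕ) : ℤ) - 2 * (h + 1) - k)
        = (((m + 1).factorial : ℂ)⁻¹ * ((m + 1 : ℕ) - 2 * h - (k + 1))) • f (m + 1)
          + ((m.factorial : ℂ)⁻¹ * (2 * h - m)) • f m := by
      intro m _
      rw [hV.Lpos_pow_Lneg hu, hW.bilinear.add_left, hW.Lneg_left hV, hW.bilinear.smul_left,
        smul_add, smul_smul, smul_smul]
      have i1 : ((m + 1 : ℕ) : ℤ) - 2 * (h + 1) - k + 1 = ((m + 1 : ℕ) : ℤ) - 2 * h - (k + 1) := by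
        ring
      have i2 : ((m + 1 : ℕ) : ℤ) - 2 * (h + 1) - k = (m : ℤ) - 2 * h - (k + 1) := by
        push_cast; ring
      rw [i1, i2]
      congr 2
      · push_cast; ring
      · have := Nat.factorial_ne_zero m
        have h2 : (m : ℂ) + 1 ≠ 0 := by exact_mod_cast Nat.succ_ne_zero m
        rw [Nat.factorial_succ]; push_cast
        field_simp
    have e2 : (((0 : ℕ).factorial : ℂ)⁻¹) •
        YW ((ρV.Lpos ^ 0) (ρV.Lneg u)) w (((0 : ℕ) : ℤ) - 2 * (h + 1) - k)
        = (((0 : ℕ).factorial : ℂ)⁻¹ * ((0 : ℕ) - 2 * h - (k + 1))) • f 0 := by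
      rw [pow_zero, Module.End.one_apply, hW.Lneg_left hV, smul_smul]
      simp only [hf, pow_zero, Module.End.one_apply]
      rw [show ((0 : ℕ) : ℤ) - 2 * (h + 1) - k + 1 = ((0 : ℕ) : ℤ) - 2 * h - (k + 1) by ring]
      congr 2
      push_cast; ring
    rw [Finset.sum_congr rfl e1, Finset.sum_add_distrib, e2, add_right_comm,
      ← Finset.sum_range_succ' (fun m => ((m.factorial : ℂ)⁻¹ * (m - 2 * h - (k + 1))) • f m),
      Finset.sum_range_succ, hf0 n le_rfl, smul_zero, add_zero, ← Finset.sum_add_distrib,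
      zpow_add_one₀ (by norm_num)]
    have e3 : ∑ m ∈ Finset.range n, (((m.factorial : ℂ)⁻¹ * (m - 2 * h - (k + 1))) • f m
        + ((m.factorial : ℂ)⁻¹ * (2 * h - m)) • f m)
        = -((k + 1 : ℂ) • ∑ m ∈ Finset.range n, (m.factorial : ℂ)⁻¹ • f m) := by
      rw [Finset.smul_sum, ← Finset.sum_neg_distrib]
      exact Finset.sum_congr rfl fun m _ => by module
    rw [e3]
    change _ = ((k + 1 : ℤ) : ℂ) • (-1 : ℂ) ^ h • ∑ m ∈ Finset.range n, (m.factorial : ℂ)⁻¹ • f m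
    push_cast; module

/-- The commutator of `L(1)` with the opposite vertex operator. -/
theorem oppositeVertexOp_Lpos (hV : IsMobiusMOSVA GV YV vac ρV)
    (hW : IsSl2LeftModule GV YV vac ρV GW YW ρW) (u : V) (w : W) (k : ℤ) :
    Yo u (ρW.Lpos w) k - ρW.Lpos (Yo u w k) = ((k + 1 : ℤ) : ℂ) • Yo u w (k + 1) := by
  have hY := oppositeVertexOp_bilinear (YW := YW) hV hW.bilinear
  induction u using gradedInduction hV.internal with
  | zero => simp only [hY.zero_left, map_zero, smul_zero, sub_zero]
  | add x y hx hy =>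
    rw [hY.add_left, hY.add_left, hY.add_left, map_add, smul_add, ← hx, ← hy]; abel
  | homog h u hu =>
    obtain ⟨M, hM⟩ := hV.exists_Lpos_pow_eq_zero u
    set f : ℕ → W := fun m => YW ((ρV.Lpos ^ m) u) w (m - 2 * h - (k + 1)) with hf
    simp only [oppositeVertexOp_of_mem hV hW.bilinear hu hM, map_smul, map_sum]
    rw [← smul_sub, smul_comm, ← Finset.sum_sub_distrib]
    congr 1
    have e1 : ∀ m ∈ Finset.range M, ((m.factorial : ℂ)⁻¹) •
        YW ((ρV.Lpos ^ m) u) (ρW.Lpos w) (m - 2 * h - k) - ((m.factorial : ℂ)⁻¹) •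
        ρW.Lpos (YW ((ρV.Lpos ^ m) u) w (m - 2 * h - k))
        = ((m.factorial : ℂ)⁻¹ * (m + k + 1)) • f m - ((m.factorial : ℂ)⁻¹) • f (m + 1) := by
      intro m _
      rw [hW.Lpos_mode hV (hV.Lpos_pow_mem hu m), ← Module.End.mul_apply ρV.Lpos, ← pow_succ']
      simp only [hf]
      rw [show (m : ℤ) - 2 * h - k - 1 = m - 2 * h - (k + 1) by ring,
        show ((m + 1 : ℕ) : ℤ) - 2 * h - (k + 1) = m - 2 * h - k by push_cast; ring]
      push_cast; module
    rw [Finset.sum_congr rfl e1, Finset.sum_sub_distrib, sum_inv_factorial_succ,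
      Finset.sum_range_succ (fun m : ℕ => (((m.factorial : ℂ)⁻¹ * m) • f m : W))]
    have hfM : f M = 0 := by simp only [hf]; rw [hM M le_rfl, hW.bilinear.zero_left]
    rw [hfM, smul_zero, add_zero, ← Finset.sum_sub_distrib, Finset.smul_sum]
    refine Finset.sum_congr rfl fun m _ => ?_
    change _ = _ • (m.factorial : ℂ)⁻¹ • f m
    push_cast; module

/-- Every summand shifts the weight by (h - m) + (m - 2h - k) = -(h + k), independently of m. -/
theorem oppositeVertexOp_Lzero (hV : IsMobiusMOSVA GV YV vac ρV)
    (hW : IsSl2LeftModule GV YV vac ρV GW YW ρW) (u : V) (w : W) (k : ℤ) :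
    Yo u (ρW.Lzero w) k - ρW.Lzero (Yo u w k) = Yo (ρV.Lzero u) w k + Yo (ρV.Lneg u) w (k - 1) := by
  have hY := oppositeVertexOp_bilinear (YW := YW) hV hW.bilinear
  rw [oppositeVertexOp_derivative hV hW, sub_add_cancel]
  induction u using gradedInduction hV.internal with
  | zero => simp only [hY.zero_left, map_zero, smul_zero, sub_zero, add_zero]
  | add x y hx hy =>
    rw [map_add, hY.add_left, hY.add_left, hY.add_left, map_add, smul_add, add_add_add_comm,
      ← hx, ← hy]
    abel
  | homog h u hu =>
    obtain ⟨M, hM⟩ := hV.exists_Lpos_pow_eq_zero u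
    rw [hV.Lzero_apply hu, hY.smul_left]
    simp only [oppositeVertexOp_of_mem hV hW.bilinear hu hM, map_smul, map_sum]
    rw [← smul_sub, smul_comm, smul_comm (k : ℂ), ← smul_add]
    congr 1
    rw [← Finset.sum_sub_distrib, Finset.smul_sum, Finset.smul_sum, ← Finset.sum_add_distrib]
    refine Finset.sum_congr rfl fun m _ => ?_
    rw [hW.Lzero_mode hV (hV.Lpos_pow_mem hu m)]
    push_cast; module

/-- The derivative factor of the m-th summand depends on m. Its m-part reindexes to Y^o of L(1)u,
the sign being absorbed because L(1) lowers the weight h by one; the rest supplies the other two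
terms. -/
theorem oppositeVertexOp_Lneg (hV : IsMobiusMOSVA GV YV vac ρV)
    (hW : IsSl2LeftModule GV YV vac ρV GW YW ρW) (u : V) (w : W) (k : ℤ) :
    Yo u (ρW.Lneg w) k - ρW.Lneg (Yo u w k)
      = Yo (ρV.Lpos u) w k + (2 : ℂ) • Yo (ρV.Lzero u) w (k - 1) + Yo (ρV.Lneg u) w (k - 2) := by
  have hY := oppositeVertexOp_bilinear (YW := YW) hV hW.bilinear
  rw [oppositeVertexOp_derivative hV hW, show k - 2 + 1 = k - 1 by ring]
  induction u using gradedInduction hV.internal with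
  | zero => simp only [hY.zero_left, map_zero, smul_zero, sub_zero, add_zero]
  | add x y hx hy =>
    simp only [map_add, hY.add_left, smul_add]
    rw [add_sub_add_comm, hx, hy]
    abel
  | homog h u hu =>
    obtain ⟨M, hM⟩ := hV.exists_Lpos_pow_eq_zero u
    set f : ℕ → W := fun m => YW ((ρV.Lpos ^ m) u) w (m - 2 * h - (k - 1)) with hf
    rw [hV.Lzero_apply hu, hY.smul_left,
      oppositeVertexOp_of_mem hV hW.bilinear (hV.Lpos_mem hu) (M := M) (fun m hm => by
        rw [← Module.End.mul_apply, ← pow_succ, hM _ (by omega)])]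
    simp only [oppositeVertexOp_of_mem hV hW.bilinear hu hM, map_smul, map_sum]
    have e1 : ∀ m ∈ Finset.range M, ((m.factorial : ℂ)⁻¹) •
        YW ((ρV.Lpos ^ m) (ρV.Lpos u)) w (m - 2 * (h - 1) - k)
        = ((m.factorial : ℂ)⁻¹) • f (m + 1) := by
      intro m _
      rw [← Module.End.mul_apply, ← pow_succ]
      simp only [hf]
      congr 2; push_cast; ring
    have hfM : f M = 0 := by simp only [hf]; rw [hM M le_rfl, hW.bilinear.zero_left]
    have e2 : ∑ m ∈ Finset.range M, ((m.factorial : ℂ)⁻¹) •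
          YW ((ρV.Lpos ^ m) u) (ρW.Lneg w) (m - 2 * h - k) - ∑ m ∈ Finset.range M,
          ((m.factorial : ℂ)⁻¹) • ρW.Lneg (YW ((ρV.Lpos ^ m) u) w (m - 2 * h - k))
        = (2 * h + k - 1 : ℂ) • ∑ m ∈ Finset.range M, ((m.factorial : ℂ)⁻¹) • f m
          - ∑ m ∈ Finset.range M, ((m.factorial : ℂ)⁻¹ * m) • f m := by
      rw [Finset.smul_sum, ← Finset.sum_sub_distrib, ← Finset.sum_sub_distrib]
      refine Finset.sum_congr rfl fun m _ => ?_
      rw [hW.Lneg_mode]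
      simp only [hf]
      rw [show (m : ℤ) - 2 * h - k + 1 = m - 2 * h - (k - 1) by ring]
      push_cast; module
    rw [← smul_sub, e2, Finset.sum_congr rfl e1, sum_inv_factorial_succ, Finset.sum_range_succ, hfM,
      smul_zero, add_zero, zpow_sub_one₀ (by norm_num), show ((-1 : ℂ))⁻¹ = -1 by norm_num]
    change _ = _ + (2 : ℂ) • (h : ℂ) • (-1 : ℂ) ^ h • ∑ m ∈ Finset.range M,
      ((m.factorial : ℂ)⁻¹) • f m + ((k - 1 : ℤ) : ℂ) • (-1 : ℂ) ^ h • ∑ m ∈ Finset.range M,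
      ((m.factorial : ℂ)⁻¹) • f m
    push_cast; module

end Opposite

end Mobius

/-! ### Transposes on the graded dual -/

section Transpose

/-- The part of x outside `G i` lies both in `E i` and in the span of the other `E j`, hence is
zero. -/
theorem eq_of_le_iSupIndep {ι M : Type*} [DecidableEq ι] [AddCommGroup M] [Module ℂ M]
    {G E : ι → Submodule ℂ M} (hG : DirectSum.IsInternal G) (hE : iSupIndep E)
    (hle : ∀ i, G i ≤ E i) (i : ι) : E i ≤ G i := by
  intro x hx
  have h1 : x - gradedProj G i x ∈ ⨆ j, ⨆ (_ : j ≠ i), E j := by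
    clear hx
    induction x using gradedInduction hG with
    | homog j x hx =>
      by_cases hj : j = i
      · subst hj
        rw [gradedProj_of_mem hG hx, sub_self]; exact zero_mem _
      · rw [gradedProj_of_mem_ne hG hj hx, sub_zero]
        exact Submodule.mem_iSup_of_mem j (Submodule.mem_iSup_of_mem hj (hle j hx))
    | zero => rw [map_zero, sub_zero]; exact zero_mem _
    | add x y hx hy => rw [map_add, add_sub_add_comm]; exact add_mem hx hy
  have h2 : x - gradedProj G i x ∈ E i := sub_mem hx (hle i (gradedProj_mem hG i x))
  have h3 := Submodule.disjoint_def.1 (hE i) _ h2 h1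
  rw [sub_eq_zero.1 h3]
  exact gradedProj_mem hG i x

variable {W : Type*} [AddCommGroup W] [Module ℂ W] {G : ℂ → Submodule ℂ W}

theorem comp_mem_dualPiece {T : Module.End ℂ W} {c : ℂ} (hT : ∀ m, ∀ w ∈ G m, T w ∈ G (m + c))
    {n : ℂ} {f : Module.Dual ℂ W} (hf : f ∈ dualPiece G n) : f ∘ₗ T ∈ dualPiece G (n - c) :=
  fun j hj x hx => hf (j + c) (fun e => hj (by rw [← e]; ring)) _ (hT j x hx)

theorem comp_mem_gradedDual {T : Module.End ℂ W} {c : ℂ} (hT : ∀ m, ∀ w ∈ G m, T w ∈ G (m + c))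
    {f : Module.Dual ℂ W} (hf : f ∈ gradedDual G) : f ∘ₗ T ∈ gradedDual G := by
  refine gradedDualInduction hf (fun n f hf => ?_) ?_ fun f g hf hg => ?_
  · exact dualPiece_le_gradedDual _ (comp_mem_dualPiece hT hf)
  · exact zero_mem _
  · exact add_mem hf hg

/-- The transpose of an endomorphism preserving the graded dual. -/
def gradedTranspose (T : Module.End ℂ W) (hT : ∀ f ∈ gradedDual G, f ∘ₗ T ∈ gradedDual G) :
    Module.End ℂ (gradedDual G) where
  toFun f := ⟨f.1 ∘ₗ T, hT f.1 f.2⟩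
  map_add' _ _ := rfl
  map_smul' _ _ := rfl

end Transpose

/-! ### The contragredient operators and their formal axioms -/

section Contragredient

variable {V W : Type*} [AddCommGroup V] [Module ℂ V] [AddCommGroup W] [Module ℂ W]
  {GV : ℤ → Submodule ℂ V} {YV : V → V → ℤ → V} {vac : V} {ρV : Sl2Rep V}
  {GW : ℂ → Submodule ℂ W} {YW : V → W → ℤ → W} {ρW : Sl2Rep W}

namespace IsMobiusLeftModule

/-- Local nilpotency makes the grading that by generalized eigenspaces of L(0). This is what shows
that L(0) and L(1) have weights 0 and -1, which the axioms state only for L(-1). -/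
theorem mem_iff (hW : IsMobiusLeftModule GV YV vac ρV GW YW ρW) (n : ℂ) :
    GW n = Module.End.maxGenEigenspace ρW.Lzero n := by
  have hle : ∀ n, GW n ≤ Module.End.maxGenEigenspace ρW.Lzero n := fun n w hw =>
    (Module.End.mem_maxGenEigenspace _ _ _).2 (hW.locally_nilpotent n w hw)
  exact le_antisymm (hle n)
    (eq_of_le_iSupIndep hW.internal (Module.End.independent_maxGenEigenspace _) hle n)

theorem Lzero_mem (hW : IsMobiusLeftModule GV YV vac ρV GW YW ρW) (n : ℂ) (w : W)
    (hw : w ∈ GW n) : ρW.Lzero w ∈ GW (n + 0) := by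
  rw [add_zero]
  rw [hW.mem_iff] at hw ⊢
  exact Module.End.mapsTo_maxGenEigenspace_of_comm (Commute.refl _) n hw

theorem Lpos_mem (hW : IsMobiusLeftModule GV YV vac ρV GW YW ρW) (n : ℂ) (w : W)
    (hw : w ∈ GW n) : ρW.Lpos w ∈ GW (n + -1) := by
  obtain ⟨m, hm⟩ := hW.locally_nilpotent n w hw
  rw [hW.mem_iff, Module.End.mem_maxGenEigenspace]
  refine ⟨m, ?_⟩
  have h1 : SemiconjBy ρW.Lpos (ρW.Lzero - n • 1) (ρW.Lzero - (n + -1) • 1) := by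
    refine LinearMap.ext fun x => ?_
    simp only [Module.End.mul_apply, LinearMap.sub_apply, LinearMap.smul_apply,
      Module.End.one_apply, map_sub, map_smul, ρW.zero_pos]
    module
  have h2 := LinearMap.congr_fun (h1.pow_right m) w
  rw [Module.End.mul_apply, Module.End.mul_apply, hm, map_zero] at h2
  exact h2.symm

end IsMobiusLeftModule

/-- The representation of `sl(2)` on the graded dual. -/
def contragredientRep (hW : IsMobiusLeftModule GV YV vac ρV GW YW ρW) :
    Sl2Rep (gradedDual GW) where
  Lneg := gradedTranspose ρW.Lpos fun _ => comp_mem_gradedDual hW.Lpos_mem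
  Lzero := gradedTranspose ρW.Lzero fun _ => comp_mem_gradedDual hW.Lzero_mem
  Lpos := gradedTranspose ρW.Lneg fun _ => comp_mem_gradedDual hW.D_weight
  bracket_zero_neg := by
    ext f w
    change f.1 (ρW.Lpos (ρW.Lzero w)) - f.1 (ρW.Lzero (ρW.Lpos w)) = f.1 (ρW.Lpos w)
    rw [ρW.zero_pos, map_sub]; ring
  bracket_zero_pos := by
    ext f w
    change f.1 (ρW.Lneg (ρW.Lzero w)) - f.1 (ρW.Lzero (ρW.Lneg w)) = -f.1 (ρW.Lneg w)
    rw [ρW.zero_neg, map_add]; ring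
  bracket_neg_pos := by
    ext f w
    change f.1 (ρW.Lneg (ρW.Lpos w)) - f.1 (ρW.Lpos (ρW.Lneg w)) = -(2 * f.1 (ρW.Lzero w))
    rw [ρW.pos_neg, map_add, map_smul, smul_eq_mul]; ring

theorem comp_opposite_mem_dualPiece (hV : IsMobiusMOSVA GV YV vac ρV)
    (hW : IsSl2LeftModule GV YV vac ρV GW YW ρW) {h : ℤ} {u : V} (hu : u ∈ GV h) (k : ℤ) {n : ℂ}
    {f : Module.Dual ℂ W} (hf : f ∈ dualPiece GW n) :
    f ∘ₗ (oppositeVertexOp_bilinear hV hW.bilinear).mode k u ∈ dualPiece GW (h + n + k) := by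
  have := comp_mem_dualPiece (T := (oppositeVertexOp_bilinear hV hW.bilinear).mode k u)
    (c := -h - k) (fun m w hw => by
      change oppositeVertexOp GV ρV YW u w k ∈ _
      convert oppositeVertexOp_mem hV hW hu hw k using 2; ring) hf
  convert this using 2; ring

theorem comp_opposite_mem_gradedDual (hV : IsMobiusMOSVA GV YV vac ρV)
    (hW : IsSl2LeftModule GV YV vac ρV GW YW ρW) (u : V) (k : ℤ) {f : Module.Dual ℂ W}
    (hf : f ∈ gradedDual GW) :
    f ∘ₗ (oppositeVertexOp_bilinear hV hW.bilinear).mode k u ∈ gradedDual GW := by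
  induction u using gradedInduction hV.internal with
  | homog h u hu =>
    refine gradedDualInduction hf (fun n f hf => ?_) ?_ fun f g hf hg => ?_
    · exact dualPiece_le_gradedDual _ (comp_opposite_mem_dualPiece hV hW hu k hf)
    · exact zero_mem _
    · exact add_mem hf hg
  | zero => rw [map_zero, LinearMap.comp_zero]; exact zero_mem _
  | add x y hx hy => rw [map_add, LinearMap.comp_add]; exact add_mem hx hy

/-- The contragredient vertex operator on the graded dual. -/
noncomputable def contragredientOp (hV : IsMobiusMOSVA GV YV vac ρV)
    (hW : IsSl2LeftModule GV YV vac ρV GW YW ρW) (u : V) (w' : gradedDual GW) (k : ℤ) :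
    gradedDual GW :=
  ⟨w'.1 ∘ₗ (oppositeVertexOp_bilinear hV hW.bilinear).mode k u,
    comp_opposite_mem_gradedDual hV hW u k w'.2⟩

theorem contragredientOp_apply (hV : IsMobiusMOSVA GV YV vac ρV)
    (hW : IsSl2LeftModule GV YV vac ρV GW YW ρW) (u : V) (w' : gradedDual GW) (k : ℤ) (w : W) :
    (contragredientOp hV hW u w' k : Module.Dual ℂ W) w
      = (w' : Module.Dual ℂ W) (oppositeVertexOp GV ρV YW u w k) := rfl

theorem contragredientOp_bilinear (hV : IsMobiusMOSVA GV YV vac ρV)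
    (hW : IsSl2LeftModule GV YV vac ρV GW YW ρW) :
    IsVertexBilinear (contragredientOp hV hW) where
  left w' :=
    { map_add := fun u u' => by
        funext k; ext w
        change w'.1 _ = w'.1 _ + w'.1 _
        rw [← map_add, map_add]; rfl
      map_smul := fun c u => by
        funext k; ext w
        change w'.1 _ = c • w'.1 _
        rw [← map_smul, map_smul]; rfl }
  right u := { map_add := fun _ _ => rfl, map_smul := fun _ _ => rfl }

/-- Y^s(u,x)𝟏 = e^{xD}u, so V^op has the same derivation as V. -/
theorem vertexD_skewOpposite (hV : IsMobiusMOSVA GV YV vac ρV) (u : V) :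
    vertexD (skewOpposite YV vac) vac u = ρV.Lneg u := by
  rw [vertexD, skewOpposite, finsum_eq_single _ 1]
  · simp [hV.identity, hV.Lneg_eq]
  · intro j hj
    have h0 : (vertexD YV vac)^[j] 0 = 0 := by
      have : vertexD YV vac = ρV.Lneg := funext fun v => (hV.Lneg_eq v).symm
      rw [this, ← Module.End.coe_pow, map_zero]
    rw [hV.identity, if_neg (by omega), h0, smul_zero]

theorem contragredientOp_d_commutator (hV : IsMobiusMOSVA GV YV vac ρV)
    (hW : IsSl2LeftModule GV YV vac ρV GW YW ρW) (u : V) (w' : gradedDual GW) (k : ℤ) :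
    gradedScalar (dualGrading GW) (fun m => m) (contragredientOp hV hW u w' k)
      - contragredientOp hV hW u (gradedScalar (dualGrading GW) (fun m => m) w') k
      = contragredientOp hV hW (vertexd GV u) w' k + (k : ℂ) • contragredientOp hV hW u w' k := by
  have hY := contragredientOp_bilinear hV hW
  have hG := dualGrading_internal hW.internal
  induction u using gradedInduction hV.internal with
  | zero => simp only [hY.zero_left, map_zero, smul_zero, sub_zero, add_zero]
  | add x y hx hy =>
    simp only [map_add, hY.add_left, smul_add]
    rw [add_sub_add_comm, hx, hy]; abel
  | homog h u hu =>
    induction w' using gradedInduction hG with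
    | zero => simp only [hY.zero_right, map_zero, smul_zero, sub_zero, add_zero]
    | add x y hx hy =>
      simp only [map_add, hY.add_right, smul_add]
      rw [add_sub_add_comm, hx, hy]; abel
    | homog n f hf =>
      have h1 : contragredientOp hV hW u f k ∈ dualGrading GW (h + n + k) :=
        comp_opposite_mem_dualPiece hV hW hu k hf
      rw [gradedScalar_apply hG _ h1, gradedScalar_apply hG _ hf, vertexd,
        gradedScalar_apply hV.internal _ hu, hY.smul_left, hY.smul_right]
      module

/-- The conditions on the contragredient other than rationality and associativity. -/
theorem contragredient_isSl2LeftModule (hV : IsMobiusMOSVA GV YV vac ρV)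
    (hW : IsMobiusLeftModule GV YV vac ρV GW YW ρW)
    (hprod : ProductRationality (dualGrading GW) (contragredientOp hV hW.toIsSl2LeftModule))
    (hiter : IterateRationality (dualGrading GW) (skewOpposite YV vac)
      (contragredientOp hV hW.toIsSl2LeftModule))
    (hassoc : VertexAssociativity (dualGrading GW) (skewOpposite YV vac)
      (contragredientOp hV hW.toIsSl2LeftModule)) :
    IsSl2LeftModule GV (skewOpposite YV vac) vac ρV (dualGrading GW)
      (contragredientOp hV hW.toIsSl2LeftModule) (contragredientRep hW) where
  internal := dualGrading_internal hW.internal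
  bilinear := contragredientOp_bilinear hV hW.toIsSl2LeftModule
  D_weight m f hf := by
    have := comp_mem_dualPiece hW.Lpos_mem hf
    rwa [sub_neg_eq_add] at this
  lower_bound := by
    obtain ⟨N, hN⟩ := hW.lower_bound
    refine ⟨N, fun m hm => eq_bot_iff.2 fun f hf => ?_⟩
    ext w
    have h1 := gradedProj_mem hW.internal m w
    rw [hN m hm, Submodule.mem_bot] at h1
    exact (dualPiece_apply_eq hW.internal hf w).trans (by rw [h1, map_zero]; rfl)
  d_grading m f hf := gradedScalar_apply (dualGrading_internal hW.internal) _ hf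
  d_commutator := contragredientOp_d_commutator hV hW.toIsSl2LeftModule
  identity w' k := by
    ext w
    rw [contragredientOp_apply, oppositeVertexOp_vac hV hW.toIsSl2LeftModule]
    split_ifs
    · rfl
    · exact map_zero _
  D_derivative u w' k := by
    ext w
    rw [vertexD_skewOpposite hV]
    change _ * w'.1 (oppositeVertexOp GV ρV YW u w (k + 1)) = w'.1 (oppositeVertexOp GV ρV YW _ w k)
    rw [oppositeVertexOp_derivative hV hW.toIsSl2LeftModule, map_smul, smul_eq_mul]
  D_commutator u w' k := by
    ext w
    change _ * w'.1 (oppositeVertexOp GV ρV YW u w (k + 1))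
      = w'.1 (oppositeVertexOp GV ρV YW u (ρW.Lpos w) k)
        - w'.1 (ρW.Lpos (oppositeVertexOp GV ρV YW u w k))
    rw [← map_sub, oppositeVertexOp_Lpos hV hW.toIsSl2LeftModule, map_smul, smul_eq_mul]
  product_rationality := hprod
  iterate_rationality := hiter
  associativity := hassoc
  Lzero_commutator u w' k := by
    ext w
    change w'.1 (oppositeVertexOp GV ρV YW u (ρW.Lzero w) k)
        - w'.1 (ρW.Lzero (oppositeVertexOp GV ρV YW u w k))
      = w'.1 (oppositeVertexOp GV ρV YW (ρV.Lzero u) w k)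
        + w'.1 (oppositeVertexOp GV ρV YW (ρV.Lneg u) w (k - 1))
    rw [← map_sub, oppositeVertexOp_Lzero hV hW.toIsSl2LeftModule, map_add]
  Lpos_commutator u w' k := by
    ext w
    change w'.1 (oppositeVertexOp GV ρV YW u (ρW.Lneg w) k)
        - w'.1 (ρW.Lneg (oppositeVertexOp GV ρV YW u w k))
      = w'.1 (oppositeVertexOp GV ρV YW (ρV.Lpos u) w k)
        + 2 * w'.1 (oppositeVertexOp GV ρV YW (ρV.Lzero u) w (k - 1))
        + w'.1 (oppositeVertexOp GV ρV YW (ρV.Lneg u) w (k - 2))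
    rw [← map_sub, oppositeVertexOp_Lneg hV hW.toIsSl2LeftModule, map_add, map_add, map_smul,
      smul_eq_mul]

end Contragredient

/-! ### Nilpotency from the transpose -/

section Nilpotent

/-- An endomorphism whose transpose is locally nilpotent is nilpotent. -/
theorem exists_pow_eq_zero_of_dual {U : Type*} [AddCommGroup U] [Module ℂ U] (T : Module.End ℂ U)
    (hT : ∀ f : Module.Dual ℂ U, ∃ m : ℕ, f ∘ₗ (T ^ m) = 0) : ∃ m : ℕ, T ^ m = 0 := by
  have hanti : ∀ {a b : ℕ}, a ≤ b → LinearMap.range (T ^ b) ≤ LinearMap.range (T ^ a) := by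
    rintro a b hab _ ⟨y, rfl⟩
    exact ⟨(T ^ (b - a)) y, by rw [← Module.End.mul_apply, ← pow_add, Nat.add_sub_cancel' hab]⟩
  -- If the ranges of the powers stabilise at m, the range of T^m lies in that of every T^k, hence
  -- in the kernel of every functional.
  by_cases hst : ∃ m, LinearMap.range (T ^ m) ≤ LinearMap.range (T ^ (m + 1))
  · obtain ⟨m, hm⟩ := hst
    have h1 : ∀ k, LinearMap.range (T ^ m) ≤ LinearMap.range (T ^ (m + k)) := by
      intro k
      induction k with
      | zero => exact le_rfl
      | succ k ih =>
        intro x hx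
        obtain ⟨y, rfl⟩ := hm hx
        obtain ⟨z, hz⟩ := ih ⟨y, rfl⟩
        exact ⟨z, by rw [← add_assoc, pow_succ', Module.End.mul_apply, hz, pow_succ',
          Module.End.mul_apply]⟩
    refine ⟨m, LinearMap.ext fun y => (Module.forall_dual_apply_eq_zero_iff ℂ _).1 fun f => ?_⟩
    obtain ⟨k, hk⟩ := hT f
    obtain ⟨z, hz⟩ := (h1 k).trans (hanti (Nat.le_add_left k m)) ⟨y, rfl⟩
    rw [← hz]
    exact LinearMap.congr_fun hk z
  · push Not at hst
    -- Otherwise the ranges strictly decrease. Vectors chosen from successive differences are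
    -- independent, so some functional is 1 on all of them; it cannot vanish on the range of any
    -- T^m.
    choose x hx hx' using fun m => SetLike.not_le_iff_exists.1 (hst m)
    have hli : LinearIndependent ℂ x := by
      rw [linearIndependent_iff']
      intro s g hs i
      induction i using Nat.strong_induction_on with
      | _ i ih =>
        intro hi
        by_contra hg
        refine hx' i ?_
        rw [← Finset.add_sum_erase s _ hi, add_eq_zero_iff_eq_neg] at hs
        have h2 : g i • x i ∈ LinearMap.range (T ^ (i + 1)) := by
          rw [hs]
          refine neg_mem (Submodule.sum_mem _ fun j hj => ?_)
          obtain ⟨hji, hjs⟩ := Finset.mem_erase.1 hj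
          rcases lt_or_gt_of_ne hji with h | h
          · rw [ih j h hjs, zero_smul]; exact zero_mem _
          · exact Submodule.smul_mem _ _ (hanti h (hx j))
        simpa [smul_smul, inv_mul_cancel₀ hg] using Submodule.smul_mem _ (g i)⁻¹ h2
    obtain ⟨f, hf⟩ := Module.exists_dual_forall_apply_eq_one (linearIndepOn_univ_iff.2 hli)
    obtain ⟨m, hm⟩ := hT f
    obtain ⟨y, hy⟩ := hx m
    have h1 := hf m (Set.mem_univ m)
    rw [← hy, ← LinearMap.comp_apply, hm] at h1
    exact absurd h1 (by simp)

end Nilpotent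

/-! ### An algebra of rational functions with prescribed poles -/

section RationalFunctions

/-- The product of all `z i` and all `z i - z j`, `i < j`. -/
noncomputable def poleProduct (n : ℕ) : MvPolynomial (Fin n) ℂ :=
  (∏ i, MvPolynomial.X i) * ∏ i, ∏ j ∈ Finset.Ioi i, (MvPolynomial.X i - MvPolynomial.X j)

/-- The functions which on the set `R` are given by rational functions with poles only at `z i = 0`
and `z i = z j`. -/
noncomputable def rationalOn {n : ℕ} (R : Set (Fin n → ℂ)) : Subalgebra ℂ ((Fin n → ℂ) → ℂ) where
  carrier := {F | ∃ (N : ℕ) (f : MvPolynomial (Fin n) ℂ), ∀ z ∈ R,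
    F z * MvPolynomial.eval z (poleProduct n) ^ N = MvPolynomial.eval z f}
  mul_mem' := by
    rintro F F' ⟨N, f, h⟩ ⟨N', f', h'⟩
    refine ⟨N + N', f * f', fun z hz => ?_⟩
    rw [map_mul, ← h z hz, ← h' z hz, Pi.mul_apply]; ring
  add_mem' := by
    rintro F F' ⟨N, f, h⟩ ⟨N', f', h'⟩
    refine ⟨N + N', f * poleProduct n ^ N' + f' * poleProduct n ^ N, fun z hz => ?_⟩
    rw [map_add, map_mul, map_mul, map_pow, map_pow, ← h z hz, ← h' z hz, Pi.add_apply]; ring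
  algebraMap_mem' c := ⟨0, MvPolynomial.C c, fun z _ => by simp⟩

variable {n : ℕ} {R : Set (Fin n → ℂ)}

theorem rationalOn_congr {F F' : (Fin n → ℂ) → ℂ} (hF : F ∈ rationalOn R)
    (h : ∀ z ∈ R, F' z = F z) : F' ∈ rationalOn R := by
  obtain ⟨N, f, hf⟩ := hF
  exact ⟨N, f, fun z hz => by rw [h z hz, hf z hz]⟩

theorem coord_mem_rationalOn (i : Fin n) : (fun z => z i) ∈ rationalOn R :=
  ⟨0, MvPolynomial.X i, fun z _ => by simp⟩

theorem inv_mem_rationalOn {g : MvPolynomial (Fin n) ℂ} (hg : g ∣ poleProduct n)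
    (h0 : ∀ z ∈ R, MvPolynomial.eval z g ≠ 0) :
    (fun z => (MvPolynomial.eval z g)⁻¹) ∈ rationalOn R := by
  obtain ⟨f, hf⟩ := hg
  refine ⟨1, f, fun z hz => ?_⟩
  rw [pow_one, hf, map_mul, inv_mul_cancel_left₀ (h0 z hz)]

theorem coord_inv_mem_rationalOn (hR : ∀ z ∈ R, ∀ i, z i ≠ 0) (i : Fin n) :
    (fun z => (z i)⁻¹) ∈ rationalOn R := by
  have := inv_mem_rationalOn (R := R) (g := MvPolynomial.X i)
    ((Finset.dvd_prod_of_mem _ (Finset.mem_univ i)).trans (Dvd.intro _ rfl))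
    (fun z hz => by simpa using hR z hz i)
  simpa using this

theorem coord_zpow_mem_rationalOn (hR : ∀ z ∈ R, ∀ i, z i ≠ 0) (i : Fin n) (k : ℤ) :
    (fun z => z i ^ k) ∈ rationalOn R := by
  obtain ⟨k, rfl | rfl⟩ := k.eq_nat_or_neg
  · simpa using! pow_mem (coord_mem_rationalOn (R := R) i) k
  · refine rationalOn_congr (pow_mem (coord_inv_mem_rationalOn hR i) k) fun z _ => ?_
    simp

theorem sub_inv_mem_rationalOn (hR : ∀ z ∈ R, ∀ i j, i < j → z i ≠ z j) {i j : Fin n}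
    (hij : i < j) : (fun z => (z i - z j)⁻¹) ∈ rationalOn R := by
  have := inv_mem_rationalOn (R := R) (g := MvPolynomial.X i - MvPolynomial.X j)
    (((Finset.dvd_prod_of_mem (fun j : Fin n => (MvPolynomial.X i - MvPolynomial.X j :
      MvPolynomial (Fin n) ℂ)) (Finset.mem_Ioi.2 hij)).trans (Finset.dvd_prod_of_mem
      (fun i : Fin n => ∏ j ∈ Finset.Ioi i, (MvPolynomial.X i - MvPolynomial.X j :
      MvPolynomial (Fin n) ℂ)) (Finset.mem_univ i))).trans (Dvd.intro_left _ rfl))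
    (fun z hz => by simpa [sub_eq_zero] using hR z hz i j hij)
  simpa using this

theorem eval_mem_rationalOn {m : ℕ} {y : Fin m → (Fin n → ℂ) → ℂ} (hy : ∀ i, y i ∈ rationalOn R)
    (f : MvPolynomial (Fin m) ℂ) :
    (fun z => MvPolynomial.eval (fun i => y i z) f) ∈ rationalOn R := by
  induction f using MvPolynomial.induction_on with
  | C a => simp only [MvPolynomial.eval_C]; exact (rationalOn R).algebraMap_mem a
  | add p q hp hq => simpa using! add_mem hp hq
  | mul_X p i hp => simpa using! mul_mem hp (hy i)

/-- Substitution into a rational function. -/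
theorem eval_div_mem_rationalOn {m : ℕ} {y : Fin m → (Fin n → ℂ) → ℂ}
    (hy : ∀ i, y i ∈ rationalOn R) (hy' : ∀ i, (fun z => (y i z)⁻¹) ∈ rationalOn R)
    (hyy : ∀ i j, i < j → (fun z => (y i z - y j z)⁻¹) ∈ rationalOn R)
    (f : MvPolynomial (Fin m) ℂ) (p : Fin m → ℕ) (q : Fin m → Fin m → ℕ) :
    (fun z => MvPolynomial.eval (fun i => y i z) f /
      ((∏ i, y i z ^ p i) * ∏ i, ∏ j ∈ Finset.Ioi i, (y i z - y j z) ^ q i j)) ∈ rationalOn R := by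
  refine rationalOn_congr (mul_mem (eval_mem_rationalOn hy f)
    (mul_mem (prod_mem fun i (_ : i ∈ Finset.univ) => pow_mem (hy' i) (p i))
    (prod_mem fun i (_ : i ∈ Finset.univ) => prod_mem fun j (hj : j ∈ Finset.Ioi i) =>
      pow_mem (hyy i j (Finset.mem_Ioi.1 hj)) (q i j)))) fun z _ => ?_
  simp only [Pi.mul_apply, Finset.prod_apply, Pi.pow_apply, div_eq_mul_inv, mul_inv,
    ← Finset.prod_inv_distrib, inv_pow]

theorem exists_of_mem_rationalOn (hR : ∀ z ∈ R, ∀ i, z i ≠ 0)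
    (hR' : ∀ z ∈ R, ∀ i j, i < j → z i ≠ z j) {F : (Fin n → ℂ) → ℂ} (hF : F ∈ rationalOn R) :
    ∃ (N : ℕ) (f : MvPolynomial (Fin n) ℂ), ∀ z ∈ R, F z = MvPolynomial.eval z f /
      ((∏ i, z i ^ N) * ∏ i, ∏ j ∈ Finset.Ioi i, (z i - z j) ^ N) := by
  obtain ⟨N, f, hf⟩ := hF
  refine ⟨N, f, fun z hz => ?_⟩
  have e : MvPolynomial.eval z (poleProduct n) ^ N
      = (∏ i, z i ^ N) * ∏ i, ∏ j ∈ Finset.Ioi i, (z i - z j) ^ N := by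
    simp only [poleProduct, map_mul, map_prod, map_sub, MvPolynomial.eval_X, mul_pow,
      Finset.prod_pow]
  rw [← e, ← hf z hz, mul_div_cancel_right₀]
  rw [e]
  refine mul_ne_zero (Finset.prod_ne_zero_iff.2 fun i _ => pow_ne_zero _ (hR z hz i))
    (Finset.prod_ne_zero_iff.2 fun i _ => Finset.prod_ne_zero_iff.2 fun j hj =>
      pow_ne_zero _ (sub_ne_zero.2 (hR' z hz i j (Finset.mem_Ioi.1 hj))))

end RationalFunctions

/-! ### Products after inverting the variables -/

section Expansion

variable {V W α : Type*} [AddCommGroup V] [Module ℂ V] [AddCommGroup W] [Module ℂ W]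
  {Y Y' : V → W → ℤ → W}

/-- The coefficients of products of vertex operators of the form
`Y'(u, x) = ∑ c x ^ a Y(v, x⁻¹)`. -/
theorem prodCoeff_expansion (hY : IsVertexBilinear Y) (hY' : IsVertexBilinear Y') {n : ℕ}
    {u : Fin n → V} {A : Fin n → Finset α} {c : Fin n → α → ℂ} {v : Fin n → α → V}
    {a : Fin n → α → ℤ}
    (h : ∀ i w k, Y' (u i) w k = ∑ x ∈ A i, c i x • Y (v i x) w (a i x - k)) (w : W)
    (k : Fin n → ℤ) : prodCoeff Y' n u w k = ∑ r ∈ Fintype.piFinset A,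
      (∏ i, c i (r i)) • prodCoeff Y n (fun i => v i (r i)) w (fun i => a i (r i) - k i) := by
  have h1 : ∀ i, hY'.mode (k i) (u i)
      = ∑ x ∈ A i, c i x • hY.mode (a i x - k i) (v i x) := fun i => by
    ext w
    simp only [LinearMap.sum_apply, LinearMap.smul_apply]
    exact h i w (k i)
  rw [← hY'.prodEnd_apply, IsVertexBilinear.prodEnd, funext h1, MultilinearMap.map_sum_finset,
    LinearMap.sum_apply]
  refine Finset.sum_congr rfl fun r _ => ?_
  rw [MultilinearMap.map_smul_univ, LinearMap.smul_apply, ← hY.prodEnd_apply]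
  rfl

/-- Rests on x^k = x^a (x⁻¹)^(a - k) with the summation index reflected by k ↦ a - k. There are
finitely many choices r, so the convergent series simply add. -/
theorem hasSum_prodTerm_expansion (hY : IsVertexBilinear Y) (hY' : IsVertexBilinear Y') {n : ℕ}
    {u : Fin n → V} {A : Fin n → Finset α} {c : Fin n → α → ℂ} {v : Fin n → α → V}
    {a : Fin n → α → ℤ}
    (h : ∀ i w k, Y' (u i) w k = ∑ x ∈ A i, c i x • Y (v i x) w (a i x - k)) (w : W)
    (w' : Module.Dual ℂ W) {z : Fin n → ℂ} (hz : ∀ i, z i ≠ 0) {S : (Fin n → α) → ℂ}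
    (hS : ∀ r ∈ Fintype.piFinset A,
      HasSum (prodTerm Y w' (fun i => v i (r i)) w (fun i => (z i)⁻¹)) (S r)) :
    HasSum (prodTerm Y' w' u w z)
      (∑ r ∈ Fintype.piFinset A, (∏ i, c i (r i) * z i ^ a i (r i)) * S r) := by
  refine (hasSum_sum fun r hr => ((Equiv.subLeft fun i => a i (r i)).hasSum_iff.2
    (hS r hr)).mul_left (∏ i, c i (r i) * z i ^ a i (r i))).of_eq (fun k => ?_) rfl
  rw [prodTerm, prodCoeff_expansion hY hY' h, map_sum, Finset.sum_mul]
  refine Finset.sum_congr rfl fun r _ => ?_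
  simp only [Function.comp_apply, Equiv.subLeft_apply, prodTerm, Pi.sub_apply]
  rw [map_smul, smul_eq_mul, Finset.prod_mul_distrib]
  have : ∏ i, z i ^ k i = (∏ i, z i ^ a i (r i)) * ∏ i, (z i)⁻¹ ^ (a i (r i) - k i) := by
    rw [← Finset.prod_mul_distrib]
    refine Finset.prod_congr rfl fun i _ => ?_
    rw [inv_zpow', ← zpow_add₀ (hz i)]
    congr 1; ring
  rw [this]
  change _ = _ * (w' (prodCoeff Y n (fun i => v i (r i)) w (fun i => a i (r i) - k i)) * _)
  ring

end Expansion

/-! ### Rationality of products on the contragredient -/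

section Products

variable {V W : Type*} [AddCommGroup V] [Module ℂ V] [AddCommGroup W] [Module ℂ W]
  {GV : ℤ → Submodule ℂ V} {YV : V → V → ℤ → V} {vac : V} {ρV : Sl2Rep V}
  {GW : ℂ → Submodule ℂ W} {YW : V → W → ℤ → W} {ρW : Sl2Rep W}

theorem oppositeVertexOp_expansion (hV : IsMobiusMOSVA GV YV vac ρV) (hY : IsVertexBilinear YW)
    (u : V) : ∃ A : Finset (ℤ × ℕ), ∀ w k, oppositeVertexOp GV ρV YW u w k
      = ∑ x ∈ A, ((-1 : ℂ) ^ x.1 * (x.2.factorial : ℂ)⁻¹) •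
        YW ((ρV.Lpos ^ x.2) (gradedProj GV x.1 u)) w ((x.2 - 2 * x.1 : ℤ) - k) := by
  obtain ⟨S, M, hS, hM⟩ := exists_opposite_support hV u
  exact ⟨S ×ˢ Finset.range M, fun w k => by
    rw [oppositeVertexOp_eq_sum hY hS hM, Finset.sum_product]⟩

/-- Transposition reverses the order of composition. Inversion z ↦ 1/z reverses the order of
absolute values as well, so the domain of convergence is preserved. -/
theorem prodCoeff_contragredientOp (hV : IsMobiusMOSVA GV YV vac ρV)
    (hW : IsSl2LeftModule GV YV vac ρV GW YW ρW) (n : ℕ) (u : Fin n → V) (w' : gradedDual GW)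
    (w : W) (k : Fin n → ℤ) :
    (prodCoeff (contragredientOp hV hW) n u w' k).1 w
      = (w' : Module.Dual ℂ W) (prodCoeff (oppositeVertexOp GV ρV YW) n (fun i => u i.rev) w
        (fun i => k i.rev)) := by
  induction n generalizing w with
  | zero => rfl
  | succ n ih =>
    rw [prodCoeff, contragredientOp_apply, ih, prodCoeff_last]
    simp only [Fin.rev_last]
    congr 2
    · funext i; simp [Fin.init, Fin.tail, Fin.rev_castSucc]
    · funext i; simp [Fin.init, Fin.tail, Fin.rev_castSucc]

/-- The coefficients of products of contragredient vertex operators are detected on each weight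
space by finitely many functionals. -/
theorem exists_functionals_contragredient (hV : IsMobiusMOSVA GV YV vac ρV)
    (hW : IsSl2LeftModule GV YV vac ρV GW YW ρW) {C : ℝ} (hC : PoleOrderBound GV GW YW C) {n : ℕ}
    (u : Fin n → V) (w' : gradedDual GW) (m : ℂ) :
    ∃ s : Finset (Module.Dual ℂ W), ∀ w ∈ GW m, (∀ f ∈ s, f w = 0) →
      ∀ k, (prodCoeff (contragredientOp hV hW) n u w' k).1 w = 0 := by
  classical
  choose A hA using fun i : Fin n => oppositeVertexOp_expansion hV hW.bilinear (u i.rev)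
  choose s hs using fun r : Fin n → ℤ × ℕ =>
    exists_functionals_prodCoeff hV.toIsMOSVA hW hC w'.2
      (fun i => (ρV.Lpos ^ (r i).2) (gradedProj GV (r i).1 (u i.rev))) (fun i => (r i).1 - (r i).2)
      (fun i => hV.Lpos_pow_mem (gradedProj_mem hV.internal _ _) _) m
  refine ⟨(Fintype.piFinset A).biUnion s, fun w hw h k => ?_⟩
  rw [prodCoeff_contragredientOp,
    prodCoeff_expansion hW.bilinear (oppositeVertexOp_bilinear hV hW.bilinear) hA, map_sum]
  refine Finset.sum_eq_zero fun r hr => ?_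
  rw [map_smul, hs r w hw (fun f hf => h f (Finset.mem_biUnion.2 ⟨r, hr, hf⟩)), smul_zero]

theorem hasSum_prodTerm_contragredient (hV : IsMobiusMOSVA GV YV vac ρV)
    (hW : IsSl2LeftModule GV YV vac ρV GW YW ρW) {n : ℕ} {u : Fin n → V} {w' : gradedDual GW}
    {φ : Module.Dual ℂ (gradedDual GW)} {w : W}
    (hφ : ∀ k, φ (prodCoeff (contragredientOp hV hW) n u w' k)
      = (prodCoeff (contragredientOp hV hW) n u w' k).1 w) {z : Fin n → ℂ} {s : ℂ}
    (h : HasSum (prodTerm (oppositeVertexOp GV ρV YW) (w' : Module.Dual ℂ W) (fun i => u i.rev) w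
      (fun i => z i.rev)) s) : HasSum (prodTerm (contragredientOp hV hW) φ u w' z) s := by
  rw [← (Equiv.arrowCongr Fin.revPerm (Equiv.refl ℤ)).hasSum_iff] at h
  refine h.of_eq (fun k => ?_) rfl
  rw [prodTerm, hφ, prodCoeff_contragredientOp]
  simp only [Function.comp_apply, prodTerm]
  congr 1
  exact (Equiv.prod_comp Fin.revPerm fun i => z i ^ k i).symm

theorem contragredient_productRationality (hV : IsMobiusMOSVA GV YV vac ρV)
    (hW : IsSl2LeftModule GV YV vac ρV GW YW ρW) {C : ℝ} (hC : PoleOrderBound GV GW YW C) :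
    ProductRationality (dualGrading GW) (contragredientOp hV hW) := by
  intro n u w' φ hφ
  obtain ⟨w, hw⟩ := exists_eval_eq hW.internal hφ
    -- From here on φ is represented by a genuine vector w for all coefficients of this product.
    (Set.range (prodCoeff (contragredientOp hV hW) n u w')) (fun m => by
      obtain ⟨s, hs⟩ := exists_functionals_contragredient hV hW hC u w' m
      exact ⟨s, fun x hx h => Set.forall_mem_range.2 (hs x hx h)⟩)
  choose A hA using fun i : Fin n => oppositeVertexOp_expansion hV hW.bilinear (u i.rev)
  choose f p q hf using fun r : Fin n → ℤ × ℕ => hW.product_rationality n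
    (fun i => (ρV.Lpos ^ (r i).2) (gradedProj GV (r i).1 (u i.rev))) w w'.1 w'.2
  let R : Set (Fin n → ℂ) := {z | (∀ i, z i ≠ 0) ∧ ∀ i j, i < j → ‖z j‖ < ‖z i‖}
  have hR : ∀ z ∈ R, ∀ i, z i ≠ 0 := fun z hz => hz.1
  have hR' : ∀ z ∈ R, ∀ i j, i < j → z i ≠ z j := fun z hz i j hij e =>
    (hz.2 i j hij).ne (by rw [e])
  have hinv := coord_inv_mem_rationalOn hR
  have key := fun z (hz : z ∈ R) => hasSum_prodTerm_contragredient hV hW (z := z)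
    (Set.forall_mem_range.1 hw)
    (hasSum_prodTerm_expansion hW.bilinear (oppositeVertexOp_bilinear hV hW.bilinear) hA w w'
      (z := fun i => z i.rev) (fun i => hz.1 i.rev) fun r _ => hf r _
        (fun i => inv_ne_zero (hz.1 i.rev)) fun i j hij => by
          rw [norm_inv, norm_inv]
          exact inv_strictAnti₀ (norm_pos_iff.2 (hz.1 _)) (hz.2 _ _ (Fin.rev_lt_rev.2 hij)))
  -- No new poles arise: (1/a - 1/b)⁻¹ = ab/(b - a), and reversing the indices gives b - a the
  -- orientation used in the denominators.
  obtain ⟨N, g, hg⟩ := exists_of_mem_rationalOn hR hR' (F := fun z => ∑ r ∈ Fintype.piFinset A,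
    (∏ i, ((-1 : ℂ) ^ (r i).1 * ((r i).2.factorial : ℂ)⁻¹) *
      z i.rev ^ ((r i).2 - 2 * (r i).1 : ℤ)) *
      (MvPolynomial.eval (fun i => (z i.rev)⁻¹) (f r) / ((∏ i, (z i.rev)⁻¹ ^ p r i) *
      ∏ i, ∏ j ∈ Finset.Ioi i, ((z i.rev)⁻¹ - (z j.rev)⁻¹) ^ q r i j)))
    (rationalOn_congr (sum_mem fun r (_ : r ∈ Fintype.piFinset A) => mul_mem
      (prod_mem fun i (_ : i ∈ Finset.univ) => mul_mem ((rationalOn R).algebraMap_mem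
        ((-1 : ℂ) ^ (r i).1 * ((r i).2.factorial : ℂ)⁻¹))
        (coord_zpow_mem_rationalOn hR i.rev ((r i).2 - 2 * (r i).1 : ℤ)))
      (eval_div_mem_rationalOn (fun i => hinv i.rev)
        (fun i => rationalOn_congr (coord_mem_rationalOn i.rev) fun z _ => inv_inv _)
        (fun i j hij => rationalOn_congr (mul_mem (mul_mem (coord_mem_rationalOn i.rev)
          (coord_mem_rationalOn j.rev)) (sub_inv_mem_rationalOn hR' (Fin.rev_lt_rev.2 hij)))
          fun z hz => by
            simp only [Pi.mul_apply]
            rw [inv_sub_inv (hR z hz i.rev) (hR z hz j.rev), inv_div, div_eq_mul_inv])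
        (f r) (p r) (q r)))
      fun z _ => by
        simp only [Finset.sum_apply, Pi.mul_apply, Finset.prod_apply, Pi.algebraMap_apply,
          Algebra.algebraMap_self, RingHom.id_apply])
  refine ⟨g, fun _ => N, fun _ _ => N, fun z h1 h2 => ?_⟩
  rw [← hg z ⟨h1, h2⟩]
  exact key z ⟨h1, h2⟩

end Products

/-! ### Binomial identities and a Leibniz rule -/

section Binomial

theorem succ_mul_choose_succ (r : ℤ) (j : ℕ) :
    ((j : ℂ) + 1) * ((Ring.choose (r + 1) (j + 1) : ℤ) : ℂ)
      = (r + 1) * ((Ring.choose r j : ℤ) : ℂ) := by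
  have h := Ring.choose_smul_choose (r + 1) (Nat.le_add_left 1 j)
  rw [Nat.choose_one_right, Ring.choose_one_right, Nat.add_sub_cancel, nsmul_eq_mul, Nat.cast_one,
    add_sub_cancel_right] at h
  exact_mod_cast h

theorem choose_succ_succ_complex (r : ℤ) (j : ℕ) : ((Ring.choose (r + 1) (j + 1) : ℤ) : ℂ)
    = ((Ring.choose r j : ℤ) : ℂ) + ((Ring.choose r (j + 1) : ℤ) : ℂ) := by
  rw [Ring.choose_succ_succ, Int.cast_add]

/-- If `T A_N = A_N T + (N + 1) A_{N + 1}` then `T ^ M A_0 / M! = ∑ A_N T ^ b / b!`. -/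
theorem inv_factorial_smul_pow_leibniz {E : Type*} [AddCommGroup E] [Module ℂ E]
    (T : Module.End ℂ E) (A : ℕ → E → E)
    (h : ∀ N x, T (A N x) = A N (T x) + ((N : ℂ) + 1) • A (N + 1) x) (M : ℕ) (x : E) :
    (M.factorial : ℂ)⁻¹ • (T ^ M) (A 0 x) = ∑ b ∈ Finset.HasAntidiagonal.antidiagonal M,
      (b.1.factorial : ℂ)⁻¹ • A b.2 ((T ^ b.1) x) := by
  induction M with
  | zero => simp
  | succ M ih =>
    have hM : ((M : ℂ) + 1) ≠ 0 := by exact_mod_cast Nat.succ_ne_zero M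
    have h1 : ((M + 1).factorial : ℂ)⁻¹ • (T ^ (M + 1)) (A 0 x)
        = ((M : ℂ) + 1)⁻¹ • T ((M.factorial : ℂ)⁻¹ • (T ^ M) (A 0 x)) := by
      rw [map_smul, smul_smul, Nat.factorial_succ, pow_succ', Module.End.mul_apply]
      push_cast
      rw [mul_inv]
    rw [h1, ih, inv_smul_eq_iff₀ hM, map_sum, Finset.smul_sum]
    have h2 : ∀ b ∈ Finset.HasAntidiagonal.antidiagonal (M + 1),
        ((M : ℂ) + 1) • (b.1.factorial : ℂ)⁻¹ • A b.2 ((T ^ b.1) x)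
          = ((b.1 : ℂ) * (b.1.factorial : ℂ)⁻¹) • A b.2 ((T ^ b.1) x)
            + ((b.2 : ℂ) * (b.1.factorial : ℂ)⁻¹) • A b.2 ((T ^ b.1) x) := fun b hb => by
      rw [Finset.HasAntidiagonal.mem_antidiagonal] at hb
      have : ((M : ℂ) + 1) = b.1 + b.2 := by exact_mod_cast hb.symm
      rw [this]; module
    rw [Finset.sum_congr rfl h2, Finset.sum_add_distrib, Finset.Nat.sum_antidiagonal_succ,
      Finset.Nat.sum_antidiagonal_succ']
    simp only [Nat.cast_zero, zero_mul, zero_smul, zero_add]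
    rw [← Finset.sum_add_distrib]
    refine Finset.sum_congr rfl fun b _ => ?_
    rw [map_smul, h, smul_add, smul_smul, ← Module.End.mul_apply, ← pow_succ']
    congr 2
    · rw [Nat.factorial_succ]
      have := Nat.factorial_ne_zero b.1
      have h2 : (b.1 : ℂ) + 1 ≠ 0 := by exact_mod_cast Nat.succ_ne_zero b.1
      push_cast
      field_simp
    · push_cast; ring

end Binomial

/-! ### Opposite vertex operators of iterates -/

section Skew

variable {V W : Type*} [AddCommGroup V] [Module ℂ V] [AddCommGroup W] [Module ℂ W]
  {GV : ℤ → Submodule ℂ V} {YV : V → V → ℤ → V} {vac : V} {ρV : Sl2Rep V}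
  {GW : ℂ → Submodule ℂ W} {YW : V → W → ℤ → W} {ρW : Sl2Rep W}

/-- The coefficient of `t ^ N` in the conjugate `e^{tL(1)} u_k e^{-tL(1)}` of a mode of a vector `u` of
weight `h`, applied to `v`. -/
noncomputable def posConjugate (ρ : Sl2Rep V) (Y : V → V → ℤ → V) (h : ℤ) (u : V) (k : ℤ) (N : ℕ)
    (v : V) : V :=
  ∑ x ∈ Finset.HasAntidiagonal.antidiagonal N,
    ((-1 : ℂ) ^ x.2 * ((Ring.choose (x.1 - 2 * h - k + x.2) x.2 : ℤ) : ℂ) * (x.1.factorial : ℂ)⁻¹) •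
      Y ((ρ.Lpos ^ x.1) u) v (k - x.2)

/-- The generating function of these operators is Y(e^{t(1-tx)L(1)}(1-tx)^{-2L(0)}u, x/(1-tx)), and
the identity expresses that its t-derivative is the commutator with L(1). -/
theorem Lpos_posConjugate (hV : IsMobiusMOSVA GV YV vac ρV) {h : ℤ} {u : V} (hu : u ∈ GV h) (k : ℤ)
    (N : ℕ) (v : V) : ρV.Lpos (posConjugate ρV YV h u k N v)
      = posConjugate ρV YV h u k N (ρV.Lpos v)
        + ((N : ℂ) + 1) • posConjugate ρV YV h u k (N + 1) v := by
  set d : ℕ → ℕ → ℂ := fun a j => (-1 : ℂ) ^ j * ((Ring.choose (a - 2 * h - k + j) j : ℤ) : ℂ) *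
    (a.factorial : ℂ)⁻¹ with hd
  -- Write N + 1 = a + j. Pascal's rule and absorption split the coefficient into a part raising the
  -- power of L(1) and a part lowering the mode; the latter is absent for j = 0.
  have h2 : ∀ x ∈ Finset.HasAntidiagonal.antidiagonal (N + 1),
      ((N : ℂ) + 1) • d x.1 x.2 • YV ((ρV.Lpos ^ x.1) u) v (k - x.2)
        = ((x.1 : ℂ) * (-1) ^ x.2 * (x.1.factorial : ℂ)⁻¹ *
            ((Ring.choose (x.1 - 2 * h - k + x.2 - 1) x.2 : ℤ) : ℂ)) •
              YV ((ρV.Lpos ^ x.1) u) v (k - x.2)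
          + (if x.2 = 0 then 0 else (-1 : ℂ) ^ x.2 * (x.1.factorial : ℂ)⁻¹ *
            (x.1 - 2 * h - k + x.2 + x.1) *
            ((Ring.choose (x.1 - 2 * h - k + x.2 - 1) (x.2 - 1) : ℤ) : ℂ)) •
              YV ((ρV.Lpos ^ x.1) u) v (k - x.2) := by
    rintro ⟨a, j⟩ hx
    rw [Finset.HasAntidiagonal.mem_antidiagonal] at hx
    have : ((N : ℂ) + 1) = a + j := by exact_mod_cast hx.symm
    rw [this, smul_smul, ← add_smul]
    congr 1
    simp only [hd]
    rcases j with _ | j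
    · simp
    · have e1 := choose_succ_succ_complex (a - 2 * h - k + j) j
      have e2 := succ_mul_choose_succ (a - 2 * h - k + j) j
      have i1 : (a : ℤ) - 2 * h - k + ((j + 1 : ℕ) : ℤ) = a - 2 * h - k + j + 1 := by
        push_cast; ring
      rw [if_neg (Nat.succ_ne_zero j), i1, add_sub_cancel_right, Nat.add_sub_cancel]
      push_cast at e2 ⊢
      linear_combination (-1 : ℂ) ^ (j + 1) * (a.factorial : ℂ)⁻¹ * (a * e1 + e2)
  simp only [posConjugate]
  rw [map_sum, Finset.smul_sum]
  change ∑ x ∈ Finset.HasAntidiagonal.antidiagonal N, ρV.Lpos (d x.1 x.2 • _) = _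
    + ∑ x ∈ Finset.HasAntidiagonal.antidiagonal (N + 1), ((N : ℂ) + 1) • d x.1 x.2 •
      YV ((ρV.Lpos ^ x.1) u) v (k - x.2)
  rw [Finset.sum_congr rfl h2, Finset.sum_add_distrib, Finset.Nat.sum_antidiagonal_succ,
    Finset.Nat.sum_antidiagonal_succ']
  simp only [Nat.cast_zero, zero_mul, zero_smul, zero_add, if_pos, if_neg (Nat.succ_ne_zero _)]
  rw [← Finset.sum_add_distrib, ← Finset.sum_add_distrib]
  refine Finset.sum_congr rfl fun x _ => ?_
  rw [map_smul, hV.Lpos_mode (hV.Lpos_pow_mem hu x.1), ← Module.End.mul_apply ρV.Lpos, ← pow_succ',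
    smul_add, smul_add, add_assoc]
  congr 1
  have i1 : k - ((x.2 + 1 : ℕ) : ℤ) = k - x.2 - 1 := by push_cast; ring
  rw [i1, smul_smul]
  congr 2
  · have := Nat.factorial_ne_zero x.1
    have h2 : (x.1 : ℂ) + 1 ≠ 0 := by exact_mod_cast Nat.succ_ne_zero x.1
    have i2 : (((x.1 + 1 : ℕ) : ℤ) - 2 * h - k + x.2 - 1) = x.1 - 2 * h - k + x.2 := by
      push_cast; ring
    rw [i2]
    simp only [hd]
    rw [Nat.factorial_succ]
    push_cast
    field_simp
  · have i2 : ((x.1 : ℤ) - 2 * h - k + ((x.2 + 1 : ℕ) : ℤ) - 1) = x.1 - 2 * h - k + x.2 := by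
      push_cast; ring
    rw [i2, Nat.add_sub_cancel]
    simp only [hd]
    push_cast
    ring

/-- The action of `L(1) ^ M / M!` on `u_k v`. -/
theorem Lpos_pow_mode (hV : IsMobiusMOSVA GV YV vac ρV) {h : ℤ} {u : V} (hu : u ∈ GV h) (v : V)
    (k : ℤ) (M : ℕ) : (M.factorial : ℂ)⁻¹ • (ρV.Lpos ^ M) (YV u v k)
      = ∑ b ∈ Finset.HasAntidiagonal.antidiagonal M,
        (b.1.factorial : ℂ)⁻¹ • posConjugate ρV YV h u k b.2 ((ρV.Lpos ^ b.1) v) := by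
  rw [← inv_factorial_smul_pow_leibniz ρV.Lpos _ (Lpos_posConjugate hV hu k)]
  simp [posConjugate]

theorem skewOpposite_eq_sum (hV : IsMobiusMOSVA GV YV vac ρV) {u v : V} {N k : ℤ} {T : ℕ}
    (hN : ∀ k < N, YV v u k = 0) (hT : k - N < T) : skewOpposite YV vac u v k
      = ∑ j ∈ Finset.range T, ((-1 : ℂ) ^ (k - j) * (j.factorial : ℂ)⁻¹) •
        (ρV.Lneg ^ j) (YV v u (k - j)) := by
  have hD : vertexD YV vac = ρV.Lneg := funext fun v => (hV.Lneg_eq v).symm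
  rw [skewOpposite, finsum_eq_sum_of_support_subset (s := Finset.range T)]
  · simp only [hD, Module.End.coe_pow]
  · intro j hj
    rw [Function.mem_support] at hj
    simp only [Finset.coe_range, Set.mem_Iio]
    by_contra hc
    exact hj (by rw [hN _ (by omega), hD, ← Module.End.coe_pow, map_zero, smul_zero])

theorem skewOpposite_add_left (hV : IsMobiusMOSVA GV YV vac ρV) (u u' v : V) (k : ℤ) :
    skewOpposite YV vac (u + u') v k = skewOpposite YV vac u v k + skewOpposite YV vac u' v k := by
  obtain ⟨N, hN⟩ := hV.mode_eq_zero v u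
  obtain ⟨N', hN'⟩ := hV.mode_eq_zero v u'
  have hT : k - min N N' < (k - min N N' + 1).toNat := by omega
  rw [skewOpposite_eq_sum hV (fun k hk => by
      rw [hV.bilinear.add_right, hN k (by omega), hN' k (by omega), add_zero]) hT,
    skewOpposite_eq_sum hV (fun k hk => hN k (by omega)) hT,
    skewOpposite_eq_sum hV (fun k hk => hN' k (by omega)) hT, ← Finset.sum_add_distrib]
  simp only [hV.bilinear.add_right, map_add, smul_add]

theorem skewOpposite_add_right (hV : IsMobiusMOSVA GV YV vac ρV) (u v v' : V) (k : ℤ) :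
    skewOpposite YV vac u (v + v') k = skewOpposite YV vac u v k + skewOpposite YV vac u v' k := by
  obtain ⟨N, hN⟩ := hV.mode_eq_zero v u
  obtain ⟨N', hN'⟩ := hV.mode_eq_zero v' u
  have hT : k - min N N' < (k - min N N' + 1).toNat := by omega
  rw [skewOpposite_eq_sum hV (fun k hk => by
      rw [hV.bilinear.add_left, hN k (by omega), hN' k (by omega), add_zero]) hT,
    skewOpposite_eq_sum hV (fun k hk => hN k (by omega)) hT,
    skewOpposite_eq_sum hV (fun k hk => hN' k (by omega)) hT, ← Finset.sum_add_distrib]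
  simp only [hV.bilinear.add_left, map_add, smul_add]

theorem skewOpposite_mem (hV : IsMobiusMOSVA GV YV vac ρV) {h₁ h₂ : ℤ} {u₁ u₂ : V}
    (hu₁ : u₁ ∈ GV h₁) (hu₂ : u₂ ∈ GV h₂) (k : ℤ) :
    skewOpposite YV vac u₁ u₂ k ∈ GV (h₁ + h₂ + k) := by
  obtain ⟨N, hN⟩ := hV.mode_eq_zero u₂ u₁
  rw [skewOpposite_eq_sum hV hN (T := (k - N + 1).toNat) (by omega)]
  refine Submodule.sum_mem _ fun j _ => Submodule.smul_mem _ _ ?_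
  have : ∀ j : ℕ, ∀ v n, v ∈ GV n → (ρV.Lneg ^ j) v ∈ GV (n + j) := by
    intro j v n hv
    induction j with
    | zero => simpa using hv
    | succ j ih =>
      rw [pow_succ', Module.End.mul_apply]
      convert hV.Lneg_mem ih using 2
      push_cast; ring
  convert this j _ _ (hV.mode_mem hu₂ hu₁ (k - j)) using 2
  ring

/-- Iterating the L(-1)-derivative property gives the Taylor coefficients of Y^o(v, x + y). -/
theorem oppositeVertexOp_Lneg_pow (hV : IsMobiusMOSVA GV YV vac ρV)
    (hW : IsSl2LeftModule GV YV vac ρV GW YW ρW) (v : V) (w : W) (l : ℤ) (j : ℕ) :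
    (j.factorial : ℂ)⁻¹ • oppositeVertexOp GV ρV YW ((ρV.Lneg ^ j) v) w l
      = ((Ring.choose (l + j) j : ℤ) : ℂ) • oppositeVertexOp GV ρV YW v w (l + j) := by
  induction j generalizing v with
  | zero => simp
  | succ j ih =>
    have h2 : (j : ℂ) + 1 ≠ 0 := by exact_mod_cast Nat.succ_ne_zero j
    rw [pow_succ, Module.End.mul_apply, Nat.factorial_succ, Nat.cast_mul, mul_inv, mul_smul, ih,
      oppositeVertexOp_derivative hV hW, smul_smul, smul_smul]
    have e := succ_mul_choose_succ (l + j) j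
    have i1 : l + ((j + 1 : ℕ) : ℤ) = l + j + 1 := by push_cast; ring
    rw [i1]
    congr 1
    push_cast at e ⊢
    rw [mul_assoc, inv_mul_eq_iff_eq_mul₀ h2, e]; ring

/-- The opposite vertex operator of `(u₂)_k u₁` in terms of the modes of the `L(1) ^ a u₂` on the
`L(1) ^ b u₁`. -/
theorem oppositeVertexOp_mode (hV : IsMobiusMOSVA GV YV vac ρV)
    (hW : IsSl2LeftModule GV YV vac ρV GW YW ρW) {h₁ h₂ : ℤ} {u₁ u₂ : V} (hu₁ : u₁ ∈ GV h₁)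
    (hu₂ : u₂ ∈ GV h₂) {A : ℕ} (hA₁ : ∀ m, A ≤ m → (ρV.Lpos ^ m) u₁ = 0)
    (hA₂ : ∀ m, A ≤ m → (ρV.Lpos ^ m) u₂ = 0) {N : ℤ}
    (hN : ∀ a b, ∀ k < N, YV ((ρV.Lpos ^ a) u₂) ((ρV.Lpos ^ b) u₁) k = 0) (w : W) (k l : ℤ) {T : ℕ}
    (hT : k - N < T) : oppositeVertexOp GV ρV YW (YV u₂ u₁ k) w l
      = (-1 : ℂ) ^ (h₁ + h₂ + k) • ∑ b ∈ Finset.range A, ∑ a ∈ Finset.range A,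
        ∑ j ∈ Finset.range T, ((b.factorial : ℂ)⁻¹ * ((-1 : ℂ) ^ j *
          ((Ring.choose (a - 2 * h₂ - k + j) j : ℤ) : ℂ) * (a.factorial : ℂ)⁻¹)) •
          YW (YV ((ρV.Lpos ^ a) u₂) ((ρV.Lpos ^ b) u₁) (k - j)) w
            (b + a + j - 2 * (h₁ + h₂ + k) - l) := by
  have hv : YV u₂ u₁ k ∈ GV (h₁ + h₂ + k) := by
    rw [add_comm h₁ h₂]; exact hV.mode_mem hu₂ hu₁ k
  obtain ⟨M, hM⟩ := hV.exists_Lpos_pow_eq_zero (YV u₂ u₁ k)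
  rw [oppositeVertexOp_of_mem hV hW.bilinear hv (M := max M (A + (A + T)))
    (fun m hm => hM m (by omega))]
  congr 1
  set F : ℕ → ℕ → ℕ → W := fun b a j => ((b.factorial : ℂ)⁻¹ * ((-1 : ℂ) ^ j *
    ((Ring.choose (a - 2 * h₂ - k + j) j : ℤ) : ℂ) * (a.factorial : ℂ)⁻¹)) •
    YW (YV ((ρV.Lpos ^ a) u₂) ((ρV.Lpos ^ b) u₁) (k - j)) w
      (b + a + j - 2 * (h₁ + h₂ + k) - l) with hF
  have h1 : ∀ m ∈ Finset.range (max M (A + (A + T))), (m.factorial : ℂ)⁻¹ •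
      YW ((ρV.Lpos ^ m) (YV u₂ u₁ k)) w (m - 2 * (h₁ + h₂ + k) - l)
      = ∑ b ∈ Finset.HasAntidiagonal.antidiagonal m,
        ∑ x ∈ Finset.HasAntidiagonal.antidiagonal b.2, F b.1 x.1 x.2 := by
    intro m _
    rw [← hW.bilinear.smul_left, Lpos_pow_mode hV hu₂, hW.bilinear.sum_left]
    refine Finset.sum_congr rfl fun b hb => ?_
    rw [Finset.HasAntidiagonal.mem_antidiagonal] at hb
    rw [posConjugate, Finset.smul_sum, hW.bilinear.sum_left]
    refine Finset.sum_congr rfl fun x hx => ?_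
    rw [Finset.HasAntidiagonal.mem_antidiagonal] at hx
    rw [smul_smul, hW.bilinear.smul_left, ← hb, ← hx]
    simp only [hF]
    congr 2
    push_cast; ring
  have F1 : ∀ b a j, A ≤ b → F b a j = 0 := fun b a j hb => by
    simp only [hF]
    rw [hA₁ b hb, hV.bilinear.zero_right, hW.bilinear.zero_left, smul_zero]
  have F2 : ∀ b a j, A ≤ a → F b a j = 0 := fun b a j ha => by
    simp only [hF]
    rw [hA₂ a ha, hV.bilinear.zero_left, hW.bilinear.zero_left, smul_zero]
  have F3 : ∀ b a j, T ≤ j → F b a j = 0 := fun b a j hj => by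
    simp only [hF]
    rw [hN a b _ (by omega), hW.bilinear.zero_left, smul_zero]
  rw [Finset.sum_congr rfl h1, sum_antidiagonal_box (A := A) (B := A + T)
    (f := fun b n => ∑ x ∈ Finset.HasAntidiagonal.antidiagonal n, F b x.1 x.2)
    (fun b n hb => Finset.sum_eq_zero fun x _ => F1 b _ _ hb)
    (fun b n hn => Finset.sum_eq_zero fun x hx => by
      rw [Finset.HasAntidiagonal.mem_antidiagonal] at hx
      by_cases h : A ≤ x.1
      · exact F2 b _ _ h
      · exact F3 b _ _ (by omega)) (by omega)]
  refine Finset.sum_congr rfl fun b _ => ?_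
  exact sum_antidiagonal_box (F2 b) (F3 b) (by omega)

/-- The opposite vertex operator of the modes of the skew-symmetric opposite vertex operator. -/
theorem oppositeVertexOp_skewOpposite (hV : IsMobiusMOSVA GV YV vac ρV)
    (hW : IsSl2LeftModule GV YV vac ρV GW YW ρW) {h₁ h₂ : ℤ} {u₁ u₂ : V} (hu₁ : u₁ ∈ GV h₁)
    (hu₂ : u₂ ∈ GV h₂) {A : ℕ} (hA₁ : ∀ m, A ≤ m → (ρV.Lpos ^ m) u₁ = 0)
    (hA₂ : ∀ m, A ≤ m → (ρV.Lpos ^ m) u₂ = 0) (w : W) (ψ : Module.Dual ℂ W) (e k : ℤ) :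
    ψ (oppositeVertexOp GV ρV YW (skewOpposite YV vac u₁ u₂ k) w (e - k))
      = ∑ a ∈ Finset.range A, ∑ b ∈ Finset.range A,
        ((-1 : ℂ) ^ (h₁ + h₂) * (a.factorial : ℂ)⁻¹ * (b.factorial : ℂ)⁻¹) *
        ∑ᶠ j : ℕ, ((Ring.choose (e + 2 * h₂ - a) j : ℤ) : ℂ) *
          ψ (YW (YV ((ρV.Lpos ^ a) u₂) ((ρV.Lpos ^ b) u₁) (k - j)) w
            (a + b - 2 * h₁ - 2 * h₂ - e - (k - j))) := by
  have hYo := oppositeVertexOp_bilinear hV hW.bilinear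
  have hN : ∃ N : ℤ, ∀ a b, ∀ k < N, YV ((ρV.Lpos ^ a) u₂) ((ρV.Lpos ^ b) u₁) k = 0 := by
    choose f hf using fun x : ℕ × ℕ => hV.mode_eq_zero ((ρV.Lpos ^ x.1) u₂) ((ρV.Lpos ^ x.2) u₁)
    obtain ⟨N, hN⟩ := ((Finset.range A ×ˢ Finset.range A).image f).bddBelow
    refine ⟨N, fun a b k hk => ?_⟩
    by_cases ha : A ≤ a
    · rw [hA₂ a ha, hV.bilinear.zero_left]
    by_cases hb : A ≤ b
    · rw [hA₁ b hb, hV.bilinear.zero_right]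
    refine hf (a, b) k (hk.trans_le (hN (Finset.mem_coe.2 (Finset.mem_image_of_mem f ?_))))
    simp only [Finset.mem_product, Finset.mem_range]
    omega
  obtain ⟨N, hN⟩ := hN
  set T := (k - N + 1).toNat with hT
  -- The matrix coefficient depends on the exponent i from e^{xL(-1)} and the exponent j from
  -- L(1)-conjugation only through n = i + j, so the two binomial factors can be summed first.
  set β : ℕ → ℕ → ℕ → ℂ := fun a b n =>
    ψ (YW (YV ((ρV.Lpos ^ a) u₂) ((ρV.Lpos ^ b) u₁) (k - n)) w
      (a + b - 2 * h₁ - 2 * h₂ - e - (k - n))) with hβ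
  have hβ0 : ∀ a b n, T ≤ n → β a b n = 0 := fun a b n hn => by
    simp only [hβ]
    rw [hN a b _ (by omega), hW.bilinear.zero_left, map_zero]
  rw [skewOpposite_eq_sum hV (N := N) (T := T) (by simpa using hN 0 0) (by omega),
    hYo.sum_left, map_sum]
  have h1 : ∀ i ∈ Finset.range T, ψ (oppositeVertexOp GV ρV YW
      (((-1 : ℂ) ^ (k - i) * (i.factorial : ℂ)⁻¹) • (ρV.Lneg ^ i) (YV u₂ u₁ (k - i))) w (e - k))
      = ∑ a ∈ Finset.range A, ∑ b ∈ Finset.range A,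
        ((-1 : ℂ) ^ (h₁ + h₂) * (a.factorial : ℂ)⁻¹ * (b.factorial : ℂ)⁻¹) *
        ∑ j ∈ Finset.range T, ((Ring.choose (e - k + i) i : ℤ) : ℂ) * ((-1 : ℂ) ^ j *
          ((Ring.choose (a - 2 * h₂ - k + i + j) j : ℤ) : ℂ)) * β a b (i + j) := by
    intro i _
    rw [hYo.smul_left, mul_smul, oppositeVertexOp_Lneg_pow hV hW,
      oppositeVertexOp_mode hV hW hu₁ hu₂ hA₁ hA₂ hN w _ _ (T := T) (by omega), map_smul, map_smul,
      map_smul, map_sum, Finset.sum_comm]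
    simp only [map_sum, map_smul, smul_eq_mul, Finset.mul_sum]
    refine Finset.sum_congr rfl fun b _ => Finset.sum_congr rfl fun a _ =>
      Finset.sum_congr rfl fun j _ => ?_
    have e1 : (-1 : ℂ) ^ (h₁ + h₂ + (k - i)) = (-1) ^ (h₁ + h₂) * (-1) ^ (k - i) :=
      zpow_add₀ (by norm_num) _ _
    have e2 : (-1 : ℂ) ^ (k - i) * (-1) ^ (k - i) = 1 := by
      rw [← mul_zpow]; norm_num
    have e3 : ψ (YW (YV ((ρV.Lpos ^ a) u₂) ((ρV.Lpos ^ b) u₁) (k - i - j)) w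
        (b + a + j - 2 * (h₁ + h₂ + (k - i)) - (e - k + i))) = β a b (i + j) := by
      simp only [hβ]
      congr 2
      · congr 1; push_cast; ring
      · push_cast; ring
    have e4 : (a : ℤ) - 2 * h₂ - (k - i) + j = a - 2 * h₂ - k + i + j := by ring
    rw [e1, e3, e4]
    linear_combination ((Ring.choose (e - k + i) i : ℤ) : ℂ) * (-1) ^ (h₁ + h₂) *
      (b.factorial : ℂ)⁻¹ * (-1) ^ j * ((Ring.choose ((a : ℤ) - 2 * h₂ - k + i + j) j : ℤ) : ℂ) *
      (a.factorial : ℂ)⁻¹ * β a b (i + j) * e2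
  rw [Finset.sum_congr rfl h1, Finset.sum_comm]
  refine Finset.sum_congr rfl fun a _ => ?_
  rw [Finset.sum_comm]
  refine Finset.sum_congr rfl fun b _ => ?_
  rw [← Finset.mul_sum, Finset.sum_comm]
  congr 1
  rw [← sum_antidiagonal_box (M := T + T)
    (f := fun j i => ((Ring.choose (e - k + i) i : ℤ) : ℂ) * ((-1 : ℂ) ^ j *
          ((Ring.choose (a - 2 * h₂ - k + i + j) j : ℤ) : ℂ)) * β a b (i + j))
    (fun j i h => by rw [hβ0 _ _ _ (by omega), mul_zero])
    (fun j i h => by rw [hβ0 _ _ _ (by omega), mul_zero]) (by omega),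
    finsum_eq_sum_of_support_subset (s := Finset.range (T + T))]
  · refine Finset.sum_congr rfl fun n _ => ?_
    rw [Finset.Nat.sum_antidiagonal_eq_sum_range_succ_mk]
    -- The difference of the upper entries no longer contains k or n, which leaves the coefficients
    -- of a single power (1 + τ)^(e + 2h₂ - a).
    have h3 := sum_neg_one_pow_choose (a - 2 * h₂ - k + n) (e - k + n) n
    rw [show e - k + n - (a - 2 * h₂ - k + n) = e + 2 * h₂ - a by ring] at h3
    rw [← h3, Int.cast_sum, Finset.sum_mul]
    refine Finset.sum_congr rfl fun j hj => ?_
    have hj' : j ≤ n := Nat.lt_succ_iff.1 (Finset.mem_range.1 hj)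
    have i1 : e - k + ((n - j : ℕ) : ℤ) = e - k + n - j := by rw [Nat.cast_sub hj']; ring
    have i2 : (a : ℤ) - 2 * h₂ - k + ((n - j : ℕ) : ℤ) + j = a - 2 * h₂ - k + n := by
      rw [Nat.cast_sub hj']; ring
    change _ = _ * β a b n
    rw [i1, i2, Nat.sub_add_cancel hj']
    push_cast
    ring
  · intro n hn
    rw [Function.mem_support] at hn
    simp only [Finset.coe_range, Set.mem_Iio]
    by_contra hc
    exact hn (by
      have := hβ0 a b n (by omega)
      simp only [hβ] at this
      rw [this, mul_zero])

end Skew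

/-! ### Products and iterates at the inverted points -/

section Iterates

variable {V W : Type*} [AddCommGroup V] [Module ℂ V] [AddCommGroup W] [Module ℂ W]
  {GV : ℤ → Submodule ℂ V} {YV : V → V → ℤ → V} {vac : V} {ρV : Sl2Rep V}
  {GW : ℂ → Submodule ℂ W} {YW : V → W → ℤ → W} {ρW : Sl2Rep W}

/-- Iterates of two vertex operators are determined by the products. -/
theorem iterate_eq_zero_of_product_eq_zero (hV : IsMOSVA GV YV vac)
    (hW : IsSl2LeftModule GV YV vac ρV GW YW ρW) {h₁ h₂ : ℤ} {m n : ℂ} {u₁ u₂ : V} {w : W}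
    (hu₁ : u₁ ∈ GV h₁) (hu₂ : u₂ ∈ GV h₂) (hw : w ∈ GW m) {ψ : Module.Dual ℂ W}
    (hψ : ψ ∈ dualPiece GW n) (h : ∀ k l, ψ (YW u₁ (YW u₂ w l) k) = 0) (k l : ℤ) :
    ψ (YW (YV u₁ u₂ k) w l) = 0 := by
  by_cases hn : n = h₁ + h₂ + m + (k + l : ℤ)
  · subst hn
    obtain ⟨N, hN⟩ := hV.mode_eq_zero u₁ u₂
    -- At (1 + t, 1) with 0 < t < 1 associativity makes the iterate series sum to zero; uniqueness
    -- of Laurent coefficients finishes.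
    have key : (fun j : ℤ => ψ (YW (YV u₁ u₂ j) w (k + l - j))) = 0 := by
      refine laurent_eq_zero (N := N) (fun j hj => by
        rw [hN j hj, hW.bilinear.zero_left, map_zero]) fun t h0 h1 => ?_
      have hn : ‖(1 : ℂ) + (t : ℂ)‖ = 1 + t := by
        rw [show (1 : ℂ) + (t : ℂ) = ((1 + t : ℝ) : ℂ) by push_cast; rfl, Complex.norm_real,
          Real.norm_of_nonneg (by linarith)]
      have hsub : (1 : ℂ) + (t : ℂ) - 1 = t := by ring
      have hnt : ‖(t : ℂ)‖ = t := by rw [Complex.norm_real, Real.norm_of_nonneg h0.le]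
      obtain ⟨s, hs1, hs2⟩ := hW.associativity u₁ u₂ w ψ (dualPiece_le_gradedDual _ hψ)
        (1 + t) 1 (by rw [hn, norm_one]; linarith) (by rw [hsub, hnt, norm_one]; exact h1)
        (by rw [hsub, hnt]; exact h0)
      have hs : s = 0 := by
        refine hs1.unique (hasSum_zero.of_eq (fun κ => ?_) rfl)
        rw [prodTerm, prodCoeff_two]
        exact mul_eq_zero_of_left (h _ _) _
      rw [hs] at hs2
      refine ((hasSum_iterTerm_iff hV hW hu₁ hu₂ hw hψ _ _ _).1 hs2).of_eq (fun j => ?_) rfl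
      rw [one_zpow, mul_one, hsub]
    have := congrFun key k
    simpa using this
  · refine hψ _ (fun e => hn ?_) _ (hW.mode_mem hV (hV.mode_mem hu₁ hu₂ k) hw l)
    rw [← e]; push_cast; ring

/-- A functional on the contragredient is evaluation at a vector, as far as the products and
iterates of two given vertex operators are concerned. -/
theorem exists_eval_contragredient (hV : IsMobiusMOSVA GV YV vac ρV)
    (hW : IsSl2LeftModule GV YV vac ρV GW YW ρW) {C : ℝ} (hC : PoleOrderBound GV GW YW C)
    {h₁ h₂ : ℤ} {u₁ u₂ : V} (hu₁ : u₁ ∈ GV h₁) (hu₂ : u₂ ∈ GV h₂) {n μ : ℂ} {w' : gradedDual GW}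
    (hw' : w' ∈ dualGrading GW n) {φ : Module.Dual ℂ (gradedDual GW)}
    (hφ : φ ∈ dualPiece (dualGrading GW) μ) :
    ∃ w ∈ GW μ, (∀ k, φ (prodCoeff (contragredientOp hV hW) 2 ![u₁, u₂] w' k)
        = (prodCoeff (contragredientOp hV hW) 2 ![u₁, u₂] w' k).1 w) ∧
      ∀ k l, φ (contragredientOp hV hW (skewOpposite YV vac u₁ u₂ k) w' l)
        = (contragredientOp hV hW (skewOpposite YV vac u₁ u₂ k) w' l).1 w := by
  classical
  obtain ⟨s₀, hs₀⟩ := exists_functionals_contragredient hV hW hC ![u₁, u₂] w' μ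
  choose s hs using fun x : ℕ × ℕ => exists_functionals_prodCoeff hV.toIsMOSVA hW hC w'.2
    ![(ρV.Lpos ^ x.1) u₂, (ρV.Lpos ^ x.2) u₁] ![h₂ - x.1, h₁ - x.2] (fun i => by
      fin_cases i
      · exact hV.Lpos_pow_mem hu₂ x.1
      · exact hV.Lpos_pow_mem hu₁ x.2) μ
  obtain ⟨A₁, hA₁⟩ := hV.exists_Lpos_pow_eq_zero u₁
  obtain ⟨A₂, hA₂⟩ := hV.exists_Lpos_pow_eq_zero u₂
  set A := max A₁ A₂
  -- One w must serve products and iterates at once. The iterates add only the functionals detecting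
  -- products of L(1)^a u₂ and L(1)^b u₁, finitely many pairs, since vanishing products force
  -- vanishing iterates.
  obtain ⟨w, hw, hw1⟩ := exists_eval_eq_of_dualPiece hW.internal hφ
    (Set.range (prodCoeff (contragredientOp hV hW) 2 ![u₁, u₂] w') ∪ Set.range fun x : ℤ × ℤ =>
      contragredientOp hV hW (skewOpposite YV vac u₁ u₂ x.1) w' x.2)
    (s := s₀ ∪ (Finset.range A ×ˢ Finset.range A).biUnion s) (fun x hx h f hf => by
      rcases hf with ⟨k, rfl⟩ | ⟨⟨k, l⟩, rfl⟩
      · exact hs₀ x hx (fun f hf => h f (Finset.mem_union_left _ hf)) k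
      · rw [contragredientOp_apply, show l = k + l - k by ring,
          oppositeVertexOp_skewOpposite hV hW hu₁ hu₂ (A := A) (fun m hm => hA₁ m (by omega))
            (fun m hm => hA₂ m (by omega))]
        refine Finset.sum_eq_zero fun a ha => Finset.sum_eq_zero fun b hb => ?_
        have hz := hs (a, b) x hx fun f hf => h f (Finset.mem_union_right _
          (Finset.mem_biUnion.2 ⟨(a, b), Finset.mk_mem_product ha hb, hf⟩))
        have h0 := iterate_eq_zero_of_product_eq_zero hV.toIsMOSVA hW (hV.Lpos_pow_mem hu₂ a)
          (hV.Lpos_pow_mem hu₁ b) hx (ψ := w'.1) hw' fun k l => hz ![k, l]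
        simp only [h0, mul_zero, finsum_zero])
  exact ⟨w, hw, fun k => hw1 _ (Or.inl ⟨k, rfl⟩), fun k l => hw1 _ (Or.inr ⟨(k, l), rfl⟩)⟩

/-- The value is put in exactly the form obtained for the iterate, with `S a b` the corresponding
value on W; associativity on W' then needs only equality of the `S a b`. -/
theorem hasSum_contragredient_product (hV : IsMobiusMOSVA GV YV vac ρV)
    (hW : IsSl2LeftModule GV YV vac ρV GW YW ρW) {h₁ h₂ : ℤ} {u₁ u₂ : V} (hu₁ : u₁ ∈ GV h₁)
    (hu₂ : u₂ ∈ GV h₂) {A : ℕ} (hA₁ : ∀ m, A ≤ m → (ρV.Lpos ^ m) u₁ = 0)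
    (hA₂ : ∀ m, A ≤ m → (ρV.Lpos ^ m) u₂ = 0) {w' : gradedDual GW}
    {φ : Module.Dual ℂ (gradedDual GW)} {w : W}
    (hφ : ∀ k, φ (prodCoeff (contragredientOp hV hW) 2 ![u₁, u₂] w' k)
        = (prodCoeff (contragredientOp hV hW) 2 ![u₁, u₂] w' k).1 w) {z₁ z₂ : ℂ} (hz₁ : z₁ ≠ 0)
    (hz₂ : z₂ ≠ 0) {S : ℕ → ℕ → ℂ} (hS : ∀ a b, HasSum (prodTerm YW w'.1
      ![(ρV.Lpos ^ a) u₂, (ρV.Lpos ^ b) u₁] w ![z₂⁻¹, z₁⁻¹]) (S a b)) :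
    HasSum (prodTerm (contragredientOp hV hW) φ ![u₁, u₂] w' ![z₁, z₂])
      (∑ a ∈ Finset.range A, ∑ b ∈ Finset.range A,
        ((-1 : ℂ) ^ (h₁ + h₂) * (a.factorial : ℂ)⁻¹ * (b.factorial : ℂ)⁻¹) *
          (z₂ ^ (a - 2 * h₂) * z₁ ^ (b - 2 * h₁) * S a b)) := by
  refine hasSum_prodTerm_contragredient hV hW hφ ?_
  have e1 : (fun i : Fin 2 => (![u₁, u₂] : Fin 2 → V) i.rev) = ![u₂, u₁] := by
    funext i; fin_cases i <;> rfl
  have e2 : (fun i : Fin 2 => (![z₁, z₂] : Fin 2 → ℂ) i.rev) = ![z₂, z₁] := by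
    funext i; fin_cases i <;> rfl
  rw [e1, e2]
  have h1 := hasSum_prodTerm_expansion hW.bilinear
    (oppositeVertexOp_bilinear (YW := YW) hV hW.bilinear) (u := ![u₂, u₁])
    (A := fun _ => Finset.range A)
    (c := fun i m => (-1 : ℂ) ^ (![h₂, h₁] : Fin 2 → ℤ) i * (m.factorial : ℂ)⁻¹)
    (v := fun i m => (ρV.Lpos ^ m) ((![u₂, u₁] : Fin 2 → V) i))
    (a := fun i m => m - 2 * (![h₂, h₁] : Fin 2 → ℤ) i) (fun i x k => by
      fin_cases i
      · refine (oppositeVertexOp_of_mem hV hW.bilinear hu₂ hA₂ x k).trans ?_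
        rw [Finset.smul_sum]
        exact Finset.sum_congr rfl fun m _ => smul_smul _ _ _
      · refine (oppositeVertexOp_of_mem hV hW.bilinear hu₁ hA₁ x k).trans ?_
        rw [Finset.smul_sum]
        exact Finset.sum_congr rfl fun m _ => smul_smul _ _ _) w w'.1 (z := ![z₂, z₁])
    (fun i => by fin_cases i <;> assumption) (S := fun r => S (r 0) (r 1)) (fun r _ => by
      have e3 : (fun i : Fin 2 => (ρV.Lpos ^ (r i)) ((![u₂, u₁] : Fin 2 → V) i))
          = ![(ρV.Lpos ^ (r 0)) u₂, (ρV.Lpos ^ (r 1)) u₁] := by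
        funext i; fin_cases i <;> rfl
      have e4 : (fun i : Fin 2 => ((![z₂, z₁] : Fin 2 → ℂ) i)⁻¹) = ![z₂⁻¹, z₁⁻¹] := by
        funext i; fin_cases i <;> rfl
      rw [e3, e4]
      exact hS _ _)
  refine h1.of_eq (fun _ => rfl) ?_
  rw [← Finset.sum_product']
  refine (Finset.sum_equiv (finTwoArrowEquiv ℕ) (fun r => ?_) fun r _ => ?_).symm
  · simp [Fintype.mem_piFinset, Fin.forall_fin_two]
  · simp only [finTwoArrowEquiv_apply, Fin.prod_univ_two, Matrix.cons_val_zero,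
      Matrix.cons_val_one]
    change _ = (-1 : ℂ) ^ (h₁ + h₂) * ((r 0).factorial : ℂ)⁻¹ * ((r 1).factorial : ℂ)⁻¹ *
      (z₂ ^ ((r 0 : ℤ) - 2 * h₂) * z₁ ^ ((r 1 : ℤ) - 2 * h₁) * S (r 0) (r 1))
    rw [zpow_add₀ (by norm_num : (-1 : ℂ) ≠ 0)]
    ring

theorem hasSum_contragredient_iterate (hV : IsMobiusMOSVA GV YV vac ρV)
    (hW : IsSl2LeftModule GV YV vac ρV GW YW ρW) {h₁ h₂ : ℤ} {u₁ u₂ : V} (hu₁ : u₁ ∈ GV h₁)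
    (hu₂ : u₂ ∈ GV h₂) {A : ℕ} (hA₁ : ∀ m, A ≤ m → (ρV.Lpos ^ m) u₁ = 0)
    (hA₂ : ∀ m, A ≤ m → (ρV.Lpos ^ m) u₂ = 0) {n μ : ℂ} {w' : gradedDual GW}
    (hw' : w' ∈ dualGrading GW n) {φ : Module.Dual ℂ (gradedDual GW)} {w : W} (hw : w ∈ GW μ)
    (hφ : ∀ k l, φ (contragredientOp hV hW (skewOpposite YV vac u₁ u₂ k) w' l)
        = (contragredientOp hV hW (skewOpposite YV vac u₁ u₂ k) w' l).1 w) {z₁ z₂ : ℂ}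
    (hz : ‖z₁ - z₂‖ < ‖z₂‖) (hz' : 0 < ‖z₁ - z₂‖) {S : ℕ → ℕ → ℂ}
    (hS : ∀ a b, HasSum (iterTerm YV YW w'.1 ((ρV.Lpos ^ a) u₂) ((ρV.Lpos ^ b) u₁) w z₂⁻¹ z₁⁻¹)
      (S a b)) :
    HasSum (iterTerm (skewOpposite YV vac) (contragredientOp hV hW) φ u₁ u₂ w' z₁ z₂)
      (∑ a ∈ Finset.range A, ∑ b ∈ Finset.range A,
        ((-1 : ℂ) ^ (h₁ + h₂) * (a.factorial : ℂ)⁻¹ * (b.factorial : ℂ)⁻¹) *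
          (z₂ ^ (a - 2 * h₂) * z₁ ^ (b - 2 * h₁) * S a b)) := by
  have hz₂ : z₂ ≠ 0 := norm_pos_iff.1 (hz'.trans hz)
  have hz₁ : z₁ ≠ 0 := by
    rintro rfl
    rw [zero_sub, norm_neg] at hz
    exact lt_irrefl _ hz
  have hz₁₂ : z₁ - z₂ ≠ 0 := norm_pos_iff.1 hz'
  have term : ∀ k : ℤ × ℤ,
      iterTerm (skewOpposite YV vac) (contragredientOp hV hW) φ u₁ u₂ w' z₁ z₂ k
      = w'.1 (oppositeVertexOp GV ρV YW (skewOpposite YV vac u₁ u₂ k.1) w k.2)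
        * ((z₁ - z₂) ^ k.1 * z₂ ^ k.2) := fun k => by
    rw [iterTerm, hφ, contragredientOp_apply]
  -- Unless the weights differ by an integer, all terms on both sides vanish.
  by_cases he : ∃ e : ℤ, μ = n + h₁ + h₂ + e
  · obtain ⟨e, rfl⟩ := he
    have hinj : Function.Injective fun k : ℤ => (k, e - k) := fun a b h => by
      simpa using congrArg Prod.fst h
    rw [← hinj.hasSum_iff]
    · set τ := (z₁ - z₂) / z₂ with hτ
      have hτ0 : τ ≠ 0 := div_ne_zero hz₁₂ hz₂
      have hτ1 : ‖τ‖ < 1 := by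
        rw [hτ, norm_div, div_lt_one (norm_pos_iff.2 hz₂)]; exact hz
      have h1 : 1 + τ = z₁ / z₂ := by rw [hτ]; field_simp; ring
      set β : ℕ → ℕ → ℤ → ℂ := fun a b k =>
        w'.1 (YW (YV ((ρV.Lpos ^ a) u₂) ((ρV.Lpos ^ b) u₁) k) w
          (a + b - 2 * h₁ - 2 * h₂ - e - k)) with hβ
      -- With τ = (z₁ - z₂)/z₂ one has z₁/z₂ = 1 + τ and 1/z₂ - 1/z₁ = τ/z₁. The iterate on W is
      -- thus a Laurent series in τ, multiplied by a power of 1 + τ.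
      have hc : ∀ a b : ℕ, HasSum (fun K : ℤ =>
          (∑ᶠ j : ℕ, ((Ring.choose (e + 2 * h₂ - a) j : ℤ) : ℂ) * β a b (K - j)) * τ ^ K)
          ((1 + τ) ^ (e + 2 * h₂ - a : ℤ) *
            (z₁ ^ (a + b - 2 * h₁ - 2 * h₂ - e : ℤ) * S a b)) := fun a b => by
        obtain ⟨N, hN⟩ := hV.mode_eq_zero ((ρV.Lpos ^ a) u₂) ((ρV.Lpos ^ b) u₁)
        refine hasSum_choose_mul (β := β a b) (A := e + 2 * h₂ - a) hτ0 hτ1 (N := N)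
          (fun k hk => ?_) ?_
        · simp only [hβ]
          rw [hN k hk, hW.bilinear.zero_left, map_zero]
        have h2 := (hasSum_iterTerm_iff hV.toIsMOSVA hW (hV.Lpos_pow_mem hu₂ a)
          (hV.Lpos_pow_mem hu₁ b) hw (e := a + b - 2 * h₁ - 2 * h₂ - e) (φ := w'.1) (by
            convert (show w'.1 ∈ dualPiece GW n from hw') using 1
            push_cast; ring_nf) _ _ _).1 (hS a b)
        refine (h2.mul_left (z₁ ^ (a + b - 2 * h₁ - 2 * h₂ - e : ℤ))).of_eq (fun k => ?_) rfl
        have h3 : z₂⁻¹ - z₁⁻¹ = τ * z₁⁻¹ := by rw [hτ]; field_simp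
        simp only [hβ]
        generalize (a + b - 2 * h₁ - 2 * h₂ - e : ℤ) = E
        rw [h3, mul_zpow, zpow_sub₀ (inv_ne_zero hz₁), inv_zpow, inv_zpow]
        have e1 := zpow_ne_zero k hz₁
        have e2 := zpow_ne_zero E hz₁
        field_simp
      have hsum := hasSum_sum fun a (_ : a ∈ Finset.range A) => hasSum_sum fun b
        (_ : b ∈ Finset.range A) => (hc a b).mul_left
          (z₂ ^ e * ((-1 : ℂ) ^ (h₁ + h₂) * (a.factorial : ℂ)⁻¹ * (b.factorial : ℂ)⁻¹))
      refine hsum.of_eq (fun k => ?_) ?_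
      · rw [Function.comp_apply, term, oppositeVertexOp_skewOpposite hV hW hu₁ hu₂ hA₁ hA₂,
          Finset.sum_mul]
        refine Finset.sum_congr rfl fun a _ => ?_
        rw [Finset.sum_mul]
        refine Finset.sum_congr rfl fun b _ => ?_
        rw [hτ, div_zpow, zpow_sub₀ hz₂]
        ring
      · refine Finset.sum_congr rfl fun a _ => Finset.sum_congr rfl fun b _ => ?_
        have h4 : z₂ ^ (a - 2 * h₂ : ℤ) * z₁ ^ (b - 2 * h₁ : ℤ)
            = z₂ ^ e * ((1 + τ) ^ (e + 2 * h₂ - a : ℤ) *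
              z₁ ^ (a + b - 2 * h₁ - 2 * h₂ - e : ℤ)) := by
          rw [h1, div_zpow, show (b - 2 * h₁ : ℤ) = (e + 2 * h₂ - a)
            + (a + b - 2 * h₁ - 2 * h₂ - e) by ring, zpow_add₀ hz₁,
            show (a - 2 * h₂ : ℤ) = e - (e + 2 * h₂ - a) by ring, zpow_sub₀ hz₂]
          ring
        rw [h4]; ring
    · intro k hk
      rw [term]
      have hne : (n + h₁ + h₂ + e) - ((h₁ + h₂ + k.1 : ℤ) : ℂ) - k.2 ≠ n := by
        intro h
        refine hk ⟨k.1, ?_⟩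
        have h' : ((k.1 + k.2 : ℤ) : ℂ) = e := by
          push_cast at h ⊢; linear_combination -h
        have h'' : k.1 + k.2 = e := by exact_mod_cast h'
        ext
        · rfl
        · simp; omega
      exact mul_eq_zero_of_left (hw' _ hne _
        (oppositeVertexOp_mem hV hW (skewOpposite_mem hV hu₁ hu₂ k.1) hw k.2)) _
  · have hne : ∀ k l : ℤ, μ - ((h₁ + h₂ + k : ℤ) : ℂ) - l ≠ n := fun k l h =>
      he ⟨k + l, by rw [← h]; push_cast; ring⟩
    have hS0 : ∀ a b, S a b = 0 := fun a b => by
      refine (hS a b).unique (hasSum_zero.of_eq (fun k => ?_) rfl)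
      rw [iterTerm]
      refine mul_eq_zero_of_left (hw' _ (fun h => he ⟨-(k.1 + k.2) - 2 * h₁ - 2 * h₂ + a + b, ?_⟩) _
        (hW.mode_mem hV.toIsMOSVA (hV.mode_mem (hV.Lpos_pow_mem hu₂ a) (hV.Lpos_pow_mem hu₁ b) k.1)
          hw k.2)) _
      rw [← h]; push_cast; ring
    refine hasSum_zero.of_eq (fun k => ?_) ?_
    · rw [term]
      exact mul_eq_zero_of_left (hw' _ (hne k.1 k.2) _
        (oppositeVertexOp_mem hV hW (skewOpposite_mem hV hu₁ hu₂ k.1) hw k.2)) _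
    · refine Finset.sum_eq_zero fun a _ => Finset.sum_eq_zero fun b _ => ?_
      rw [hS0, mul_zero, mul_zero]

end Iterates

/-! ### Reduction to homogeneous arguments -/

section Additivity

theorem prodTerm_two {V W : Type*} [AddCommGroup W] [Module ℂ W] (Y : V → W → ℤ → W)
    (φ : Module.Dual ℂ W) (u₁ u₂ : V) (w : W) (z₁ z₂ : ℂ) (k : Fin 2 → ℤ) :
    prodTerm Y φ ![u₁, u₂] w ![z₁, z₂] k
      = φ (Y u₁ (Y u₂ w (k 1)) (k 0)) * (z₁ ^ k 0 * z₂ ^ k 1) := by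
  rw [prodTerm, prodCoeff_two, Fin.prod_univ_two]
  rfl

variable {V W : Type*} [AddCommGroup V] [Module ℂ V] [AddCommGroup W] [Module ℂ W]

/-- A property of two vectors of an algebra, a vector in a module and a functional, which is
additive in each argument, holds if it holds for homogeneous arguments. -/
theorem homogeneous_induction {GV : ℤ → Submodule ℂ V}
    {G : ℂ → Submodule ℂ W} (hV : DirectSum.IsInternal GV) (hG : DirectSum.IsInternal G)
    {P : V → V → W → Module.Dual ℂ W → Prop}
    (homog : ∀ h₁ h₂ n μ, ∀ u₁ ∈ GV h₁, ∀ u₂ ∈ GV h₂, ∀ w ∈ G n, ∀ φ ∈ dualPiece G μ, P u₁ u₂ w φ)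
    (add₁ : ∀ u u' v w φ, P u v w φ → P u' v w φ → P (u + u') v w φ)
    (add₂ : ∀ u v v' w φ, P u v w φ → P u v' w φ → P u (v + v') w φ)
    (add₃ : ∀ u v w w' φ, P u v w φ → P u v w' φ → P u v (w + w') φ)
    (add₄ : ∀ u v w φ φ', P u v w φ → P u v w φ' → P u v w (φ + φ')) (u₁ u₂ : V) (w : W)
    {φ : Module.Dual ℂ W} (hφ : φ ∈ gradedDual G) : P u₁ u₂ w φ := by
  have h4 : ∀ h₁ h₂ n, ∀ u₁ ∈ GV h₁, ∀ u₂ ∈ GV h₂, ∀ w ∈ G n, P u₁ u₂ w φ := by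
    intro h₁ h₂ n u₁ hu₁ u₂ hu₂ w hw
    refine gradedDualInduction hφ (fun μ φ hφ => ?_) ?_ fun f g hf hg => add₄ _ _ _ _ _ hf hg
    · exact homog h₁ h₂ n μ u₁ hu₁ u₂ hu₂ w hw φ hφ
    · exact homog h₁ h₂ n 0 u₁ hu₁ u₂ hu₂ w hw 0 (zero_mem _)
  have h3 : ∀ h₁ h₂, ∀ u₁ ∈ GV h₁, ∀ u₂ ∈ GV h₂, P u₁ u₂ w φ := by
    intro h₁ h₂ u₁ hu₁ u₂ hu₂
    induction w using gradedInduction hG with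
    | homog n w hw => exact h4 h₁ h₂ n u₁ hu₁ u₂ hu₂ w hw
    | zero => exact h4 h₁ h₂ 0 u₁ hu₁ u₂ hu₂ 0 (zero_mem _)
    | add x y hx hy => exact add₃ _ _ _ _ _ hx hy
  have h2 : ∀ h₁, ∀ u₁ ∈ GV h₁, P u₁ u₂ w φ := by
    intro h₁ u₁ hu₁
    induction u₂ using gradedInduction hV with
    | homog h₂ u₂ hu₂ => exact h3 h₁ h₂ u₁ hu₁ u₂ hu₂
    | zero => exact h3 h₁ 0 u₁ hu₁ 0 (zero_mem _)
    | add x y hx hy => exact add₂ _ _ _ _ _ hx hy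
  induction u₁ using gradedInduction hV with
  | homog h₁ u₁ hu₁ => exact h2 h₁ u₁ hu₁
  | zero => exact h2 0 0 (zero_mem _)
  | add x y hx hy => exact add₁ _ _ _ _ _ hx hy

end Additivity

/-! ### Associativity and rationality of iterates on the contragredient -/

section Associativity

variable {V W : Type*} [AddCommGroup V] [Module ℂ V] [AddCommGroup W] [Module ℂ W]
  {GV : ℤ → Submodule ℂ V} {YV : V → V → ℤ → V} {vac : V} {ρV : Sl2Rep V}
  {GW : ℂ → Submodule ℂ W} {YW : V → W → ℤ → W} {ρW : Sl2Rep W}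

/-- Since ‖1/z₂ - 1/z₁‖ = (‖z₁ - z₂‖/‖z₂‖)·‖1/z₁‖, inversion with exchange of the variables
preserves the region of the iterate. -/
theorem norm_inv_sub_inv_lt {z₁ z₂ : ℂ} (hz : ‖z₁ - z₂‖ < ‖z₂‖) (hz' : 0 < ‖z₁ - z₂‖) :
    z₁ ≠ 0 ∧ z₂ ≠ 0 ∧ ‖z₂⁻¹ - z₁⁻¹‖ < ‖z₁⁻¹‖ ∧ 0 < ‖z₂⁻¹ - z₁⁻¹‖ := by
  have hz₂ : z₂ ≠ 0 := norm_pos_iff.1 (hz'.trans hz)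
  have hz₁ : z₁ ≠ 0 := by
    rintro rfl
    rw [zero_sub, norm_neg] at hz
    exact lt_irrefl _ hz
  have h1 : ‖z₂⁻¹ - z₁⁻¹‖ = ‖z₁ - z₂‖ / ‖z₂‖ * ‖z₁⁻¹‖ := by
    rw [inv_sub_inv hz₂ hz₁, norm_div, norm_mul, norm_inv, div_mul_eq_div_div, div_eq_mul_inv]
  have h2 : 0 < ‖z₁⁻¹‖ := norm_pos_iff.2 (inv_ne_zero hz₁)
  have h3 : 0 < ‖z₂‖ := norm_pos_iff.2 hz₂
  refine ⟨hz₁, hz₂, ?_, ?_⟩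
  · rw [h1]
    exact mul_lt_of_lt_one_left h2 ((div_lt_one h3).2 hz)
  · rw [h1]; positivity

theorem contragredient_associativity (hV : IsMobiusMOSVA GV YV vac ρV)
    (hW : IsSl2LeftModule GV YV vac ρV GW YW ρW) {C : ℝ} (hC : PoleOrderBound GV GW YW C) :
    VertexAssociativity (dualGrading GW) (skewOpposite YV vac) (contragredientOp hV hW) := by
  have hY := contragredientOp_bilinear hV hW
  intro u₁ u₂ w' φ hφ z₁ z₂ hz₁₂ hz hz'
  obtain ⟨hz₁, hz₂, hy, hy'⟩ := norm_inv_sub_inv_lt hz hz'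
  refine homogeneous_induction hV.internal (dualGrading_internal hW.internal)
    (P := fun u₁ u₂ w' φ => ∃ s : ℂ, HasSum (prodTerm (contragredientOp hV hW) φ ![u₁, u₂] w'
      ![z₁, z₂]) s ∧ HasSum (iterTerm (skewOpposite YV vac) (contragredientOp hV hW) φ u₁ u₂ w'
      z₁ z₂) s) ?_ ?_ ?_ ?_ ?_ u₁ u₂ w' hφ
  · intro h₁ h₂ n μ u₁ hu₁ u₂ hu₂ w' hw' φ hφ
    obtain ⟨w, hw, hw1, hw2⟩ := exists_eval_contragredient hV hW hC hu₁ hu₂ hw' hφ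
    obtain ⟨A₁, hA₁⟩ := hV.exists_Lpos_pow_eq_zero u₁
    obtain ⟨A₂, hA₂⟩ := hV.exists_Lpos_pow_eq_zero u₂
    -- Associativity on W at (1/z₂, 1/z₁) gives product and iterate the same values `S a b`, hence
    -- the same sum on W'.
    choose S hS1 hS2 using fun a b => hW.associativity ((ρV.Lpos ^ a) u₂) ((ρV.Lpos ^ b) u₁) w
      w'.1 w'.2 z₂⁻¹ z₁⁻¹ (by
        rw [norm_inv, norm_inv]; exact inv_strictAnti₀ (norm_pos_iff.2 hz₂) hz₁₂) hy hy'
    exact ⟨_, hasSum_contragredient_product hV hW hu₁ hu₂ (A := max A₁ A₂)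
      (fun m hm => hA₁ m (by omega)) (fun m hm => hA₂ m (by omega)) hw1 hz₁ hz₂ hS1,
      hasSum_contragredient_iterate hV hW hu₁ hu₂ (A := max A₁ A₂) (fun m hm => hA₁ m (by omega))
      (fun m hm => hA₂ m (by omega)) hw' hw hw2 hz hz' hS2⟩
  all_goals
    intro _ _ _ _ _ ⟨s, hs1, hs2⟩ ⟨t, ht1, ht2⟩
    refine ⟨s + t, (hs1.add ht1).of_eq (fun k => ?_) rfl, (hs2.add ht2).of_eq (fun k => ?_) rfl⟩
    · simp only [prodTerm_two, hY.add_left, hY.add_right, map_add, LinearMap.add_apply, add_mul]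
    · simp only [iterTerm, skewOpposite_add_left hV, skewOpposite_add_right hV, hY.add_left,
        hY.add_right, map_add, LinearMap.add_apply, add_mul]

theorem contragredient_iterateRationality (hV : IsMobiusMOSVA GV YV vac ρV)
    (hW : IsSl2LeftModule GV YV vac ρV GW YW ρW) {C : ℝ} (hC : PoleOrderBound GV GW YW C) :
    IterateRationality (dualGrading GW) (skewOpposite YV vac) (contragredientOp hV hW) := by
  have hY := contragredientOp_bilinear hV hW
  let R : Set (Fin 2 → ℂ) := {z | ‖z 0 - z 1‖ < ‖z 1‖ ∧ 0 < ‖z 0 - z 1‖}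
  have hR : ∀ z ∈ R, ∀ i, z i ≠ 0 := fun z hz i => by
    obtain ⟨h1, h2, -⟩ := norm_inv_sub_inv_lt hz.1 hz.2
    fin_cases i <;> assumption
  have hR' : ∀ z ∈ R, ∀ i j, i < j → z i ≠ z j := fun z hz i j hij e => by
    obtain rfl : i = 0 := by omega
    obtain rfl : j = 1 := by omega
    exact hz.2.ne' (by rw [e, sub_self, norm_zero])
  intro u₁ u₂ w' φ hφ
  have key : ∃ F ∈ rationalOn R, ∀ z ∈ R, HasSum (iterTerm (skewOpposite YV vac)
      (contragredientOp hV hW) φ u₁ u₂ w' (z 0) (z 1)) (F z) := by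
    refine homogeneous_induction hV.internal (dualGrading_internal hW.internal)
      (P := fun u₁ u₂ w' φ => ∃ F ∈ rationalOn R, ∀ z ∈ R, HasSum (iterTerm (skewOpposite YV vac)
        (contragredientOp hV hW) φ u₁ u₂ w' (z 0) (z 1)) (F z)) ?_ ?_ ?_ ?_ ?_ u₁ u₂ w' hφ
    · intro h₁ h₂ n μ u₁ hu₁ u₂ hu₂ w' hw' φ hφ
      obtain ⟨w, hw, -, hw2⟩ := exists_eval_contragredient hV hW hC hu₁ hu₂ hw' hφ
      obtain ⟨A₁, hA₁⟩ := hV.exists_Lpos_pow_eq_zero u₁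
      obtain ⟨A₂, hA₂⟩ := hV.exists_Lpos_pow_eq_zero u₂
      choose f p₁ p₂ p₁₂ hf using fun a b => hW.iterate_rationality ((ρV.Lpos ^ a) u₂)
        ((ρV.Lpos ^ b) u₁) w w'.1 w'.2
      have hi := coord_inv_mem_rationalOn hR
      refine ⟨_, ?_, fun z hz => by
        obtain ⟨-, -, hy, hy'⟩ := norm_inv_sub_inv_lt hz.1 hz.2
        exact hasSum_contragredient_iterate hV hW hu₁ hu₂ (A := max A₁ A₂)
          (fun m hm => hA₁ m (by omega)) (fun m hm => hA₂ m (by omega)) hw' hw hw2 hz.1 hz.2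
          fun a b => hf a b _ _ hy hy'⟩
      have h1 : ∀ a b : ℕ, (fun z : Fin 2 → ℂ => MvPolynomial.eval ![(z 1)⁻¹, (z 0)⁻¹] (f a b) /
          ((z 1)⁻¹ ^ p₁ a b * (z 0)⁻¹ ^ p₂ a b * ((z 1)⁻¹ - (z 0)⁻¹) ^ p₁₂ a b))
            ∈ rationalOn R := by
        intro a b
        refine rationalOn_congr (eval_div_mem_rationalOn (m := 2)
          (y := ![fun z => (z 1)⁻¹, fun z => (z 0)⁻¹]) (fun i => by
            fin_cases i
            · exact hi 1
            · exact hi 0) (fun i => by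
            fin_cases i
            · exact rationalOn_congr (coord_mem_rationalOn 1) fun z _ => inv_inv _
            · exact rationalOn_congr (coord_mem_rationalOn 0) fun z _ => inv_inv _)
          (fun i j hij => by
            obtain rfl : i = 0 := by omega
            obtain rfl : j = 1 := by omega
            refine rationalOn_congr (mul_mem (mul_mem (coord_mem_rationalOn 1)
              (coord_mem_rationalOn 0)) (sub_inv_mem_rationalOn hR' zero_lt_one)) fun z hz => ?_
            simp only [Pi.mul_apply, Matrix.cons_val_zero, Matrix.cons_val_one]
            rw [inv_sub_inv (hR z hz 1) (hR z hz 0), inv_div, div_eq_mul_inv])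
          (f a b) ![p₁ a b, p₂ a b] fun _ _ => p₁₂ a b) fun z _ => ?_
        have e1 : (fun i : Fin 2 => (![fun z => (z 1)⁻¹, fun z => (z 0)⁻¹] :
            Fin 2 → (Fin 2 → ℂ) → ℂ) i z) = ![(z 1)⁻¹, (z 0)⁻¹] := by
          funext i; fin_cases i <;> rfl
        have e2 : Finset.Ioi (0 : Fin 2) = {1} := rfl
        have e3 : Finset.Ioi (1 : Fin 2) = ∅ := rfl
        rw [e1, Fin.prod_univ_two, Fin.prod_univ_two, e2, e3, Finset.prod_singleton,
          Finset.prod_empty, mul_one]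
        rfl
      refine rationalOn_congr (sum_mem fun a (_ : a ∈ Finset.range (max A₁ A₂)) =>
        sum_mem fun b (_ : b ∈ Finset.range (max A₁ A₂)) =>
          mul_mem ((rationalOn R).algebraMap_mem
            ((-1 : ℂ) ^ (h₁ + h₂) * (a.factorial : ℂ)⁻¹ * (b.factorial : ℂ)⁻¹))
          (mul_mem (mul_mem (coord_zpow_mem_rationalOn hR 1 (a - 2 * h₂))
            (coord_zpow_mem_rationalOn hR 0 (b - 2 * h₁))) (h1 a b))) fun z _ => ?_
      simp only [Finset.sum_apply, Pi.mul_apply, Pi.algebraMap_apply, Algebra.algebraMap_self,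
        RingHom.id_apply]
    all_goals
      intro _ _ _ _ _ ⟨F, hF, hs⟩ ⟨F', hF', ht⟩
      refine ⟨F + F', add_mem hF hF', fun z hz => ((hs z hz).add (ht z hz)).of_eq (fun k => ?_) rfl⟩
      simp only [iterTerm, skewOpposite_add_left hV, skewOpposite_add_right hV, hY.add_left,
        hY.add_right, map_add, LinearMap.add_apply, add_mul]
  obtain ⟨F, hF, hs⟩ := key
  obtain ⟨N, f, hf⟩ := exists_of_mem_rationalOn hR hR' hF
  refine ⟨f, N, N, N, fun z₁ z₂ h1 h2 => ?_⟩
  have h3 := hs ![z₁, z₂] ⟨h1, h2⟩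
  rw [hf ![z₁, z₂] ⟨h1, h2⟩, Fin.prod_univ_two, Fin.prod_univ_two,
    show Finset.Ioi (0 : Fin 2) = {1} from rfl, show Finset.Ioi (1 : Fin 2) = ∅ from rfl,
    Finset.prod_singleton, Finset.prod_empty, mul_one] at h3
  exact h3

end Associativity

/-! ### Local nilpotency of L(0) on the contragredient -/

section Nilpotency

variable {V W : Type*} [AddCommGroup V] [Module ℂ V] [AddCommGroup W] [Module ℂ W]
  {GV : ℤ → Submodule ℂ V} {YV : V → V → ℤ → V} {vac : V} {ρV : Sl2Rep V}
  {GW : ℂ → Submodule ℂ W} {YW : V → W → ℤ → W} {ρW : Sl2Rep W}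

theorem contragredientRep_Lzero_pow (hW : IsMobiusLeftModule GV YV vac ρV GW YW ρW) (n : ℂ) (m : ℕ)
    (f : gradedDual GW) : ((((contragredientRep hW).Lzero - n • 1) ^ m) f).1
      = f.1 ∘ₗ (ρW.Lzero - n • 1) ^ m := by
  have h : ∀ g : gradedDual GW, (((contragredientRep hW).Lzero - n • 1) g).1
      = g.1 ∘ₗ (ρW.Lzero - n • 1) := fun g => by
    ext w
    change g.1 (ρW.Lzero w) - n * g.1 w = g.1 (ρW.Lzero w - n • w)
    rw [map_sub, map_smul, smul_eq_mul]
  induction m with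
  | zero => rfl
  | succ m ih => rw [pow_succ', Module.End.mul_apply, h, ih, pow_succ]; rfl

theorem contragredient_locally_nilpotent_iff (hW : IsMobiusLeftModule GV YV vac ρV GW YW ρW) :
    (∀ n, ∀ f ∈ dualGrading GW n, ∃ m : ℕ, (((contragredientRep hW).Lzero - n • 1) ^ m) f = 0) ↔
      ∀ n : ℂ, ∃ m : ℕ, ∀ w ∈ GW n, ((ρW.Lzero - n • 1) ^ m) w = 0 := by
  have hT : ∀ n j : ℂ, ∀ w ∈ GW j, (ρW.Lzero - n • 1) w ∈ GW j := fun n j w hw => by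
    have h1 := hW.Lzero_mem j w hw
    rw [add_zero] at h1
    exact sub_mem h1 (Submodule.smul_mem _ n hw)
  have hTm : ∀ (n j : ℂ) (m : ℕ), ∀ w ∈ GW j, ((ρW.Lzero - n • 1) ^ m) w ∈ GW j :=
      fun n j m w hw => by
    induction m with
    | zero => exact hw
    | succ m ih => rw [pow_succ', Module.End.mul_apply]; exact hT n j _ ih
  constructor
  · intro h n
    let T : Module.End ℂ (GW n) := (ρW.Lzero - n • 1).restrict (hT n n)
    have hTpow : ∀ (m : ℕ) (x : GW n), ((T ^ m) x : W) = ((ρW.Lzero - n • 1) ^ m) x := fun m x => by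
      rw [Module.End.pow_restrict]; rfl
    -- Composition with the projection extends every functional on W_[n] to an element of W'_[n], so
    -- the hypothesis on W' reaches the whole dual of W_[n].
    let P : W →ₗ[ℂ] GW n := (gradedProj GW n).codRestrict (GW n) (gradedProj_mem hW.internal n)
    obtain ⟨m, hm⟩ := exists_pow_eq_zero_of_dual T fun f => by
      have hf : f ∘ₗ P ∈ dualPiece GW n := fun j hj x hx => by
        have : P x = 0 := Subtype.ext (gradedProj_of_mem_ne hW.internal hj hx)
        rw [LinearMap.comp_apply, this, map_zero]
      obtain ⟨m, hm⟩ := h n ⟨f ∘ₗ P, dualPiece_le_gradedDual n hf⟩ hf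
      refine ⟨m, LinearMap.ext fun x => ?_⟩
      have h1 := LinearMap.congr_fun (congrArg Subtype.val hm) (x : W)
      rw [contragredientRep_Lzero_pow] at h1
      have h2 : P (((ρW.Lzero - n • 1) ^ m) (x : W)) = (T ^ m) x := by
        refine Subtype.ext ?_
        rw [hTpow]
        exact gradedProj_of_mem hW.internal (hTm n n m x x.2)
      change f (P (((ρW.Lzero - n • 1) ^ m) (x : W))) = 0 at h1
      rw [h2] at h1
      exact h1
    refine ⟨m, fun w hw => ?_⟩
    rw [← hTpow m ⟨w, hw⟩, hm]; rfl
  · intro h n f hf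
    obtain ⟨m, hm⟩ := h n
    refine ⟨m, Subtype.ext ?_⟩
    rw [contragredientRep_Lzero_pow]
    ext w
    change f.1 (((ρW.Lzero - n • 1) ^ m) w) = 0
    induction w using gradedInduction hW.internal with
    | homog j w hw =>
      by_cases hj : j = n
      · subst hj; rw [hm w hw, map_zero]
      · exact hf j hj _ (hTm n j m w hw)
    | zero => rw [map_zero, map_zero]
    | add x y hx hy => rw [map_add, map_add, hx, hy, add_zero]

end Nilpotency

theorem mainTheorem8 {V W : Type*} [AddCommGroup V] [Module ℂ V] [AddCommGroup W] [Module ℂ W]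
    (GV : ℤ → Submodule ℂ V) (YV : V → V → ℤ → V) (vac : V) (ρV : Sl2Rep V)
    (hV : IsMobiusMOSVA GV YV vac ρV)
    (GW : ℂ → Submodule ℂ W) (YW : V → W → ℤ → W) (ρW : Sl2Rep W)
    (hW : IsMobiusLeftModule GV YV vac ρV GW YW ρW)
    (hpole : StrongPoleOrder GV GW YW) :
    ∃ (YW' : V → gradedDual GW → ℤ → gradedDual GW) (ρW' : Sl2Rep (gradedDual GW)),
      ((∀ (u : V) (w' : gradedDual GW) (k : ℤ) (w : W),
          (YW' u w' k : Module.Dual ℂ W) w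
            = (w' : Module.Dual ℂ W) (oppositeVertexOp GV ρV YW u w k)) ∧
        (∀ (w' : gradedDual GW) (w : W),
          (ρW'.Lneg w' : Module.Dual ℂ W) w = (w' : Module.Dual ℂ W) (ρW.Lpos w) ∧
          (ρW'.Lzero w' : Module.Dual ℂ W) w = (w' : Module.Dual ℂ W) (ρW.Lzero w) ∧
          (ρW'.Lpos w' : Module.Dual ℂ W) w = (w' : Module.Dual ℂ W) (ρW.Lneg w))) ∧
      IsSl2LeftModule GV (skewOpposite YV vac) vac ρV (dualGrading GW) YW' ρW' ∧
      (IsMobiusLeftModule GV (skewOpposite YV vac) vac ρV (dualGrading GW) YW' ρW' ↔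
        ∀ n : ℂ, ∃ m : ℕ, ∀ w ∈ GW n, ((ρW.Lzero - n • 1) ^ m) w = 0) := by
  obtain ⟨C, hC⟩ := hpole
  have hC : PoleOrderBound GV GW YW C := hC
  have hW' := hW.toIsSl2LeftModule
  have key := contragredient_isSl2LeftModule hV hW (contragredient_productRationality hV hW' hC)
    (contragredient_iterateRationality hV hW' hC) (contragredient_associativity hV hW' hC)
  exact ⟨contragredientOp hV hW', contragredientRep hW, ⟨fun u w' k w => rfl,
    fun w' w => ⟨rfl, rfl, rfl⟩⟩, key,
    fun h => (contragredient_locally_nilpotent_iff hW).1 h.locally_nilpotent,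
    fun h => { key with locally_nilpotent := (contragredient_locally_nilpotent_iff hW).2 h }⟩
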